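/- For $a>0$ let $\mathbb S^3_a=\{(z,w)\in\mathbb C^2: |z|^2/a^2+|w|^2=1\}$, let $\mathbb S^1$ act on it by multiplication on $w$, and identify the orbit space with $\Omega_a=\{(z,r)\in\mathbb C\times\mathbb R:|z|^2/a^2+r^2=1,\ r\ge 0\}$ through $(z,w)\mapsto(z,|w|)$. Give $\Omega_a$ the metric $4\pi^2r^2\,\check g_a$, where $\check g_a$ is the metric induced from $\mathbb C\times\mathbb R$. In polar coordinates $z=a\sin\phi\,e^{i\theta}$, $r=\cos\phi$, with $\rho=2\pi\int_0^\phi\cos\xi\sqrt{a^2\cos^2\xi+\sin^2\xi}\,d\xi\in[0,L_a]$, it is $d\rho^2+\varphi(\rho)^2d\theta^2$, with $\varphi=\pi a\sin 2\phi$. Let $O=\{\rho=0\}$, let $D(0)=\Omega_a\cap\{\operatorname{Im}z=0\}$, and let $\rho_{a,0}$ be the value of $\rho$ at $\phi=\pi/4$; the Clifford geodesic is $t\mapsto(\rho_{a,0},t)$. Fix a real analytic function $(a,s)\mapsto\beta_a(s)$ on $(0,\infty)\times(-1,1)$ such that, for each $a$, $\beta_a$ maps $(-1,1)$ onto $(0,L_a)$,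 $\beta_a'>0$ and $\beta_a(0)=\rho_{a,0}$. Let $\gamma_{a,s}(t)=(\rho_{a,s}(t),\theta_{a,s}(t))$, $t\in\mathbb R$, be the geodesic of $\Omega_a$ with $\gamma_{a,s}(0)=(\beta_a(s),0)$ and $\dot\gamma_{a,s}(0)=(0,1)$. For $k\ge1$ let $\ell_k(a,s)>0$ be the time with $\theta_{a,s}(\ell_k(a,s))=k\pi$, and let $f_k(a,s)=\dot\rho_{a,s}(\ell_k(a,s))$. Let $\mathcal B_{\rm triv}=\{(a,0):a>0\}$. For integers $0<j<2k$ with $\gcd(j,k)=1$, let $\mathcal B_{(j,k)}$ be the connected component containing $(a^j_k,0)$, where $a^j_k=\frac{j/k}{\sqrt{4-(j/k)^2}}$, of the closure of $f_k^{-1}(0)\setminus\mathcal B_{\rm triv}$ in $(0,\infty)\times(-1,1)$. Then: (i) Let $(a,s)\in\mathcal B_{(j,k)}\setminus\mathcal B_{\rm triv}$ and $\ell=\ell_k(a,s)$. Then $\gamma_{a,s}$ restricted to $[-\ell,\ell]$ is a closed geodesic in $\Omega_a$. It meets the Clifford geodesic at exactly $2j$ instants $t\in[-\ell,\ell]$,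 and it has winding number $k$ around $O$. It self-intersects along $D(0)$ at exactly $k-1$ instants: there are exactly $k-1$ pairs $-\ell\le t_1<t_2<\ell$ with $\gamma_{a,s}(t_1)=\gamma_{a,s}(t_2)\in D(0)$, and these give exactly $k-1$ points of $D(0)$. (ii) If $(j,k)\ne(j',k')$, then $\mathcal B_{(j,k)}\cap\mathcal B_{(j',k')}=\emptyset$. (iii) If $(j,k)\ne(j',k')$, $(a,s)\in\mathcal B_{(j,k)}$ and $(a,s')\in\mathcal B_{(j',k')}$, then no isometry of $\mathbb S^3_a$ (with the Riemannian metric induced from $\mathbb C^2$) maps the preimage of $\gamma_{a,s}(\mathbb R)$ under $\mathbb S^3_a\to\Omega_a$ onto the preimage of $\gamma_{a,s'}(\mathbb R)$. -/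

import Mathlib

open Real Set Topology
open scoped ContDiff

noncomputable section

namespace EllipsoidTori

/-! ### The disk `Ω_a` in polar coordinates -/

/-- The density of the arclength function: the metric of `Ω_a` restricted to a ray
is `(2π cos ξ √(a² cos² ξ + sin² ξ))² dξ²`. -/
def arclengthDensity (a ξ : ℝ) : ℝ :=
  2 * π * (cos ξ * √(a ^ 2 * cos ξ ^ 2 + sin ξ ^ 2))

/-- The arclength function `ρ(φ)`, `0 ≤ φ ≤ π / 2`, along a ray from the centre `O` of `Ω_a`. -/
def arclength (a φ : ℝ) : ℝ := ∫ ξ in (0 : ℝ)..φ, arclengthDensity a ξ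

/-- `L_a`, the distance from the centre `O` to the boundary of `Ω_a`. -/
def totalLength (a : ℝ) : ℝ := arclength a (π / 2)

/-- `φ(ρ)`, the inverse of the arclength function `[0, π / 2] → [0, L_a]`. -/
def latitude (a : ℝ) : ℝ → ℝ := Function.invFunOn (arclength a) (Icc 0 (π / 2))

/-- The warping function: the metric of `Ω_a` is `dρ² + (warp a ρ)² dθ²`. -/
def warp (a ρ : ℝ) : ℝ := π * a * sin (2 * latitude a ρ)

/-- The point of `Ω_a = {(z, r) : |z|² / a² + r² = 1, r ≥ 0}` (the orbit space of the ellipsoid)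
with polar coordinates `(ρ, θ)`. The centre `O` is `(0, 1)`. -/
def diskPoint (a : ℝ) (x : ℝ × ℝ) : ℂ × ℝ :=
  ((a * sin (latitude a x.1) : ℝ) * Complex.exp (x.2 * Complex.I), cos (latitude a x.1))

/-- The radial segment `σ(θ)` issuing from `O`. -/
def radialSegment (a θ : ℝ) : Set (ℂ × ℝ) :=
  (fun ρ => diskPoint a (ρ, θ)) '' Ioo 0 (totalLength a)

/-- The diameter `D(θ)` of `Ω_a`. -/
def diameter (a θ : ℝ) : Set (ℂ × ℝ) :=
  closure (radialSegment a θ ∪ radialSegment a (θ + π))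

/-- `t ↦ γ t = (ρ(t), θ(t))`, `t ∈ ℝ`, is a geodesic of the metric `dρ² + (warp a ρ)² dθ²`,
lying in the interior of `Ω_a` minus `O`. -/
structure IsGeodesic (a : ℝ) (γ : ℝ → ℝ × ℝ) : Prop where
  mem : ∀ t, (γ t).1 ∈ Ioo 0 (totalLength a)
  diff_rho : Differentiable ℝ (fun t => (γ t).1)
  diff_theta : Differentiable ℝ (fun t => (γ t).2)
  eq_rho : ∀ t, HasDerivAt (deriv fun t => (γ t).1)
    (warp a (γ t).1 * deriv (warp a) (γ t).1 * deriv (fun t => (γ t).2) t ^ 2) t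
  eq_theta : ∀ t, HasDerivAt (deriv fun t => (γ t).2)
    (-(2 * (deriv (warp a) (γ t).1 / warp a (γ t).1) *
      deriv (fun t => (γ t).1) t * deriv (fun t => (γ t).2) t)) t

/-- `γ` is the geodesic of `Ω_a` with `γ(0) = (b, 0)` and `γ'(0) = (0, 1)`; it starts
orthogonally to `σ(0)`. -/
structure IsOrthogonalGeodesic (a b : ℝ) (γ : ℝ → ℝ × ℝ) : Prop where
  geodesic : IsGeodesic a γ
  init : γ 0 = (b, 0)
  init_rho : deriv (fun t => (γ t).1) 0 = 0
  init_theta : deriv (fun t => (γ t).2) 0 = 1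

/-- The restriction of `γ` to `[t₀, t₁]` is a closed geodesic in `Ω_a`: `γ` is a geodesic, and as
a curve of points of `Ω_a` it is periodic with period `t₁ - t₀`. -/
def IsClosedGeodesicOn (a : ℝ) (γ : ℝ → ℝ × ℝ) (t₀ t₁ : ℝ) : Prop :=
  IsGeodesic a γ ∧ t₀ < t₁ ∧ Function.Periodic (fun t => diskPoint a (γ t)) (t₁ - t₀)

/-- The radius `ρ_{a,0}` of the Clifford geodesic, the point with `φ(ρ_{a,0}) = π / 4`. -/
def cliffordRadius (a : ℝ) : ℝ := arclength a (π / 4)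

/-- The image in `Ω_a` of the Clifford geodesic `t ↦ (ρ_{a,0}, t)`. -/
def cliffordGeodesic (a : ℝ) : Set (ℂ × ℝ) :=
  range fun t : ℝ => diskPoint a (cliffordRadius a, t)

/-! ### The geodesics `γ_{a,s}` -/

/-- The strip `(0, ∞) × (-1, 1)` of parameters `(a, s)`. -/
def strip : Set (ℝ × ℝ) := Ioi 0 ×ˢ Ioo (-1) 1

/-- `β a : (-1, 1) → (0, L_a)`, depending analytically on `(a, s)`, is a parametrization of the
radial segment `σ(0)` with positive derivative and `β a 0 = ρ_{a,0}`. -/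
structure IsRadialParametrization (β : ℝ → ℝ → ℝ) : Prop where
  analytic : AnalyticOnNhd ℝ (fun p : ℝ × ℝ => β p.1 p.2) strip
  center : ∀ a, 0 < a → β a 0 = cliffordRadius a
  deriv_pos : ∀ a s, (a, s) ∈ strip → 0 < deriv (β a) s
  image : ∀ a, 0 < a → β a '' Ioo (-1) 1 = Ioo 0 (totalLength a)

/-- The geodesic `γ_{a,s}` in polar coordinates. -/
def gammaCurve (β : ℝ → ℝ → ℝ) (a s : ℝ) : ℝ → ℝ × ℝ :=
  Classical.epsilon (IsOrthogonalGeodesic a (β a s))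

/-- `γ_{a,s}` as a curve of points in `Ω_a`. -/
def gammaPoint (β : ℝ → ℝ → ℝ) (a s t : ℝ) : ℂ × ℝ := diskPoint a (gammaCurve β a s t)

/-- `ℓ_k(a,s)`, the positive time at which the angular coordinate of `γ_{a,s}` is `kπ`. -/
def ell (β : ℝ → ℝ → ℝ) (k : ℕ) (a s : ℝ) : ℝ :=
  sInf {t | 0 < t ∧ (gammaCurve β a s t).2 = k * π}

/-- The function `f_k`. -/
def fZero (β : ℝ → ℝ → ℝ) (k : ℕ) (a s : ℝ) : ℝ :=
  deriv (fun t => (gammaCurve β a s t).1) (ell β k a s)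

/-! ### Bifurcation branches -/

/-- The zero set of `f_k` in the strip. -/
def zeroSet (β : ℝ → ℝ → ℝ) (k : ℕ) : Set (ℝ × ℝ) := {p ∈ strip | fZero β k p.1 p.2 = 0}

/-- The trivial branch. -/
def trivialBranch : Set (ℝ × ℝ) := {p | 0 < p.1 ∧ p.2 = 0}

/-- The bifurcation instant `a^j_k`. -/
def bifInstant (j k : ℕ) : ℝ := ((j : ℝ) / k) / √(4 - ((j : ℝ) / k) ^ 2)

/-- The labels of branches. -/
def IsLabel (j k : ℕ) : Prop := 0 < j ∧ j < 2 * k ∧ Nat.Coprime j k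

/-- The branch `𝓑_(j,k)`: the connected component containing `(a^j_k, 0)` of the closure, relative
to the strip, of the set of nontrivial zeros of `f_k`. -/
def branch (β : ℝ → ℝ → ℝ) (j k : ℕ) : Set (ℝ × ℝ) :=
  connectedComponentIn (strip ∩ closure (zeroSet β k \ trivialBranch)) (bifInstant j k, 0)

/-- The closed curve `c : [t₀, t₁] → ℂ` avoids `0` and has winding number `n` around `0`: a
continuous choice of its argument increases by `2πn`. -/
def HasWindingNumber (c : ℝ → ℂ) (t₀ t₁ : ℝ) (n : ℤ) : Prop :=
  c t₀ = c t₁ ∧ (∀ t ∈ Icc t₀ t₁, c t ≠ 0) ∧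
    ∃ α : ℝ → ℝ, ContinuousOn α (Icc t₀ t₁) ∧
      (∀ t ∈ Icc t₀ t₁, c t = (‖c t‖ : ℂ) * Complex.exp (α t * Complex.I)) ∧
      α t₁ - α t₀ = 2 * π * n

/-! ### Tori in the ellipsoid -/

/-- The ellipsoid `S³_a = {(z, w) : |z|² / a² + |w|² = 1}` in `ℂ²` with its Euclidean norm. -/
def ellipsoid (a : ℝ) : Set (EuclideanSpace ℂ (Fin 2)) :=
  {p | ‖p 0‖ ^ 2 / a ^ 2 + ‖p 1‖ ^ 2 = 1}

/-- The quotient map `S³_a → Ω_a` by the circle action on the second coordinate. -/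
def orbitMap (p : EuclideanSpace ℂ (Fin 2)) : ℂ × ℝ := (p 0, ‖p 1‖)

/-- The preimage in `S³_a` of the geodesic `γ_{a,s}`. -/
def torus (β : ℝ → ℝ → ℝ) (a s : ℝ) : Set (EuclideanSpace ℂ (Fin 2)) :=
  {p ∈ ellipsoid a | orbitMap p ∈ range (gammaPoint β a s)}

/-- `F` restricts to an isometry of `S³_a` with the Riemannian metric induced from `ℂ²`: a smooth
bijection whose differential preserves the norm of tangent vectors (the inverse is then
smooth by the inverse function theorem). -/
def IsEllipsoidIsometry (a : ℝ) (F : EuclideanSpace ℂ (Fin 2) → EuclideanSpace ℂ (Fin 2)) : Prop :=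
  BijOn F (ellipsoid a) (ellipsoid a) ∧
  (∃ U, IsOpen U ∧ ellipsoid a ⊆ U ∧ ContDiffOn ℝ ∞ F U) ∧
  ∀ p ∈ ellipsoid a, ∀ v : EuclideanSpace ℂ (Fin 2),
    inner ℝ (p 0) (v 0) / a ^ 2 + inner ℝ (p 1) (v 1) = 0 → ‖fderiv ℝ F p v‖ = ‖v‖

/-- Congruence of subsets of `S³_a`. -/
def Congruent (a : ℝ) (S T : Set (EuclideanSpace ℂ (Fin 2))) : Prop :=
  ∃ F, IsEllipsoidIsometry a F ∧ F '' S = T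

end EllipsoidTori

end

/-! Along a geodesic issuing orthogonally from the ray, the height `u = cos 2φ` is a harmonic
oscillator in a rescaled time: conservation of energy and angular momentum give `u = q cos τ`, where
`q` is the initial height and the phase `τ` increases with `t`
(`IsOrthogonalGeodesic.exists_isPhase`). Time and angle are primitives in `τ` of positive, even,
`2π`-periodic densities. The geometry is therefore governed by one number, the angle `T = halfPeriod
a q` swept while `τ` grows by `π`.

For `s ≠ 0`, `f_k(a,s) = 0` says that `τ` is a multiple of `π` when the angle is `kπ`, hence that
`kπ / T` is an integer. This ratio is continuous on the strip, so it is integral on the closure of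
the nontrivial zeros and constant on connected sets there; at `(a^j_k, 0)` it equals `j`. Thus `jT =
kπ` on the whole branch (`halfPeriod_of_mem_branch`). The counts in (i) follow from this relation,
from the symmetry `t ↦ -t`, and from coprimality, which makes `j` oscillations the first return.
(ii) holds because `T` determines `j / k`.

For (iii), `T` is even in `q`, so it is enough that congruent tori over the same `a` have equal
`|q|`, the oscillation of `|z|²` up to scale. If `a ≠ 1`, the Gauss equation shows that an isometry
preserves the scalar curvature, which determines `|z|` (`IsEllipsoidIsometry.norm_fst_eq`). If `a =
1`, isometries are linear, and conjugating the generator of the circle action by the isometry shows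
that the oscillation of `|z|²` cannot decrease (`IsRotational.abs_le`); that argument needs `T < π`
on the round sphere (`halfPeriod_one_lt_pi`). -/

namespace EllipsoidTori

/-! ### The arclength function, the latitude and the warping function -/

/-- The factor `√(a² cos² ψ + sin² ψ)`, the speed of the meridian ellipse. -/
noncomputable def meridianSpeed (a ψ : ℝ) : ℝ := √(a ^ 2 * cos ψ ^ 2 + sin ψ ^ 2)

theorem meridianSpeed_pos {a : ℝ} (ha : 0 < a) (ψ : ℝ) : 0 < meridianSpeed a ψ := by
  refine Real.sqrt_pos.2 ?_
  rcases eq_or_ne (cos ψ) 0 with h | h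
  · have := sin_sq_add_cos_sq ψ
    rw [h] at this ⊢
    nlinarith
  · positivity

theorem arclengthDensity_eq (a ψ : ℝ) :
    arclengthDensity a ψ = 2 * π * (cos ψ * meridianSpeed a ψ) := rfl

theorem continuous_arclengthDensity_uncurry :
    Continuous fun p : ℝ × ℝ => arclengthDensity p.1 p.2 := by
  unfold arclengthDensity
  fun_prop

theorem continuous_arclengthDensity (a : ℝ) : Continuous (arclengthDensity a) := by
  unfold arclengthDensity
  fun_prop

theorem arclengthDensity_pos {a ψ : ℝ} (ha : 0 < a) (h : ψ ∈ Ioo (-(π / 2)) (π / 2)) :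
    0 < arclengthDensity a ψ := by
  rw [arclengthDensity_eq]
  have := cos_pos_of_mem_Ioo h
  have := meridianSpeed_pos ha ψ
  positivity

theorem hasDerivAt_arclength (a ψ : ℝ) : HasDerivAt (arclength a) (arclengthDensity a ψ) ψ :=
  intervalIntegral.integral_hasDerivAt_right
    ((continuous_arclengthDensity a).intervalIntegrable _ _)
    ((continuous_arclengthDensity a).stronglyMeasurableAtFilter _ _)
    (continuous_arclengthDensity a).continuousAt

theorem continuous_arclength (a : ℝ) : Continuous (arclength a) :=
  continuous_iff_continuousAt.2 fun ψ => (hasDerivAt_arclength a ψ).continuousAt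

theorem continuous_arclength_left (ψ : ℝ) : Continuous fun a => arclength a ψ :=
  intervalIntegral.continuous_parametric_intervalIntegral_of_continuous'
    continuous_arclengthDensity_uncurry 0 ψ

@[simp] theorem arclength_zero (a : ℝ) : arclength a 0 = 0 := by simp [arclength]

theorem strictMonoOn_arclength {a : ℝ} (ha : 0 < a) :
    StrictMonoOn (arclength a) (Icc 0 (π / 2)) := by
  refine strictMonoOn_of_deriv_pos (convex_Icc _ _) (continuous_arclength a).continuousOn ?_
  intro ψ hψ
  rw [interior_Icc] at hψ
  rw [(hasDerivAt_arclength a ψ).deriv]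
  exact arclengthDensity_pos ha ⟨by linarith [hψ.1, pi_pos], hψ.2⟩

theorem latitude_arclength {a ψ : ℝ} (ha : 0 < a) (h : ψ ∈ Icc 0 (π / 2)) :
    latitude a (arclength a ψ) = ψ :=
  (strictMonoOn_arclength ha).injOn.leftInvOn_invFunOn h

theorem arclength_mem_Ioo {a ψ : ℝ} (ha : 0 < a) (h : ψ ∈ Ioo 0 (π / 2)) :
    arclength a ψ ∈ Ioo 0 (totalLength a) := by
  have hp : (0 : ℝ) ≤ π / 2 := by positivity
  constructor
  · rw [← arclength_zero a]
    exact strictMonoOn_arclength ha ⟨le_rfl, hp⟩ (Ioo_subset_Icc_self h) h.1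
  · exact strictMonoOn_arclength ha (Ioo_subset_Icc_self h) ⟨hp, le_rfl⟩ h.2

theorem exists_arclength_eq {a ρ : ℝ} (h : ρ ∈ Ioo 0 (totalLength a)) :
    ∃ ψ ∈ Ioo 0 (π / 2), arclength a ψ = ρ := by
  have := intermediate_value_Ioo (show (0 : ℝ) ≤ π / 2 by positivity)
    (continuous_arclength a).continuousOn
  rw [arclength_zero] at this
  exact this h

theorem latitude_mem_Ioo {a ρ : ℝ} (ha : 0 < a) (h : ρ ∈ Ioo 0 (totalLength a)) :
    latitude a ρ ∈ Ioo 0 (π / 2) := by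
  obtain ⟨ψ, hψ, rfl⟩ := exists_arclength_eq h
  rwa [latitude_arclength ha (Ioo_subset_Icc_self hψ)]

theorem arclength_latitude {a ρ : ℝ} (ha : 0 < a) (h : ρ ∈ Ioo 0 (totalLength a)) :
    arclength a (latitude a ρ) = ρ := by
  obtain ⟨ψ, hψ, rfl⟩ := exists_arclength_eq h
  rw [latitude_arclength ha (Ioo_subset_Icc_self hψ)]

theorem eventually_mem_Ioo_totalLength {a ρ : ℝ} (h : ρ ∈ Ioo 0 (totalLength a)) :
    ∀ᶠ p : ℝ × ℝ in 𝓝 (a, ρ), p.2 ∈ Ioo 0 (totalLength p.1) := by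
  have h1 : Continuous fun p : ℝ × ℝ => totalLength p.1 :=
    (continuous_arclength_left (π / 2)).comp continuous_fst
  exact (continuous_const.continuousAt.eventually_lt continuousAt_snd h.1).and
    (continuousAt_snd.eventually_lt h1.continuousAt h.2)

/-- For `y` in `[0, π/2]`, `y < latitude a ρ` amounts to `arclength a y < ρ`, an open condition on
`(a, ρ)` because `arclength` is continuous in `a`. Levels `y` outside that interval are trivial and
treated apart, since monotonicity holds only on it. Joint continuity is what later makes the half
period continuous on the strip. -/
theorem continuousAt_latitude_uncurry {a ρ : ℝ} (ha : 0 < a) (h : ρ ∈ Ioo 0 (totalLength a)) :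
    ContinuousAt (fun p : ℝ × ℝ => latitude p.1 p.2) (a, ρ) := by
  have hm := latitude_mem_Ioo ha h
  have hev : ∀ᶠ p : ℝ × ℝ in 𝓝 (a, ρ), 0 < p.1 ∧ p.2 ∈ Ioo 0 (totalLength p.1) :=
    (continuous_const.continuousAt.eventually_lt continuousAt_fst ha).and
      (eventually_mem_Ioo_totalLength h)
  have hc : ∀ ψ : ℝ, ContinuousAt (fun p : ℝ × ℝ => arclength p.1 ψ) (a, ρ) := fun ψ =>
    ((continuous_arclength_left ψ).comp continuous_fst).continuousAt
  refine tendsto_order.2 ⟨fun y hy => ?_, fun y hy => ?_⟩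
  · rcases lt_or_ge y 0 with h0 | h0
    · filter_upwards [hev] with p hp
      exact h0.trans (latitude_mem_Ioo hp.1 hp.2).1
    · have hyI : y ∈ Icc 0 (π / 2) := ⟨h0, (hy.trans hm.2).le⟩
      have hlt : arclength a y < ρ := by
        rw [← arclength_latitude ha h]
        exact strictMonoOn_arclength ha hyI (Ioo_subset_Icc_self hm) hy
      filter_upwards [hev, (hc y).eventually_lt continuousAt_snd hlt] with p hp hp2
      by_contra hcon
      rw [not_lt] at hcon
      have := (strictMonoOn_arclength hp.1).monotoneOn
        (Ioo_subset_Icc_self (latitude_mem_Ioo hp.1 hp.2)) hyI hcon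
      rw [arclength_latitude hp.1 hp.2] at this
      exact absurd hp2 (not_lt.2 this)
  · rcases lt_or_ge (π / 2) y with h0 | h0
    · filter_upwards [hev] with p hp
      exact (latitude_mem_Ioo hp.1 hp.2).2.trans h0
    · have hyI : y ∈ Icc 0 (π / 2) := ⟨(hm.1.trans hy).le, h0⟩
      have hlt : ρ < arclength a y := by
        rw [← arclength_latitude ha h]
        exact strictMonoOn_arclength ha (Ioo_subset_Icc_self hm) hyI hy
      filter_upwards [hev, continuousAt_snd.eventually_lt (hc y) hlt] with p hp hp2
      by_contra hcon
      rw [not_lt] at hcon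
      have := (strictMonoOn_arclength hp.1).monotoneOn hyI
        (Ioo_subset_Icc_self (latitude_mem_Ioo hp.1 hp.2)) hcon
      rw [arclength_latitude hp.1 hp.2] at this
      exact absurd hp2 (not_lt.2 this)

theorem continuousAt_latitude {a ρ : ℝ} (ha : 0 < a) (h : ρ ∈ Ioo 0 (totalLength a)) :
    ContinuousAt (latitude a) ρ :=
  ContinuousAt.comp (g := fun p : ℝ × ℝ => latitude p.1 p.2) (f := fun x => (a, x))
    (continuousAt_latitude_uncurry ha h) (by fun_prop)

theorem cos_latitude_pos {a ρ : ℝ} (ha : 0 < a) (h : ρ ∈ Ioo 0 (totalLength a)) :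
    0 < cos (latitude a ρ) := by
  have := latitude_mem_Ioo ha h
  exact cos_pos_of_mem_Ioo ⟨by linarith [this.1, pi_pos], this.2⟩

theorem sin_latitude_pos {a ρ : ℝ} (ha : 0 < a) (h : ρ ∈ Ioo 0 (totalLength a)) :
    0 < sin (latitude a ρ) := by
  have := latitude_mem_Ioo ha h
  exact sin_pos_of_pos_of_lt_pi this.1 (by linarith [this.2, pi_pos])

theorem hasDerivAt_latitude {a ρ : ℝ} (ha : 0 < a) (h : ρ ∈ Ioo 0 (totalLength a)) :
    HasDerivAt (latitude a) (arclengthDensity a (latitude a ρ))⁻¹ ρ := by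
  have hm := latitude_mem_Ioo ha h
  refine HasDerivAt.of_local_left_inverse (continuousAt_latitude ha h)
    (hasDerivAt_arclength a _)
    (arclengthDensity_pos ha ⟨by linarith [hm.1, pi_pos], hm.2⟩).ne' ?_
  filter_upwards [isOpen_Ioo.mem_nhds h] with x hx using arclength_latitude ha hx

theorem warp_pos {a ρ : ℝ} (ha : 0 < a) (h : ρ ∈ Ioo 0 (totalLength a)) : 0 < warp a ρ := by
  have := sin_latitude_pos ha h
  have := cos_latitude_pos ha h
  rw [warp, sin_two_mul]
  positivity

theorem hasDerivAt_warp {a ρ : ℝ} (ha : 0 < a) (h : ρ ∈ Ioo 0 (totalLength a)) :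
    HasDerivAt (warp a) (a * cos (2 * latitude a ρ) /
      (cos (latitude a ρ) * meridianSpeed a (latitude a ρ))) ρ := by
  have h1 := (((hasDerivAt_latitude ha h).const_mul 2).sin).const_mul (π * a)
  refine h1.congr_deriv ?_
  have := (cos_latitude_pos ha h).ne'
  have := (meridianSpeed_pos ha (latitude a ρ)).ne'
  have := pi_pos.ne'
  rw [arclengthDensity_eq]
  field_simp

/-- The height `cos (2ψ)` of a point of `Ω_a`; it vanishes on the Clifford geodesic. -/
noncomputable def height (a ρ : ℝ) : ℝ := cos (2 * latitude a ρ)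

theorem height_mem_Ioo {a ρ : ℝ} (ha : 0 < a) (h : ρ ∈ Ioo 0 (totalLength a)) :
    height a ρ ∈ Ioo (-1) 1 := by
  have h1 := sin_latitude_pos ha h
  have h2 := cos_latitude_pos ha h
  have h3 := sin_sq_add_cos_sq (latitude a ρ)
  rw [height, cos_two_mul]
  constructor <;> nlinarith

/-- The angle `2φ` stays in `(0, π)`, where the cosine is injective. The height can thus replace `ρ`
as radial coordinate. -/
theorem height_injOn {a : ℝ} (ha : 0 < a) : InjOn (height a) (Ioo 0 (totalLength a)) := by
  intro x hx y hy h
  have h1 := latitude_mem_Ioo ha hx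
  have h2 := latitude_mem_Ioo ha hy
  have := injOn_cos ⟨by linarith [h1.1], by linarith [h1.2]⟩
    ⟨by linarith [h2.1], by linarith [h2.2]⟩ h
  rw [← arclength_latitude ha hx, ← arclength_latitude ha hy]
  congr 1
  linarith

theorem sin_sq_latitude (a ρ : ℝ) : sin (latitude a ρ) ^ 2 = (1 - height a ρ) / 2 := by
  rw [height, cos_two_mul']
  linarith [sin_sq_add_cos_sq (latitude a ρ)]

theorem cos_sq_latitude (a ρ : ℝ) : cos (latitude a ρ) ^ 2 = (1 + height a ρ) / 2 := by
  rw [height, cos_two_mul]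
  ring

theorem sin_two_latitude_sq (a ρ : ℝ) : sin (2 * latitude a ρ) ^ 2 = 1 - height a ρ ^ 2 := by
  rw [height, sin_sq]

theorem sin_two_latitude_pos {a ρ : ℝ} (ha : 0 < a) (h : ρ ∈ Ioo 0 (totalLength a)) :
    0 < sin (2 * latitude a ρ) := by
  have h1 := latitude_mem_Ioo ha h
  exact sin_pos_of_pos_of_lt_pi (by linarith [h1.1]) (by linarith [h1.2])

theorem hasDerivAt_height {a ρ : ℝ} (ha : 0 < a) (h : ρ ∈ Ioo 0 (totalLength a)) :
    HasDerivAt (height a) (-(2 * sin (latitude a ρ) /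
      (π * meridianSpeed a (latitude a ρ)))) ρ := by
  refine (((hasDerivAt_latitude ha h).const_mul 2).cos).congr_deriv ?_
  have := (cos_latitude_pos ha h).ne'
  have := (meridianSpeed_pos ha (latitude a ρ)).ne'
  have := pi_pos.ne'
  rw [arclengthDensity_eq, sin_two_mul]
  field_simp

theorem height_cliffordRadius {a : ℝ} (ha : 0 < a) : height a (cliffordRadius a) = 0 := by
  rw [height, cliffordRadius, latitude_arclength ha ⟨by positivity, by linarith [pi_pos]⟩]
  rw [show 2 * (π / 4) = π / 2 by ring, cos_pi_div_two]

theorem cliffordRadius_mem_Ioo {a : ℝ} (ha : 0 < a) :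
    cliffordRadius a ∈ Ioo 0 (totalLength a) :=
  arclength_mem_Ioo ha ⟨by positivity, by linarith [pi_pos]⟩

/-! ### Primitives of positive even periodic functions -/

/-- A continuous positive even `2π`-periodic function. -/
structure IsPhaseDensity (f : ℝ → ℝ) : Prop where
  cont : Continuous f
  pos : ∀ x, 0 < f x
  even : ∀ x, f (-x) = f x
  periodic : Function.Periodic f (2 * π)

/-- The primitive vanishing at `0`. -/
noncomputable def primitive (f : ℝ → ℝ) (x : ℝ) : ℝ := ∫ ξ in (0 : ℝ)..x, f ξ

namespace IsPhaseDensity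

variable {f : ℝ → ℝ}

theorem hasDerivAt_primitive (hf : IsPhaseDensity f) (x : ℝ) :
    HasDerivAt (primitive f) (f x) x :=
  intervalIntegral.integral_hasDerivAt_right (hf.cont.intervalIntegrable _ _)
    (hf.cont.stronglyMeasurableAtFilter _ _) hf.cont.continuousAt

theorem continuous_primitive (hf : IsPhaseDensity f) : Continuous (primitive f) :=
  continuous_iff_continuousAt.2 fun x => (hf.hasDerivAt_primitive x).continuousAt

theorem strictMono_primitive (hf : IsPhaseDensity f) : StrictMono (primitive f) :=
  strictMono_of_deriv_pos fun x => by
    rw [(hf.hasDerivAt_primitive x).deriv]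
    exact hf.pos x

theorem primitive_neg (hf : IsPhaseDensity f) (x : ℝ) : primitive f (-x) = -primitive f x := by
  have := intervalIntegral.integral_comp_neg (a := 0) (b := x) f
  simp only [hf.even, neg_zero] at this
  rw [primitive, primitive, this, intervalIntegral.integral_symm]

theorem primitive_add_two_pi (hf : IsPhaseDensity f) (x : ℝ) :
    primitive f (x + 2 * π) = primitive f x + 2 * primitive f π := by
  have h1 : ∀ x, primitive f (x + 2 * π) - primitive f x = ∫ ξ in (0 : ℝ)..2 * π, f ξ := fun x => by
    rw [primitive, primitive, intervalIntegral.integral_interval_sub_left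
      (hf.cont.intervalIntegrable _ _) (hf.cont.intervalIntegrable _ _),
      hf.periodic.intervalIntegral_add_eq x 0, zero_add]
  -- At `-π` the oddness of the primitive identifies the integral over a period with twice its value
  -- at `π`.
  have h2 := h1 (-π)
  rw [show -π + 2 * π = π by ring, hf.primitive_neg] at h2
  linarith [h1 x]

theorem primitive_add_int_mul (hf : IsPhaseDensity f) (x : ℝ) (n : ℤ) :
    primitive f (x + n * (2 * π)) = primitive f x + n * (2 * primitive f π) := by
  induction n with
  | zero => simp
  | succ n ih =>
    have := hf.primitive_add_two_pi (x + (n : ℤ) * (2 * π))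
    rw [ih] at this
    push_cast at this ⊢
    rw [show x + ((n : ℝ) + 1) * (2 * π) = x + n * (2 * π) + 2 * π by ring, this]
    ring
  | pred n ih =>
    have := hf.primitive_add_two_pi (x + ((-(n : ℤ) - 1 : ℤ) : ℝ) * (2 * π))
    push_cast at this ih ⊢
    rw [show x + (-(n : ℝ) - 1) * (2 * π) + 2 * π = x + -(n : ℝ) * (2 * π) by ring, ih] at this
    linarith

/-- Converts multiples of `π` in the phase into multiples of the half period in the angle, and
likewise for the time. -/
theorem primitive_int_mul_pi (hf : IsPhaseDensity f) (n : ℤ) :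
    primitive f (n * π) = n * primitive f π := by
  have h0 : primitive f 0 = 0 := by simp [primitive]
  rcases Int.even_or_odd' n with ⟨m, rfl | rfl⟩
  · have := hf.primitive_add_int_mul 0 m
    push_cast
    rw [show 2 * (m : ℝ) * π = 0 + m * (2 * π) by ring, this, h0]
    ring
  · have := hf.primitive_add_int_mul π m
    push_cast
    rw [show (2 * (m : ℝ) + 1) * π = π + m * (2 * π) by ring, this]
    ring

theorem primitive_pi_pos (hf : IsPhaseDensity f) : 0 < primitive f π := by
  have := hf.strictMono_primitive pi_pos
  simpa [primitive] using this

theorem surjective_primitive (hf : IsPhaseDensity f) : Function.Surjective (primitive f) := by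
  intro y
  have hP := hf.primitive_pi_pos
  obtain ⟨n, hn⟩ := exists_nat_gt (|y| / primitive f π)
  rw [div_lt_iff₀ hP] at hn
  have h1 := hf.primitive_int_mul_pi n
  have h2 := hf.primitive_int_mul_pi (-n)
  push_cast at h1 h2
  have h3 := intermediate_value_Icc (show (-(n : ℝ)) * π ≤ n * π by nlinarith [pi_pos, n.cast_nonneg (α := ℝ)])
    hf.continuous_primitive.continuousOn
  rw [h1, h2] at h3
  have h4 := abs_le.1 hn.le
  obtain ⟨x, -, hx⟩ := h3 ⟨by linarith, h4.2⟩
  exact ⟨x, hx⟩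

end IsPhaseDensity

/-! ### The time and angle densities with respect to the phase -/

/-- `dt / dτ` along a geodesic whose height is `q cos τ`. -/
noncomputable def timeDensity (a q ξ : ℝ) : ℝ :=
  √(1 + q * cos ξ) * √(a ^ 2 * (1 + q * cos ξ) + (1 - q * cos ξ)) / (2 * a * √(1 - q ^ 2))

/-- `dθ / dτ` along a geodesic whose height is `q cos τ`. -/
noncomputable def angleDensity (a q ξ : ℝ) : ℝ :=
  √(1 - q ^ 2) * √(a ^ 2 * (1 + q * cos ξ) + (1 - q * cos ξ)) /
    (2 * a * (1 - q * cos ξ) * √(1 + q * cos ξ))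

theorem abs_mul_cos_lt {q : ℝ} (hq : q ∈ Ioo (-1 : ℝ) 1) (x : ℝ) : |q * cos x| < 1 := by
  rw [abs_mul]
  have h1 := abs_cos_le_one x
  have h2 := abs_lt.2 hq
  nlinarith [abs_nonneg q]

theorem mul_cos_mem_Ioo {q : ℝ} (hq : q ∈ Ioo (-1 : ℝ) 1) (x : ℝ) : q * cos x ∈ Ioo (-1 : ℝ) 1 :=
  abs_lt.1 (abs_mul_cos_lt hq x)

theorem one_sub_sq_pos {q : ℝ} (hq : q ∈ Ioo (-1 : ℝ) 1) : 0 < 1 - q ^ 2 := by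
  nlinarith [hq.1, hq.2]

theorem isPhaseDensity_timeDensity {a q : ℝ} (ha : 0 < a) (hq : q ∈ Ioo (-1 : ℝ) 1) :
    IsPhaseDensity (timeDensity a q) where
  cont := by unfold timeDensity; fun_prop
  pos x := by
    have h1 := mul_cos_mem_Ioo hq x
    have h2 := one_sub_sq_pos hq
    have h3 : 0 < 1 + q * cos x := by linarith [h1.1]
    have h4 : 0 < 1 - q * cos x := by linarith [h1.2]
    unfold timeDensity
    positivity
  even x := by simp [timeDensity]
  periodic x := by simp [timeDensity]

theorem isPhaseDensity_angleDensity {a q : ℝ} (ha : 0 < a) (hq : q ∈ Ioo (-1 : ℝ) 1) :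
    IsPhaseDensity (angleDensity a q) where
  cont := by
    unfold angleDensity
    refine Continuous.div (by fun_prop) (by fun_prop) fun x => ?_
    have h1 := mul_cos_mem_Ioo hq x
    have h3 : 0 < 1 + q * cos x := by linarith [h1.1]
    have h4 : 0 < 1 - q * cos x := by linarith [h1.2]
    positivity
  pos x := by
    have h1 := mul_cos_mem_Ioo hq x
    have h2 := one_sub_sq_pos hq
    have h3 : 0 < 1 + q * cos x := by linarith [h1.1]
    have h4 : 0 < 1 - q * cos x := by linarith [h1.2]
    unfold angleDensity
    positivity
  even x := by simp [angleDensity]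
  periodic x := by simp [angleDensity]

/-- The time as a function of the phase. -/
noncomputable def phaseTime (a q : ℝ) : ℝ → ℝ := primitive (timeDensity a q)

/-- The angle as a function of the phase. -/
noncomputable def phaseAngle (a q : ℝ) : ℝ → ℝ := primitive (angleDensity a q)

/-- The angle swept during half an oscillation of the height. -/
noncomputable def halfPeriod (a q : ℝ) : ℝ := phaseAngle a q π

theorem halfPeriod_pos {a q : ℝ} (ha : 0 < a) (hq : q ∈ Ioo (-1 : ℝ) 1) : 0 < halfPeriod a q :=
  (isPhaseDensity_angleDensity ha hq).primitive_pi_pos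

/-- The reflection `ξ ↦ π - ξ` reverses the sign of `cos ξ`. Because of this evenness, `|q|`
suffices as a congruence invariant. -/
theorem halfPeriod_neg (a q : ℝ) : halfPeriod a (-q) = halfPeriod a q := by
  have h := intervalIntegral.integral_comp_sub_left (a := 0) (b := π) (angleDensity a q) π
  rw [sub_self, sub_zero] at h
  rw [halfPeriod, halfPeriod, phaseAngle, phaseAngle, primitive, primitive, ← h]
  simp [angleDensity, cos_pi_sub]

theorem halfPeriod_zero (a : ℝ) : halfPeriod a 0 = π * √(a ^ 2 + 1) / (2 * a) := by
  simp [halfPeriod, phaseAngle, primitive, angleDensity, mul_div_assoc]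

theorem continuousOn_halfPeriod :
    ContinuousOn (fun p : ℝ × ℝ => halfPeriod p.1 p.2) (Ioi 0 ×ˢ Ioo (-1) 1) := by
  rw [continuousOn_iff_continuous_domRestrict]
  refine intervalIntegral.continuous_parametric_intervalIntegral_of_continuous'
    (f := fun (p : (Ioi 0 ×ˢ Ioo (-1) 1 : Set (ℝ × ℝ))) ξ => angleDensity p.1.1 p.1.2 ξ) ?_ 0 π
  unfold angleDensity Function.uncurry
  refine Continuous.div (by fun_prop) (by fun_prop) ?_
  rintro ⟨⟨⟨a, q⟩, ha, hq⟩, x⟩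
  have h1 := mul_cos_mem_Ioo hq x
  have h3 : 0 < 1 + q * cos x := by linarith [h1.1]
  have h4 : 0 < 1 - q * cos x := by linarith [h1.2]
  have h5 : 0 < a := ha
  simp only
  positivity

/-! ### The phase of a geodesic orthogonal to a ray -/

theorem sqrt_one_add_height {a ρ : ℝ} (ha : 0 < a) (h : ρ ∈ Ioo 0 (totalLength a)) :
    √(1 + height a ρ) = √2 * cos (latitude a ρ) := by
  rw [← Real.sqrt_sq (cos_latitude_pos ha h).le, ← Real.sqrt_mul zero_le_two, cos_sq_latitude]
  congr 1
  ring

theorem sqrt_height_eq_meridianSpeed (a ρ : ℝ) :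
    √(a ^ 2 * (1 + height a ρ) + (1 - height a ρ)) = √2 * meridianSpeed a (latitude a ρ) := by
  rw [meridianSpeed, ← Real.sqrt_mul zero_le_two, cos_sq_latitude, sin_sq_latitude]
  congr 1
  ring

/-- With `u = cos 2φ`, both radicals of the density become trigonometric functions of the latitude;
this ties the formula in `q cos τ` to the metric. -/
theorem timeDensity_eq {a q ρ x : ℝ} (ha : 0 < a) (h : ρ ∈ Ioo 0 (totalLength a))
    (hx : height a ρ = q * cos x) :
    timeDensity a q x =
      cos (latitude a ρ) * meridianSpeed a (latitude a ρ) / (a * √(1 - q ^ 2)) := by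
  rw [timeDensity, ← hx, sqrt_one_add_height ha h, sqrt_height_eq_meridianSpeed]
  rw [show √2 * cos (latitude a ρ) * (√2 * meridianSpeed a (latitude a ρ)) =
    (√2 * √2) * (cos (latitude a ρ) * meridianSpeed a (latitude a ρ)) by ring,
    Real.mul_self_sqrt zero_le_two, mul_assoc 2 a, mul_div_mul_left _ _ two_ne_zero]

theorem angleDensity_eq {a q ρ x : ℝ} (ha : 0 < a) (h : ρ ∈ Ioo 0 (totalLength a))
    (hx : height a ρ = q * cos x) :
    angleDensity a q x =
      √(1 - q ^ 2) * meridianSpeed a (latitude a ρ) /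
        (4 * a * sin (latitude a ρ) ^ 2 * cos (latitude a ρ)) := by
  rw [angleDensity, ← hx, sqrt_one_add_height ha h, sqrt_height_eq_meridianSpeed,
    show 1 - height a ρ = 2 * sin (latitude a ρ) ^ 2 by rw [sin_sq_latitude]; ring]
  have := (cos_latitude_pos ha h).ne'
  have := (sin_latitude_pos ha h).ne'
  field_simp
  ring

theorem warp_eq_sqrt_height {a ρ : ℝ} (ha : 0 < a) (h : ρ ∈ Ioo 0 (totalLength a)) :
    warp a ρ = π * a * √(1 - height a ρ ^ 2) := by
  rw [← sin_two_latitude_sq, Real.sqrt_sq (sin_two_latitude_pos ha h).le, warp]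

/-- The phase `τ` of a curve `γ` in the disk: the height is `q cos τ`, and the time and the angle
are primitives of the densities. -/
structure IsPhase (a q : ℝ) (γ : ℝ → ℝ × ℝ) (τ : ℝ → ℝ) : Prop where
  mem : ∀ t, (γ t).1 ∈ Ioo 0 (totalLength a)
  time : ∀ t, phaseTime a q (τ t) = t
  angle : ∀ t, (γ t).2 = phaseAngle a q (τ t)
  height_eq : ∀ t, height a (γ t).1 = q * cos (τ t)
  deriv_rho : ∀ t, warp a (γ t).1 * deriv (fun t => (γ t).1) t =
    (π * a) ^ 2 * √(1 - q ^ 2) * (q * sin (τ t))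

theorem eq_of_hasDerivAt_zero {f : ℝ → ℝ} (h : ∀ t, HasDerivAt f 0 t) (x y : ℝ) : f x = f y :=
  is_const_of_deriv_eq_zero (fun t => (h t).differentiableAt) (fun t => (h t).deriv) x y

/-- Angular momentum is conserved by rotational symmetry. The initial velocity `(0, 1)` has length
`warp a b`, so the angular momentum and the energy have the same value `warp a b ^ 2`. -/
theorem IsOrthogonalGeodesic.clairaut {a b : ℝ} {γ : ℝ → ℝ × ℝ} (ha : 0 < a)
    (h : IsOrthogonalGeodesic a b γ) (t : ℝ) :
    warp a (γ t).1 ^ 2 * deriv (fun t => (γ t).2) t = warp a b ^ 2 := by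
  have hd : ∀ t, HasDerivAt (fun t => warp a (γ t).1 ^ 2 * deriv (fun t => (γ t).2) t) 0 t := by
    intro t
    have hw := hasDerivAt_warp ha (h.geodesic.mem t)
    have h1 := hw.comp t (h.geodesic.diff_rho t).hasDerivAt
    refine ((h1.pow 2).mul (h.geodesic.eq_theta t)).congr_deriv ?_
    have hp := (warp_pos ha (h.geodesic.mem t)).ne'
    rw [hw.deriv]
    simp only [Function.comp_apply, Pi.pow_apply]
    generalize a * cos (2 * latitude a (γ t).1) /
      (cos (latitude a (γ t).1) * meridianSpeed a (latitude a (γ t).1)) = w'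
    field_simp
    ring
  rw [eq_of_hasDerivAt_zero hd t 0, h.init, h.init_theta, mul_one]

theorem IsOrthogonalGeodesic.energy {a b : ℝ} {γ : ℝ → ℝ × ℝ} (ha : 0 < a)
    (h : IsOrthogonalGeodesic a b γ) (t : ℝ) :
    deriv (fun t => (γ t).1) t ^ 2 + warp a (γ t).1 ^ 2 * deriv (fun t => (γ t).2) t ^ 2 =
      warp a b ^ 2 := by
  have hd : ∀ t, HasDerivAt (fun t => deriv (fun t => (γ t).1) t ^ 2 +
      warp a (γ t).1 ^ 2 * deriv (fun t => (γ t).2) t ^ 2) 0 t := by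
    intro t
    have hw := hasDerivAt_warp ha (h.geodesic.mem t)
    have h1 := hw.comp t (h.geodesic.diff_rho t).hasDerivAt
    refine (((h.geodesic.eq_rho t).pow 2).add
      ((h1.pow 2).mul ((h.geodesic.eq_theta t).pow 2))).congr_deriv ?_
    have hp := (warp_pos ha (h.geodesic.mem t)).ne'
    rw [hw.deriv]
    simp only [Function.comp_apply, Pi.pow_apply]
    generalize a * cos (2 * latitude a (γ t).1) /
      (cos (latitude a (γ t).1) * meridianSpeed a (latitude a (γ t).1)) = w'
    field_simp
    ring
  rw [eq_of_hasDerivAt_zero hd t 0, h.init, h.init_theta, h.init_rho]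
  ring

/-- The height `U` and a normalized radial momentum `V` satisfy `U' = κV`, `V' = -κU` with `U(0) =
q`, `V(0) = 0`: a rotation by the angle `τ = ∫ κ`. Since `τ` is an integral over time and is not
read off from `U`, the Clifford case `q = 0` is included. -/
theorem IsOrthogonalGeodesic.exists_isPhase {a b : ℝ} {γ : ℝ → ℝ × ℝ} (ha : 0 < a)
    (h : IsOrthogonalGeodesic a b γ) : ∃ τ, IsPhase a (height a b) γ τ := by
  have hb : b ∈ Ioo 0 (totalLength a) := by
    have := h.geodesic.mem 0
    rwa [h.init] at this
  set q := height a b with hq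
  have hqI := height_mem_Ioo ha hb
  have hc0 := Real.sqrt_pos.2 (one_sub_sq_pos hqI)
  set c := √(1 - q ^ 2) with hc
  have he : warp a b = π * a * c := warp_eq_sqrt_height ha hb
  have hpi := pi_pos
  set r := fun t => (γ t).1 with hr
  have hmem : ∀ t, r t ∈ Ioo 0 (totalLength a) := h.geodesic.mem
  have hrd : ∀ t, HasDerivAt r (deriv r t) t := fun t => (h.geodesic.diff_rho t).hasDerivAt
  have hrc : Continuous r := h.geodesic.diff_rho.continuous
  -- The reciprocal of the time density, expressed through the position of the geodesic.
  set κ : ℝ → ℝ := fun t => a * c / (cos (latitude a (r t)) * meridianSpeed a (latitude a (r t)))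
    with hκ
  have hlc : Continuous fun t => latitude a (r t) := continuous_iff_continuousAt.2 fun t =>
    (continuousAt_latitude ha (hmem t)).comp hrc.continuousAt
  have hκc : Continuous κ := by
    refine continuous_const.div ?_ fun t =>
      (mul_pos (cos_latitude_pos ha (hmem t)) (meridianSpeed_pos ha _)).ne'
    unfold meridianSpeed
    fun_prop
  set τ : ℝ → ℝ := primitive κ with hτ
  have hτd : ∀ t, HasDerivAt τ (κ t) t := fun t =>
    intervalIntegral.integral_hasDerivAt_right (hκc.intervalIntegrable _ _)
      (hκc.stronglyMeasurableAtFilter _ _) hκc.continuousAt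
  have hτ0 : τ 0 = 0 := by simp [hτ, primitive]
  have hcl := h.clairaut ha
  have hen := h.energy ha
  have hω : ∀ t, deriv (fun t => (γ t).2) t = warp a b ^ 2 / warp a (r t) ^ 2 := fun t => by
    have := (warp_pos ha (hmem t)).ne'
    rw [← hcl t]
    exact (mul_div_cancel_left₀ _ (pow_ne_zero 2 this)).symm
  -- Normalized so that the height has derivative exactly `κ V`.
  set V : ℝ → ℝ := fun t => -(warp a (r t) * deriv r t / (π * a * (π * a * c))) with hV
  have hUd : ∀ t, HasDerivAt (fun t => height a (r t)) (κ t * V t) t := fun t => by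
    refine ((hasDerivAt_height ha (hmem t)).comp t (hrd t)).congr_deriv ?_
    have h1 := (cos_latitude_pos ha (hmem t)).ne'
    have h2 := (meridianSpeed_pos ha (latitude a (r t))).ne'
    simp only [hκ, hV, warp, sin_two_mul]
    field_simp
  have hVd : ∀ t, HasDerivAt V (-(κ t * height a (r t))) t := fun t => by
    have hw := hasDerivAt_warp ha (hmem t)
    refine ((((hw.comp t (hrd t)).mul (h.geodesic.eq_rho t)).div_const
      (π * a * (π * a * c))).neg).congr_deriv ?_
    have h1 := (cos_latitude_pos ha (hmem t)).ne'
    have h2 := (meridianSpeed_pos ha (latitude a (r t))).ne'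
    have h3 := (warp_pos ha (hmem t)).ne'
    have h4 := hen t
    change -((a * cos (2 * latitude a (r t)) / _ * deriv r t * deriv r t + warp a (r t) *
      (warp a (r t) * deriv (warp a) (r t) * deriv (fun t => (γ t).2) t ^ 2)) / _) = _
    have h5 : a * cos (2 * latitude a (r t)) /
        (cos (latitude a (r t)) * meridianSpeed a (latitude a (r t))) = deriv (warp a) (r t) :=
      hw.deriv.symm
    rw [h5]
    -- Conservation of energy eliminates both velocities, so that the equation for `V` closes up.
    have h6 : deriv (warp a) (r t) * deriv r t * deriv r t + warp a (r t) *
        (warp a (r t) * deriv (warp a) (r t) * deriv (fun t => (γ t).2) t ^ 2) =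
        deriv (warp a) (r t) * warp a b ^ 2 := by
      rw [← h4]; ring
    rw [h6, ← h5, he]
    simp only [hκ, height]
    field_simp
  -- Uniqueness for the rotation system: the squared distance to `(q cos τ, -q sin τ)` has zero
  -- derivative and starts at `0`.
  have hE : ∀ t, (height a (r t) - q * cos (τ t)) ^ 2 + (V t + q * sin (τ t)) ^ 2 = 0 := by
    intro t
    have hd : ∀ t, HasDerivAt (fun t => (height a (r t) - q * cos (τ t)) ^ 2 +
        (V t + q * sin (τ t)) ^ 2) 0 t := fun t => by
      refine ((((hUd t).sub ((hτd t).cos.const_mul q)).pow 2).add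
        (((hVd t).add ((hτd t).sin.const_mul q)).pow 2)).congr_deriv ?_
      simp only [Pi.sub_apply, Pi.add_apply]
      ring
    rw [eq_of_hasDerivAt_zero hd t 0, hτ0]
    have hr0 : r 0 = b := by simp [hr, h.init]
    have hp0 : deriv r 0 = 0 := h.init_rho
    simp [hV, hr0, hp0, hq]
  have hU : ∀ t, height a (r t) = q * cos (τ t) := fun t => by
    have := hE t
    nlinarith [sq_nonneg (height a (r t) - q * cos (τ t)), sq_nonneg (V t + q * sin (τ t))]
  have hVs : ∀ t, V t = -(q * sin (τ t)) := fun t => by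
    have := hE t
    nlinarith [sq_nonneg (height a (r t) - q * cos (τ t)), sq_nonneg (V t + q * sin (τ t))]
  refine ⟨τ, hmem, fun t => ?_, fun t => ?_, hU, fun t => ?_⟩
  · have hd : ∀ t, HasDerivAt (fun t => phaseTime a q (τ t) - t) 0 t := fun t => by
      refine ((((isPhaseDensity_timeDensity ha hqI).hasDerivAt_primitive (τ t)).comp t
        (hτd t)).sub (hasDerivAt_id t)).congr_deriv ?_
      rw [timeDensity_eq ha (hmem t) (hU t)]
      have h1 := (cos_latitude_pos ha (hmem t)).ne'
      have h2 := (meridianSpeed_pos ha (latitude a (r t))).ne'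
      simp only [hκ]
      rw [← hc]
      field_simp
      ring
    have := eq_of_hasDerivAt_zero hd t 0
    simp only [hτ0] at this
    have h0 : phaseTime a q 0 = 0 := by simp [phaseTime, primitive]
    linarith
  · have hd : ∀ t, HasDerivAt (fun t => phaseAngle a q (τ t) - (γ t).2) 0 t := fun t => by
      refine ((((isPhaseDensity_angleDensity ha hqI).hasDerivAt_primitive (τ t)).comp t
        (hτd t)).sub (h.geodesic.diff_theta t).hasDerivAt).congr_deriv ?_
      rw [angleDensity_eq ha (hmem t) (hU t), hω, he, warp, sin_two_mul]
      have h1 := (cos_latitude_pos ha (hmem t)).ne'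
      have h2 := (meridianSpeed_pos ha (latitude a (r t))).ne'
      have h3 := (sin_latitude_pos ha (hmem t)).ne'
      simp only [hκ]
      rw [← hc]
      field_simp
      ring
    have := eq_of_hasDerivAt_zero hd t 0
    simp only [hτ0, h.init] at this
    have h0 : phaseAngle a q 0 = 0 := by simp [phaseAngle, primitive]
    linarith
  · have := hVs t
    simp only [hV] at this
    have h3 : warp a (r t) * deriv r t / (π * a * (π * a * c)) = q * sin (τ t) := by linarith
    rw [div_eq_iff (by positivity)] at h3
    rw [h3]
    ring

/-! ### Existence of the geodesics -/

/-- The phase description is run backwards: time as a function of the phase is inverted, and the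
radius and the angle are recovered from `q cos τ`. Completeness comes from the surjectivity of the
time primitive. Existence is indispensable because `gammaCurve` is only a choice. -/
theorem exists_isOrthogonalGeodesic {a b : ℝ} (ha : 0 < a) (hb : b ∈ Ioo 0 (totalLength a)) :
    ∃ γ, IsOrthogonalGeodesic a b γ := by
  set q := height a b with hq
  have hqI := height_mem_Ioo ha hb
  have hc0 := Real.sqrt_pos.2 (one_sub_sq_pos hqI)
  have hc2 := Real.sq_sqrt (one_sub_sq_pos hqI).le
  have he : warp a b = π * a * √(1 - q ^ 2) := warp_eq_sqrt_height ha hb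
  set c := √(1 - q ^ 2) with hc
  have hpi := pi_pos
  have hT := isPhaseDensity_timeDensity ha hqI
  have hA := isPhaseDensity_angleDensity ha hqI
  let W := hT.strictMono_primitive.orderIsoOfSurjective _ hT.surjective_primitive
  let τ : ℝ → ℝ := W.symm
  have hW : ∀ t, primitive (timeDensity a q) (τ t) = t := fun t => W.apply_symm_apply t
  have hτd : ∀ t, HasDerivAt τ (timeDensity a q (τ t))⁻¹ t := fun t =>
    HasDerivAt.of_local_left_inverse W.symm.continuous.continuousAt
      (hT.hasDerivAt_primitive (τ t)) (hT.pos _).ne' (Filter.Eventually.of_forall hW)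
  have hτ0 : τ 0 = 0 := by
    apply hT.strictMono_primitive.injective
    rw [hW]
    simp [primitive]
  set u : ℝ → ℝ := fun t => q * cos (τ t) with hu
  have huI : ∀ t, u t ∈ Ioo (-1 : ℝ) 1 := fun t => mul_cos_mem_Ioo hqI _
  set r : ℝ → ℝ := fun t => arclength a (arccos (u t) / 2) with hr
  have hψ : ∀ t, arccos (u t) / 2 ∈ Ioo 0 (π / 2) := fun t => by
    have h1 := arccos_pos.2 (huI t).2
    have h2 : arccos (u t) < π := by
      rcases (arccos_le_pi (u t)).lt_or_eq with h | h
      · exact h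
      · exact absurd (arccos_eq_pi.1 h) (not_le.2 (huI t).1)
    constructor <;> linarith
  have hmem : ∀ t, r t ∈ Ioo 0 (totalLength a) := fun t => arclength_mem_Ioo ha (hψ t)
  have hlat : ∀ t, latitude a (r t) = arccos (u t) / 2 := fun t =>
    latitude_arclength ha (Ioo_subset_Icc_self (hψ t))
  have hht : ∀ t, height a (r t) = q * cos (τ t) := fun t => by
    rw [height, hlat, mul_div_cancel₀ _ two_ne_zero, cos_arccos (huI t).1.le (huI t).2.le]
  have hS : ∀ t, sin (2 * latitude a (r t)) = √(1 - u t ^ 2) := fun t => by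
    rw [hlat, mul_div_cancel₀ _ two_ne_zero, sin_arccos]
  have hSp : ∀ t, 0 < √(1 - u t ^ 2) := fun t => Real.sqrt_pos.2 (one_sub_sq_pos (huI t))
  have hwarp : ∀ t, warp a (r t) = π * a * √(1 - u t ^ 2) := fun t => by rw [warp, hS]
  have hτ' : ∀ t, (timeDensity a q (τ t))⁻¹ =
      a * c / (cos (latitude a (r t)) * meridianSpeed a (latitude a (r t))) := fun t => by
    rw [timeDensity_eq ha (hmem t) (hht t), inv_div]
  have hud : ∀ t, HasDerivAt u (-(q * sin (τ t) * (timeDensity a q (τ t))⁻¹)) t := fun t => by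
    refine ((hτd t).cos.const_mul q).congr_deriv ?_
    ring
  have hrd : ∀ t, HasDerivAt r (π * a * c * (q * sin (τ t)) / √(1 - u t ^ 2)) t := fun t => by
    have h1 := ((hasDerivAt_arccos (huI t).1.ne' (huI t).2.ne).comp t (hud t)).div_const 2
    refine ((hasDerivAt_arclength a _).comp t h1).congr_deriv ?_
    rw [hτ', arclengthDensity_eq, hlat]
    have h1 := (cos_latitude_pos ha (hmem t)).ne'
    have h2 := (meridianSpeed_pos ha (latitude a (r t))).ne'
    have h3 := (hSp t).ne'
    rw [hlat] at h1 h2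
    simp only [Function.comp_apply]
    field_simp
  set θ : ℝ → ℝ := fun t => phaseAngle a q (τ t) with hθ
  have hθd : ∀ t, HasDerivAt θ (c ^ 2 / (1 - u t ^ 2)) t := fun t => by
    refine ((hA.hasDerivAt_primitive (τ t)).comp t (hτd t)).congr_deriv ?_
    rw [hτ', angleDensity_eq ha (hmem t) (hht t), ← Real.sq_sqrt (one_sub_sq_pos (huI t)).le,
      ← hS, sin_two_mul]
    have h1 := (cos_latitude_pos ha (hmem t)).ne'
    have h2 := (meridianSpeed_pos ha (latitude a (r t))).ne'
    have h3 := (sin_latitude_pos ha (hmem t)).ne'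
    rw [← hc]
    field_simp
    ring
  have hr' : deriv r = fun t => π * a * c * (q * sin (τ t)) / √(1 - u t ^ 2) :=
    funext fun t => (hrd t).deriv
  have hθ' : deriv θ = fun t => c ^ 2 / (1 - u t ^ 2) := funext fun t => (hθd t).deriv
  have h1u : ∀ t, HasDerivAt (fun t => 1 - u t ^ 2)
      (2 * u t * (q * sin (τ t)) * (timeDensity a q (τ t))⁻¹) t := fun t => by
    refine (((hud t).pow 2).const_sub 1).congr_deriv ?_
    simp
    ring
  have hw' : ∀ t, deriv (warp a) (r t) = (timeDensity a q (τ t))⁻¹ * u t / c := fun t => by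
    rw [(hasDerivAt_warp ha (hmem t)).deriv, hτ', show cos (2 * latitude a (r t)) = u t from hht t]
    field_simp
  -- The energy identity of the oscillator, which the radial geodesic equation reduces to.
  have huu : ∀ t, (q * sin (τ t)) ^ 2 = 1 - u t ^ 2 - c ^ 2 := fun t => by
    simp only [hu, hc2]
    have := sin_sq_add_cos_sq (τ t)
    linear_combination q ^ 2 * this
  refine ⟨fun t => (r t, θ t), ⟨hmem, fun t => (hrd t).differentiableAt,
    fun t => (hθd t).differentiableAt, fun t => ?_, fun t => ?_⟩, ?_, ?_, ?_⟩
  · change HasDerivAt (deriv r) (warp a (r t) * deriv (warp a) (r t) * deriv θ t ^ 2) t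
    rw [hr']
    have h1 := (((hτd t).sin.const_mul q).const_mul (π * a * c)).div
      ((h1u t).sqrt (one_sub_sq_pos (huI t)).ne') (hSp t).ne'
    refine h1.congr_deriv ?_
    rw [hw', hθ', hwarp]
    have h2 := (hSp t).ne'
    have h3 := Real.sq_sqrt (one_sub_sq_pos (huI t)).le
    have h4 := huu t
    have hut : u t = q * cos (τ t) := rfl
    simp only
    rw [← h3] at h4 ⊢
    rw [Real.sqrt_sq (hSp t).le]
    generalize √(1 - u t ^ 2) = S at *
    generalize (timeDensity a q (τ t))⁻¹ = κ at *
    rw [hut]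
    field_simp
    linear_combination (-κ * q * cos (τ t)) * h4
  · change HasDerivAt (deriv θ)
      (-(2 * (deriv (warp a) (r t) / warp a (r t)) * deriv r t * deriv θ t)) t
    rw [hθ']
    have h0 := (one_sub_sq_pos (huI t)).ne'
    refine ((hasDerivAt_const t (c ^ 2)).div (h1u t) h0).congr_deriv ?_
    rw [hw', hr', hwarp]
    have h2 := (hSp t).ne'
    have h3 := Real.sq_sqrt (one_sub_sq_pos (huI t)).le
    simp only
    rw [← h3]
    rw [Real.sqrt_sq (hSp t).le]
    generalize √(1 - u t ^ 2) = S at *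
    field_simp
    ring
  · have h0 : r 0 = b := by
      apply height_injOn ha (hmem 0) hb
      rw [hht, hτ0, cos_zero, mul_one]
    have h1 : θ 0 = 0 := by simp [hθ, hτ0, phaseAngle, primitive]
    rw [h0, h1]
  · change deriv r 0 = 0
    simp [hr', hτ0]
  · change deriv θ 0 = 1
    simp only [hθ', hu, hτ0, cos_zero, mul_one, hc2]
    exact div_self (one_sub_sq_pos hqI).ne'

/-! ### Points of the disk -/

theorem diskPoint_fst (a : ℝ) (x : ℝ × ℝ) :
    (diskPoint a x).1 = (a * sin (latitude a x.1) : ℝ) * Complex.exp (x.2 * Complex.I) := rfl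

theorem norm_diskPoint_fst {a ρ : ℝ} (ha : 0 < a) (h : ρ ∈ Ioo 0 (totalLength a)) (θ : ℝ) :
    ‖(diskPoint a (ρ, θ)).1‖ = a * sin (latitude a ρ) := by
  rw [diskPoint_fst, norm_mul, Complex.norm_exp_ofReal_mul_I, mul_one, Complex.norm_real,
    Real.norm_of_nonneg (mul_pos ha (sin_latitude_pos ha h)).le]

theorem diskPoint_eq_iff {a ρ₁ ρ₂ θ₁ θ₂ : ℝ} (ha : 0 < a) (h₁ : ρ₁ ∈ Ioo 0 (totalLength a))
    (h₂ : ρ₂ ∈ Ioo 0 (totalLength a)) :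
    diskPoint a (ρ₁, θ₁) = diskPoint a (ρ₂, θ₂) ↔ ρ₁ = ρ₂ ∧ ∃ n : ℤ, θ₁ = θ₂ + n * (2 * π) := by
  constructor
  · intro h
    have hc : cos (latitude a ρ₁) = cos (latitude a ρ₂) := congrArg Prod.snd h
    have l1 := latitude_mem_Ioo ha h₁
    have l2 := latitude_mem_Ioo ha h₂
    have hl := injOn_cos ⟨l1.1.le, by linarith [l1.2, pi_pos]⟩
      ⟨l2.1.le, by linarith [l2.2, pi_pos]⟩ hc
    have hρ : ρ₁ = ρ₂ := by rw [← arclength_latitude ha h₁, hl, arclength_latitude ha h₂]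
    subst hρ
    refine ⟨rfl, ?_⟩
    have hz := congrArg Prod.fst h
    rw [diskPoint_fst, diskPoint_fst] at hz
    have h0 : ((a * sin (latitude a ρ₁) : ℝ) : ℂ) ≠ 0 :=
      Complex.ofReal_ne_zero.2 (mul_pos ha (sin_latitude_pos ha h₁)).ne'
    obtain ⟨n, hn⟩ := Complex.exp_eq_exp_iff_exists_int.1 (mul_left_cancel₀ h0 hz)
    refine ⟨n, ?_⟩
    have := congrArg Complex.im hn
    simpa using this
  · rintro ⟨rfl, n, rfl⟩
    refine Prod.ext ?_ rfl
    rw [diskPoint_fst, diskPoint_fst]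
    congr 1
    rw [Complex.exp_eq_exp_iff_exists_int]
    exact ⟨n, by push_cast; ring⟩

theorem diskPoint_mem_cliffordGeodesic_iff {a ρ θ : ℝ} (ha : 0 < a)
    (h : ρ ∈ Ioo 0 (totalLength a)) :
    diskPoint a (ρ, θ) ∈ cliffordGeodesic a ↔ height a ρ = 0 := by
  constructor
  · rintro ⟨t, ht⟩
    rw [diskPoint_eq_iff ha (cliffordRadius_mem_Ioo ha) h] at ht
    rw [← ht.1, height_cliffordRadius ha]
  · intro h0
    refine ⟨θ, ?_⟩
    rw [height_injOn ha h (cliffordRadius_mem_Ioo ha) (h0.trans (height_cliffordRadius ha).symm)]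

theorem diskPoint_mem_diameter_iff {a ρ θ : ℝ} (ha : 0 < a) (h : ρ ∈ Ioo 0 (totalLength a)) :
    diskPoint a (ρ, θ) ∈ diameter a 0 ↔ ∃ n : ℤ, θ = n * π := by
  have him : ∀ x : ℝ × ℝ, (diskPoint a x).1.im = a * sin (latitude a x.1) * sin x.2 := fun x => by
    rw [diskPoint_fst, Complex.im_ofReal_mul, Complex.exp_ofReal_mul_I_im]
  constructor
  · intro hd
    -- The closure in `diameter` adds only points satisfying the closed condition `Im z = 0`.
    have hcl : IsClosed {p : ℂ × ℝ | p.1.im = 0} :=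
      isClosed_eq (Complex.continuous_im.comp continuous_fst) continuous_const
    have hsub : radialSegment a 0 ∪ radialSegment a (0 + π) ⊆ {p : ℂ × ℝ | p.1.im = 0} := by
      rintro _ (⟨x, -, rfl⟩ | ⟨x, -, rfl⟩)
      · simp [him]
      · simp [him]
    have h0 : (diskPoint a (ρ, θ)).1.im = 0 := closure_minimal hsub hcl hd
    rw [him, mul_eq_zero] at h0
    rcases h0 with h0 | h0
    · exact absurd h0 (mul_pos ha (sin_latitude_pos ha h)).ne'
    · obtain ⟨n, hn⟩ := sin_eq_zero_iff.1 h0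
      exact ⟨n, hn.symm⟩
  · rintro ⟨n, rfl⟩
    apply subset_closure
    rcases Int.even_or_odd' n with ⟨m, rfl | rfl⟩
    · refine Or.inl ⟨ρ, h, ?_⟩
      rw [diskPoint_eq_iff ha h h]
      exact ⟨rfl, -m, by push_cast; ring⟩
    · refine Or.inr ⟨ρ, h, ?_⟩
      rw [diskPoint_eq_iff ha h h]
      exact ⟨rfl, -m, by push_cast; ring⟩

/-! ### Closed geodesics -/

namespace IsPhase

variable {a q : ℝ} {γ : ℝ → ℝ × ℝ} {τ : ℝ → ℝ}

theorem phase_phaseTime (h : IsPhase a q γ τ) (ha : 0 < a) (hq : q ∈ Ioo (-1 : ℝ) 1) (x : ℝ) :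
    τ (phaseTime a q x) = x :=
  (isPhaseDensity_timeDensity ha hq).strictMono_primitive.injective (h.time _)

theorem strictMono_phase (h : IsPhase a q γ τ) (ha : 0 < a) (hq : q ∈ Ioo (-1 : ℝ) 1) :
    StrictMono τ := fun x y hxy => by
  rw [← h.time x, ← h.time y] at hxy
  exact (isPhaseDensity_timeDensity ha hq).strictMono_primitive.lt_iff_lt.1 hxy

theorem phase_neg (h : IsPhase a q γ τ) (ha : 0 < a) (hq : q ∈ Ioo (-1 : ℝ) 1) (t : ℝ) :
    τ (-t) = -τ t := by
  apply (isPhaseDensity_timeDensity ha hq).strictMono_primitive.injective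
  rw [(isPhaseDensity_timeDensity ha hq).primitive_neg]
  exact (h.time _).trans (congrArg Neg.neg (h.time t).symm)

theorem strictMono_angle (h : IsPhase a q γ τ) (ha : 0 < a) (hq : q ∈ Ioo (-1 : ℝ) 1) :
    StrictMono fun t => (γ t).2 := by
  simp only [h.angle]
  exact (isPhaseDensity_angleDensity ha hq).strictMono_primitive.comp (h.strictMono_phase ha hq)

theorem angle_neg (h : IsPhase a q γ τ) (ha : 0 < a) (hq : q ∈ Ioo (-1 : ℝ) 1) (t : ℝ) :
    (γ (-t)).2 = -(γ t).2 := by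
  rw [h.angle, h.angle, h.phase_neg ha hq]
  exact (isPhaseDensity_angleDensity ha hq).primitive_neg _

theorem surjective_angle (h : IsPhase a q γ τ) (ha : 0 < a) (hq : q ∈ Ioo (-1 : ℝ) 1) :
    Function.Surjective fun t => (γ t).2 := fun y => by
  obtain ⟨x, hx⟩ := (isPhaseDensity_angleDensity ha hq).surjective_primitive y
  refine ⟨phaseTime a q x, ?_⟩
  simp only [h.angle, h.phase_phaseTime ha hq]
  exact hx

theorem angle_zero (h : IsPhase a q γ τ) (ha : 0 < a) (hq : q ∈ Ioo (-1 : ℝ) 1) :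
    (γ 0).2 = 0 := by
  have := h.angle_neg ha hq 0
  rw [neg_zero] at this
  linarith

theorem rho_eq_iff (h : IsPhase a q γ τ) (ha : 0 < a) (hq0 : q ≠ 0) (t₁ t₂ : ℝ) :
    (γ t₁).1 = (γ t₂).1 ↔ cos (τ t₁) = cos (τ t₂) := by
  rw [← (height_injOn ha).eq_iff (h.mem t₁) (h.mem t₂), h.height_eq, h.height_eq,
    mul_right_inj' hq0]

theorem continuous_angle (h : IsPhase a q γ τ) (ha : 0 < a) (hq : q ∈ Ioo (-1 : ℝ) 1) :
    Continuous fun t => (γ t).2 :=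
  (h.strictMono_angle ha hq).monotone.continuous_of_surjective (h.surjective_angle ha hq)

variable {j k : ℕ} {ℓ : ℝ}

/-- The angle `kπ` equals `jT`, the angle at phase `jπ`, and the angle is injective in the phase. -/
theorem phase_end (h : IsPhase a q γ τ) (ha : 0 < a) (hq : q ∈ Ioo (-1 : ℝ) 1)
    (hT : j * halfPeriod a q = k * π) (hℓ : (γ ℓ).2 = k * π) : τ ℓ = j * π := by
  apply (isPhaseDensity_angleDensity ha hq).strictMono_primitive.injective
  have := (isPhaseDensity_angleDensity ha hq).primitive_int_mul_pi j
  push_cast at this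
  rw [this]
  exact ((h.angle ℓ).symm.trans hℓ).trans hT.symm

theorem phase_add_period (h : IsPhase a q γ τ) (ha : 0 < a) (hq : q ∈ Ioo (-1 : ℝ) 1)
    (hT : j * halfPeriod a q = k * π) (hℓ : (γ ℓ).2 = k * π) (t : ℝ) :
    τ (t + 2 * ℓ) = τ t + j * (2 * π) := by
  have hD := isPhaseDensity_timeDensity ha hq
  apply hD.strictMono_primitive.injective
  have h1 := hD.primitive_add_int_mul (τ t) j
  have h2 := hD.primitive_int_mul_pi j
  have h3 : primitive (timeDensity a q) (τ t) = t := h.time t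
  have h4 : primitive (timeDensity a q) (τ ℓ) = ℓ := h.time ℓ
  have h5 : primitive (timeDensity a q) (τ (t + 2 * ℓ)) = t + 2 * ℓ := h.time _
  push_cast at h1 h2
  rw [h.phase_end ha hq hT hℓ] at h4
  rw [h5, h1, h3]
  linarith

theorem periodic_diskPoint (h : IsPhase a q γ τ) (ha : 0 < a) (hq : q ∈ Ioo (-1 : ℝ) 1)
    (hT : j * halfPeriod a q = k * π) (hℓ : (γ ℓ).2 = k * π) :
    Function.Periodic (fun t => diskPoint a (γ t)) (ℓ - -ℓ) := fun t => by
  have hτ := h.phase_add_period ha hq hT hℓ t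
  rw [sub_neg_eq_add, ← two_mul]
  refine (diskPoint_eq_iff ha (h.mem _) (h.mem _)).2 ⟨?_, k, ?_⟩
  · apply height_injOn ha (h.mem _) (h.mem _)
    rw [h.height_eq, h.height_eq, hτ, cos_add_nat_mul_two_pi]
  · have h1 := (isPhaseDensity_angleDensity ha hq).primitive_add_int_mul (τ t) j
    push_cast at h1 ⊢
    rw [h.angle, h.angle, hτ, phaseAngle, h1]
    have : primitive (angleDensity a q) π = halfPeriod a q := rfl
    rw [this]
    linear_combination 2 * hT

theorem encard_clifford (h : IsPhase a q γ τ) (ha : 0 < a) (hq : q ∈ Ioo (-1 : ℝ) 1)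
    (hq0 : q ≠ 0) (hT : j * halfPeriod a q = k * π) (hℓ : (γ ℓ).2 = k * π) :
    {t ∈ Icc (-ℓ) ℓ | diskPoint a (γ t) ∈ cliffordGeodesic a}.encard = 2 * j := by
  have hτℓ := h.phase_end ha hq hT hℓ
  have hmono := h.strictMono_phase ha hq
  -- The crossings are the odd multiples of `π/2` in `[-jπ, jπ]`; the endpoints are multiples of `π`
  -- and contribute nothing, which leaves the `2j` indices `-j ≤ n < j`.
  have hset : {t ∈ Icc (-ℓ) ℓ | diskPoint a (γ t) ∈ cliffordGeodesic a} =
      (fun n : ℤ => phaseTime a q ((2 * n + 1) * π / 2)) '' (Finset.Ico (-(j : ℤ)) j : Finset ℤ) := by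
    ext t
    have hcos : diskPoint a (γ t) ∈ cliffordGeodesic a ↔ cos (τ t) = 0 := by
      rw [show γ t = ((γ t).1, (γ t).2) from rfl,
        diskPoint_mem_cliffordGeodesic_iff ha (h.mem t), h.height_eq]
      simp [hq0]
    have hI : t ∈ Icc (-ℓ) ℓ ↔ -(j * π) ≤ τ t ∧ τ t ≤ j * π := by
      rw [mem_Icc, ← hmono.le_iff_le, ← hmono.le_iff_le (a := t), h.phase_neg ha hq, hτℓ]
    rw [mem_ofPred_eq, hcos, hI, cos_eq_zero_iff]
    simp only [Finset.coe_Ico, mem_image, mem_Ico]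
    constructor
    · rintro ⟨⟨h1, h2⟩, n, hn⟩
      refine ⟨n, ⟨?_, ?_⟩, ?_⟩
      · rw [hn] at h1
        have : (-(2 * j : ℝ)) ≤ 2 * n + 1 := by
          by_contra hc
          nlinarith [pi_pos]
        have : -(2 * (j : ℤ)) ≤ 2 * n + 1 := by exact_mod_cast this
        omega
      · rw [hn] at h2
        have : 2 * n + 1 ≤ (2 * j : ℝ) := by
          by_contra hc
          nlinarith [pi_pos]
        have : 2 * n + 1 ≤ 2 * (j : ℤ) := by exact_mod_cast this
        omega
      · rw [← hn, h.time]
    · rintro ⟨n, ⟨h1, h2⟩, rfl⟩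
      rw [h.phase_phaseTime ha hq]
      have h1' : (-(j : ℝ)) ≤ n := by exact_mod_cast h1
      have h2' : (n : ℝ) + 1 ≤ j := by exact_mod_cast h2
      exact ⟨⟨by nlinarith [pi_pos], by nlinarith [pi_pos]⟩, n, rfl⟩
  have hinj : Function.Injective fun n : ℤ => phaseTime a q ((2 * n + 1) * π / 2) := by
    intro m n hmn
    have := (isPhaseDensity_timeDensity ha hq).strictMono_primitive.injective hmn
    have h2 : ((m : ℝ)) = n := by
      have := pi_pos
      nlinarith
    exact_mod_cast h2
  rw [hset, hinj.encard_image, Set.encard_coe_eq_coe_finsetCard, Int.card_Ico,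
    show ((j : ℤ) - -(j : ℤ)).toNat = 2 * j by omega]
  push_cast
  rfl

theorem hasWindingNumber (h : IsPhase a q γ τ) (ha : 0 < a) (hq : q ∈ Ioo (-1 : ℝ) 1)
    (hT : j * halfPeriod a q = k * π) (hℓ : (γ ℓ).2 = k * π) :
    HasWindingNumber (fun t => (diskPoint a (γ t)).1) (-ℓ) ℓ k := by
  refine ⟨?_, fun t _ => ?_, fun t => (γ t).2, (h.continuous_angle ha hq).continuousOn,
    fun t _ => ?_, ?_⟩
  · have := h.periodic_diskPoint ha hq hT hℓ (-ℓ)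
    simp only at this ⊢
    rw [← this]
    congr 4
    ring
  · simp only [diskPoint_fst]
    exact mul_ne_zero (Complex.ofReal_ne_zero.2 (mul_pos ha (sin_latitude_pos ha (h.mem t))).ne')
      (Complex.exp_ne_zero _)
  · simp only
    rw [show γ t = ((γ t).1, (γ t).2) from rfl, norm_diskPoint_fst ha (h.mem t), diskPoint_fst]
  · simp only [h.angle_neg ha hq, hℓ]
    push_cast
    ring

/-- Equal radii give `τ₂ = ±τ₁ + 2πn`. With the sign `+`, equality of the angles modulo `2π` and `jT
= kπ` give `j ∣ nk`, so `j ∣ n` and the phases differ by a multiple of the full period `2jπ`, which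
is impossible. With the sign `-`, the same divisibility requires `2 θ(t₁)` to be a multiple of `2π`,
which is what lying on the diameter provides. -/
theorem eq_neg_of_diskPoint_eq (h : IsPhase a q γ τ) (ha : 0 < a) (hq : q ∈ Ioo (-1 : ℝ) 1)
    (hq0 : q ≠ 0) (hj : 0 < j) (hjk : Nat.Coprime j k) (hT : j * halfPeriod a q = k * π)
    (hℓ : (γ ℓ).2 = k * π) {t₁ t₂ : ℝ} (h₁ : t₁ ∈ Ico (-ℓ) ℓ) (h₂ : t₂ ∈ Ico (-ℓ) ℓ)
    (hne : t₁ ≠ t₂) (heq : diskPoint a (γ t₁) = diskPoint a (γ t₂))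
    (hd : ∃ n : ℤ, (γ t₁).2 = n * π) : t₁ = -t₂ := by
  have hτℓ := h.phase_end ha hq hT hℓ
  have hmono := h.strictMono_phase ha hq
  have hI : ∀ t, t ∈ Ico (-ℓ) ℓ → -(j * π) ≤ τ t ∧ τ t < j * π := fun t ht => by
    rwa [mem_Ico, ← hmono.le_iff_le, ← hmono.lt_iff_lt (a := t), h.phase_neg ha hq, hτℓ] at ht
  have b1 := hI _ h₁
  have b2 := hI _ h₂
  obtain ⟨hρ, N, hN⟩ := (diskPoint_eq_iff ha (h.mem t₁) (h.mem t₂)).1 heq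
  obtain ⟨m, hm⟩ := hd
  rw [h.rho_eq_iff ha hq0, cos_eq_cos_iff] at hρ
  have hA := isPhaseDensity_angleDensity ha hq
  have hTdef : primitive (angleDensity a q) π = halfPeriod a q := rfl
  have hjp : (0 : ℝ) < j := by exact_mod_cast hj
  have hpi := pi_pos
  -- The only place where coprimality of `j` and `k` enters the count.
  have hdvd : ∀ n M : ℤ, n * (k : ℝ) = j * M → ∃ l : ℤ, (n : ℝ) = j * l := fun n M hnM => by
    have h1 : n * (k : ℤ) = j * M := by exact_mod_cast hnM
    have h2 : (j : ℤ) ∣ n := (Nat.isCoprime_iff_coprime.2 hjk).dvd_of_dvd_mul_right ⟨M, h1⟩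
    obtain ⟨l, hl⟩ := h2
    exact ⟨l, by exact_mod_cast hl⟩
  obtain ⟨n, hn | hn⟩ := hρ
  · exfalso
    have h3 := hA.primitive_add_int_mul (τ t₁) n
    have h4 : (γ t₂).2 = (γ t₁).2 + n * (2 * halfPeriod a q) := by
      rw [h.angle, h.angle, hn, show 2 * (n : ℝ) * π + τ t₁ = τ t₁ + n * (2 * π) by ring,
        phaseAngle, h3, hTdef]
    obtain ⟨l, hl⟩ := hdvd n (-N) (by
      apply mul_right_cancel₀ (b := 2 * π) (by positivity)
      push_cast
      linear_combination (-(j : ℝ)) * hN - (j : ℝ) * h4 - 2 * (n : ℝ) * hT)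
    have h5 : τ t₂ - τ t₁ = (2 * j * π) * l := by rw [hn, hl]; ring
    have hl0 : l = 0 := by
      have c1 : (l : ℝ) < 1 := by
        by_contra hc
        nlinarith [mul_pos hjp hpi]
      have c2 : (-1 : ℝ) < l := by
        by_contra hc
        nlinarith [mul_pos hjp hpi]
      have c1' : l < 1 := by exact_mod_cast c1
      have c2' : -1 < l := by exact_mod_cast c2
      omega
    apply hne
    apply hmono.injective
    rw [hl0] at h5
    push_cast at h5
    linarith
  · have h3 := hA.primitive_add_int_mul (-τ t₁) n
    have h4 : (γ t₂).2 = -(γ t₁).2 + n * (2 * halfPeriod a q) := by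
      rw [h.angle, h.angle, hn, show 2 * (n : ℝ) * π - τ t₁ = -τ t₁ + n * (2 * π) by ring,
        phaseAngle, h3, hTdef, hA.primitive_neg]
    obtain ⟨l, hl⟩ := hdvd n (m - N) (by
      apply mul_right_cancel₀ (b := 2 * π) (by positivity)
      push_cast
      linear_combination (-(j : ℝ)) * hN - (j : ℝ) * h4 - 2 * (n : ℝ) * hT + 2 * j * hm)
    have h5 : τ t₂ + τ t₁ = (2 * j * π) * l := by rw [hn, hl]; ring
    have c1 : (l : ℝ) < 1 := by
      by_contra hc
      nlinarith [mul_pos hjp hpi]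
    have c2 : (-2 : ℝ) < l := by
      by_contra hc
      nlinarith [mul_pos hjp hpi]
    have c1' : l < 1 := by exact_mod_cast c1
    have c2' : -2 < l := by exact_mod_cast c2
    -- The phases lie in `[-jπ, jπ)`; `l = -1` would put both at the left endpoint, contradicting
    -- `t₁ ≠ t₂`.
    obtain rfl | rfl : l = 0 ∨ l = -1 := by omega
    · apply hmono.injective
      rw [h.phase_neg ha hq]
      push_cast at h5
      linarith
    · exfalso
      push_cast at h5
      apply hne
      apply hmono.injective
      linarith [b1.1, b2.1]

theorem diskPoint_neg (h : IsPhase a q γ τ) (ha : 0 < a) (hq : q ∈ Ioo (-1 : ℝ) 1)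
    (t : ℝ) (hd : ∃ n : ℤ, (γ t).2 = n * π) :
    diskPoint a (γ (-t)) = diskPoint a (γ t) := by
  obtain ⟨n, hn⟩ := hd
  refine (diskPoint_eq_iff ha (h.mem _) (h.mem _)).2 ⟨?_, -n, ?_⟩
  · apply height_injOn ha (h.mem _) (h.mem _)
    rw [h.height_eq, h.height_eq, h.phase_neg ha hq, cos_neg]
  · rw [h.angle_neg ha hq, hn]
    push_cast
    ring

/-- The instants `t ∈ (0, ℓ)` at which the geodesic crosses the diameter. -/
theorem exists_crossing (h : IsPhase a q γ τ) (ha : 0 < a) (hq : q ∈ Ioo (-1 : ℝ) 1)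
    (hℓ : (γ ℓ).2 = k * π) : ∃ A : ℕ → ℝ, (∀ i, (γ (A i)).2 = i * π) ∧
      (∀ i ∈ Finset.Ico 1 k, A i ∈ Ioo 0 ℓ) ∧
      ∀ t ∈ Ioo 0 ℓ, (∃ n : ℤ, (γ t).2 = n * π) → ∃ i ∈ Finset.Ico 1 k, A i = t := by
  have hpi := pi_pos
  have hmono := h.strictMono_angle ha hq
  choose A hA using fun i : ℕ => h.surjective_angle ha hq (i * π)
  simp only at hA
  have h0 := h.angle_zero ha hq
  refine ⟨A, hA, fun i hi => ?_, fun t ht hn => ?_⟩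
  · rw [Finset.mem_Ico] at hi
    have i1 : (1 : ℝ) ≤ i := by exact_mod_cast hi.1
    have i2 : (i : ℝ) < k := by exact_mod_cast hi.2
    constructor
    · rw [← hmono.lt_iff_lt]
      simp only [h0, hA]
      positivity
    · rw [← hmono.lt_iff_lt]
      simp only [hℓ, hA]
      exact mul_lt_mul_of_pos_right i2 hpi
  · obtain ⟨n, hn⟩ := hn
    have t1 := hmono ht.1
    have t2 := hmono ht.2
    simp only [h0, hn, hℓ] at t1 t2
    have n1 : (0 : ℝ) < n := pos_of_mul_pos_left t1 hpi.le
    have n2 : (n : ℝ) < k := lt_of_mul_lt_mul_right t2 hpi.le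
    have n1' : 0 < n := by exact_mod_cast n1
    have n2' : n < k := by exact_mod_cast n2
    lift n to ℕ using n1'.le
    refine ⟨n, Finset.mem_Ico.2 ⟨by omega, by omega⟩, ?_⟩
    apply hmono.injective
    simp only [hA, hn]
    norm_cast

/-- The pairs are `(-A i, A i)` with angle `iπ` at `A i`, `1 ≤ i < k`. The instants `0` and `-ℓ`
also lie on the diameter but have no partner: `0` is its own mirror image and `ℓ` is excluded. -/
theorem encard_selfIntersection_pairs (h : IsPhase a q γ τ) (ha : 0 < a)
    (hq : q ∈ Ioo (-1 : ℝ) 1) (hq0 : q ≠ 0) (hj : 0 < j) (hk : 0 < k) (hjk : Nat.Coprime j k)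
    (hT : j * halfPeriod a q = k * π) (hℓ : (γ ℓ).2 = k * π) :
    {x : ℝ × ℝ | x.1 ∈ Ico (-ℓ) ℓ ∧ x.2 ∈ Ico (-ℓ) ℓ ∧ x.1 < x.2 ∧
      diskPoint a (γ x.1) = diskPoint a (γ x.2) ∧
      diskPoint a (γ x.1) ∈ diameter a 0}.encard + 1 = k := by
  obtain ⟨A, hA, hA1, hA2⟩ := h.exists_crossing ha hq hℓ
  have hset : {x : ℝ × ℝ | x.1 ∈ Ico (-ℓ) ℓ ∧ x.2 ∈ Ico (-ℓ) ℓ ∧ x.1 < x.2 ∧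
      diskPoint a (γ x.1) = diskPoint a (γ x.2) ∧ diskPoint a (γ x.1) ∈ diameter a 0} =
      (fun i : ℕ => (-A i, A i)) '' (Finset.Ico 1 k : Finset ℕ) := by
    ext ⟨t₁, t₂⟩
    simp only [mem_ofPred_eq, mem_image, SetLike.mem_coe]
    constructor
    · rintro ⟨h1, h2, h12, heq, hd⟩
      have hd' := (diskPoint_mem_diameter_iff ha (h.mem t₁)).1 hd
      have hneg := h.eq_neg_of_diskPoint_eq ha hq hq0 hj hjk hT hℓ h1 h2 h12.ne heq hd'
      rw [heq] at hd
      obtain ⟨i, hi, rfl⟩ := hA2 t₂ ⟨by linarith, h2.2⟩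
        ((diskPoint_mem_diameter_iff ha (h.mem t₂)).1 hd)
      exact ⟨i, hi, by rw [hneg]⟩
    · rintro ⟨i, hi, hp⟩
      obtain ⟨rfl, rfl⟩ := Prod.mk.inj hp
      have := hA1 i hi
      have hi' : ∃ n : ℤ, (γ (A i)).2 = n * π := ⟨i, by rw [hA]; norm_cast⟩
      have heq := h.diskPoint_neg ha hq _ hi'
      refine ⟨⟨by linarith [this.2], by linarith [this.1, this.2]⟩,
        ⟨by linarith [this.1, this.2], this.2⟩, by linarith [this.1], heq, ?_⟩
      rw [heq]
      exact (diskPoint_mem_diameter_iff ha (h.mem _)).2 hi'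
  have hinj : Function.Injective fun i : ℕ => (-A i, A i) := fun m n hmn => by
    have h1 := hA m
    rw [(Prod.mk.inj hmn).2, hA n] at h1
    have := mul_right_cancel₀ pi_pos.ne' h1
    exact_mod_cast this.symm
  rw [hset, hinj.encard_image, Set.encard_coe_eq_coe_finsetCard, Nat.card_Ico]
  norm_cast
  omega

theorem encard_selfIntersection_points (h : IsPhase a q γ τ) (ha : 0 < a)
    (hq : q ∈ Ioo (-1 : ℝ) 1) (hq0 : q ≠ 0) (hj : 0 < j) (hk : 0 < k) (hjk : Nat.Coprime j k)
    (hT : j * halfPeriod a q = k * π) (hℓ : (γ ℓ).2 = k * π) :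
    {p ∈ diameter a 0 | ∃ t₁ ∈ Ico (-ℓ) ℓ, ∃ t₂ ∈ Ico (-ℓ) ℓ, t₁ ≠ t₂ ∧
      diskPoint a (γ t₁) = p ∧ diskPoint a (γ t₂) = p}.encard + 1 = k := by
  obtain ⟨A, hA, hA1, hA2⟩ := h.exists_crossing ha hq hℓ
  have hA' : ∀ i, ∃ n : ℤ, (γ (A i)).2 = n * π := fun i => ⟨i, by rw [hA]; norm_cast⟩
  have hset : {p ∈ diameter a 0 | ∃ t₁ ∈ Ico (-ℓ) ℓ, ∃ t₂ ∈ Ico (-ℓ) ℓ, t₁ ≠ t₂ ∧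
      diskPoint a (γ t₁) = p ∧ diskPoint a (γ t₂) = p} =
      (fun i : ℕ => diskPoint a (γ (A i))) '' (Finset.Ico 1 k : Finset ℕ) := by
    ext p
    simp only [mem_ofPred_eq, mem_image, SetLike.mem_coe]
    constructor
    · rintro ⟨hd, t₁, h1, t₂, h2, h12, rfl, heq⟩
      have hd1 := (diskPoint_mem_diameter_iff ha (h.mem t₁)).1 hd
      have hneg := h.eq_neg_of_diskPoint_eq ha hq hq0 hj hjk hT hℓ h1 h2 h12 heq.symm hd1
      rcases lt_or_ge 0 t₁ with h0 | h0
      · obtain ⟨i, hi, rfl⟩ := hA2 t₁ ⟨h0, h1.2⟩ hd1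
        exact ⟨i, hi, rfl⟩
      · have h0' : 0 < t₂ := lt_of_le_of_ne (by linarith) fun h00 => h12 (by rw [hneg, ← h00, neg_zero])
        rw [← heq] at hd
        obtain ⟨i, hi, rfl⟩ := hA2 t₂ ⟨h0', h2.2⟩
          ((diskPoint_mem_diameter_iff ha (h.mem t₂)).1 hd)
        exact ⟨i, hi, heq⟩
    · rintro ⟨i, hi, rfl⟩
      have := hA1 i hi
      exact ⟨(diskPoint_mem_diameter_iff ha (h.mem _)).2 (hA' i), -A i,
        ⟨by linarith [this.2], by linarith [this.1, this.2]⟩, A i,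
        ⟨by linarith [this.1, this.2], this.2⟩, by linarith [this.1],
        h.diskPoint_neg ha hq _ (hA' i), rfl⟩
  -- Two coinciding crossings would be opposite instants, yet all `A i` are positive.
  have hinj : InjOn (fun i : ℕ => diskPoint a (γ (A i))) (Finset.Ico 1 k : Finset ℕ) := by
    intro m hm n hn hmn
    have m1 := hA1 m hm
    have n1 := hA1 n hn
    by_contra hne
    have hneA : A m ≠ A n := fun heq => hne <| by
      have h1 := hA m
      rw [heq, hA n] at h1
      exact_mod_cast (mul_right_cancel₀ pi_pos.ne' h1).symm
    have := h.eq_neg_of_diskPoint_eq ha hq hq0 hj hjk hT hℓ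
      ⟨by linarith [m1.1, m1.2], m1.2⟩ ⟨by linarith [n1.1, n1.2], n1.2⟩ hneA hmn (hA' m)
    linarith [m1.1, n1.1]
  rw [hset, hinj.encard_image, Set.encard_coe_eq_coe_finsetCard, Nat.card_Ico]
  norm_cast
  omega

end IsPhase

/-! ### The branches -/

/-- The height of the initial point of `γ_{a,s}`. -/
noncomputable def initialHeight (β : ℝ → ℝ → ℝ) (a s : ℝ) : ℝ := height a (β a s)

namespace IsRadialParametrization

variable {β : ℝ → ℝ → ℝ} {a s : ℝ}

theorem mem_Ioo (hβ : IsRadialParametrization β) (h : (a, s) ∈ strip) :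
    β a s ∈ Ioo 0 (totalLength a) := by
  rw [← hβ.image a h.1]
  exact mem_image_of_mem _ h.2

theorem initialHeight_mem (hβ : IsRadialParametrization β) (h : (a, s) ∈ strip) :
    initialHeight β a s ∈ Ioo (-1 : ℝ) 1 :=
  height_mem_Ioo h.1 (hβ.mem_Ioo h)

theorem initialHeight_zero (hβ : IsRadialParametrization β) (ha : 0 < a) :
    initialHeight β a 0 = 0 := by
  rw [initialHeight, hβ.center a ha, height_cliffordRadius ha]

theorem initialHeight_ne_zero (hβ : IsRadialParametrization β) (h : (a, s) ∈ strip)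
    (hs : s ≠ 0) : initialHeight β a s ≠ 0 := by
  have ha : 0 < a := h.1
  have h0 : ((a, 0) : ℝ × ℝ) ∈ strip := ⟨ha, by simp⟩
  have hc : ContinuousOn (β a) (Ioo (-1) 1) :=
    hβ.analytic.continuousOn.comp (f := fun s => (a, s)) (by fun_prop) fun x hx => ⟨ha, hx⟩
  have hmono : StrictMonoOn (β a) (Ioo (-1) 1) := by
    refine strictMonoOn_of_deriv_pos (convex_Ioo _ _) hc fun x hx => ?_
    rw [interior_Ioo] at hx
    exact hβ.deriv_pos a x ⟨ha, hx⟩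
  rw [← hβ.initialHeight_zero ha]
  exact fun heq => hs <| hmono.injOn h.2 h0.2 <|
    height_injOn ha (hβ.mem_Ioo h) (hβ.mem_Ioo h0) heq

theorem continuousOn_initialHeight (hβ : IsRadialParametrization β) :
    ContinuousOn (fun p : ℝ × ℝ => initialHeight β p.1 p.2) strip := by
  intro p hp
  have h1 : ContinuousWithinAt (fun p : ℝ × ℝ => (p.1, β p.1 p.2)) strip p :=
    continuousWithinAt_fst.prodMk (hβ.analytic.continuousOn p hp)
  have h2 := continuousAt_latitude_uncurry hp.1 (hβ.mem_Ioo hp)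
  exact continuous_cos.continuousAt.comp_continuousWithinAt
    (continuousWithinAt_const.mul
      (ContinuousAt.comp_continuousWithinAt (f := fun p : ℝ × ℝ => (p.1, β p.1 p.2)) h2 h1))

theorem isOrthogonalGeodesic (hβ : IsRadialParametrization β) (h : (a, s) ∈ strip) :
    IsOrthogonalGeodesic a (β a s) (gammaCurve β a s) :=
  Classical.epsilon_spec (exists_isOrthogonalGeodesic h.1 (hβ.mem_Ioo h))

theorem exists_isPhase (hβ : IsRadialParametrization β) (h : (a, s) ∈ strip) :
    ∃ τ, IsPhase a (initialHeight β a s) (gammaCurve β a s) τ :=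
  (hβ.isOrthogonalGeodesic h).exists_isPhase h.1

/-- The angle is a strictly increasing bijection vanishing at `0`, so the set whose infimum defines
`ell` is a singleton. -/
theorem ell_spec (hβ : IsRadialParametrization β) (h : (a, s) ∈ strip) {k : ℕ} (hk : 0 < k) :
    0 < ell β k a s ∧ (gammaCurve β a s (ell β k a s)).2 = k * π := by
  obtain ⟨τ, hτ⟩ := hβ.exists_isPhase h
  have hmono := hτ.strictMono_angle h.1 (hβ.initialHeight_mem h)
  obtain ⟨t, ht⟩ := hτ.surjective_angle h.1 (hβ.initialHeight_mem h) (k * π)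
  have h0 := hτ.angle_zero h.1 (hβ.initialHeight_mem h)
  have hpos : 0 < t := by
    rw [← hmono.lt_iff_lt]
    have : (0 : ℝ) < k := by exact_mod_cast hk
    simp only [h0] at ht ⊢
    rw [ht]
    exact mul_pos this pi_pos
  have hset : {t | 0 < t ∧ (gammaCurve β a s t).2 = k * π} = {t} := by
    ext t'
    simp only [mem_ofPred_eq, mem_singleton_iff]
    refine ⟨fun h' => hmono.injective (h'.2.trans ht.symm), ?_⟩
    rintro rfl
    exact ⟨hpos, ht⟩
  rw [ell, hset, csInf_singleton]
  exact ⟨hpos, ht⟩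

/-- At a nontrivial zero of `f_k` the half period divides `kπ`. -/
theorem exists_int_of_fZero (hβ : IsRadialParametrization β) (h : (a, s) ∈ strip) {k : ℕ}
    (hk : 0 < k) (hs : s ≠ 0) (hf : fZero β k a s = 0) :
    ∃ n : ℤ, (n : ℝ) = k * π / halfPeriod a (initialHeight β a s) := by
  obtain ⟨τ, hτ⟩ := hβ.exists_isPhase h
  have hq := hβ.initialHeight_mem h
  have hd := hτ.deriv_rho (ell β k a s)
  rw [fZero] at hf
  rw [hf, mul_zero] at hd
  have h0 : sin (τ (ell β k a s)) = 0 := by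
    have ha : 0 < a := h.1
    have := (Real.sqrt_pos.2 (one_sub_sq_pos hq)).ne'
    have h1 : (π * a) ^ 2 * √(1 - initialHeight β a s ^ 2) ≠ 0 :=
      mul_ne_zero (pow_ne_zero 2 (mul_pos pi_pos ha).ne') this
    exact (mul_eq_zero.1 ((mul_eq_zero.1 hd.symm).resolve_left h1)).resolve_left
      (hβ.initialHeight_ne_zero h hs)
  obtain ⟨n, hn⟩ := sin_eq_zero_iff.1 h0
  refine ⟨n, ?_⟩
  have hA := isPhaseDensity_angleDensity h.1 hq
  rw [eq_div_iff (halfPeriod_pos h.1 hq).ne', ← (hβ.ell_spec h hk).2, hτ.angle, ← hn]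
  exact (hA.primitive_int_mul_pi n).symm

theorem bifInstant_pos {j k : ℕ} (hl : IsLabel j k) : 0 < bifInstant j k := by
  have hj : (0 : ℝ) < j := by exact_mod_cast hl.1
  have hjk : (j : ℝ) < 2 * k := by exact_mod_cast hl.2.1
  have hk : (0 : ℝ) < k := by linarith
  have h1 : (j : ℝ) / k < 2 := by rw [div_lt_iff₀ hk]; exact hjk
  have h2 : (0 : ℝ) < j / k := by positivity
  have h3 : 0 < 4 - ((j : ℝ) / k) ^ 2 := by nlinarith
  rw [bifInstant]
  positivity

/-- Since `T(a, 0) = π √(a² + 1) / (2a)`, the equation `kπ / T = j` reads `a / √(a² + 1) = j /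
(2k)`, whose solution is `a^j_k`. -/
theorem halfPeriod_bifInstant {j k : ℕ} (hl : IsLabel j k) :
    k * π / halfPeriod (bifInstant j k) 0 = j := by
  have hj : (0 : ℝ) < j := by exact_mod_cast hl.1
  have hjk : (j : ℝ) < 2 * k := by exact_mod_cast hl.2.1
  have hk : (0 : ℝ) < k := by linarith
  have h1 : (j : ℝ) / k < 2 := by rw [div_lt_iff₀ hk]; exact hjk
  have h2 : (0 : ℝ) < j / k := by positivity
  have h3 : 0 < 4 - ((j : ℝ) / k) ^ 2 := by nlinarith
  have h4 := Real.sqrt_pos.2 h3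
  have h5 : √(bifInstant j k ^ 2 + 1) = 2 / √(4 - ((j : ℝ) / k) ^ 2) := by
    rw [← Real.sqrt_sq (div_pos two_pos h4).le, bifInstant]
    have hR := Real.sq_sqrt h3.le
    generalize √(4 - ((j : ℝ) / k) ^ 2) = R at hR h4
    generalize (j : ℝ) / k = x at hR
    congr 1
    field_simp
    linarith
  rw [halfPeriod_zero, h5, bifInstant]
  have := pi_pos
  generalize √(4 - ((j : ℝ) / k) ^ 2) = R at h4
  field_simp

/-- The half period is constant along a branch. -/
theorem halfPeriod_of_mem_branch (hβ : IsRadialParametrization β) {j k : ℕ} (hl : IsLabel j k)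
    (h : (a, s) ∈ branch β j k) :
    (a, s) ∈ strip ∧ j * halfPeriod a (initialHeight β a s) = k * π := by
  have hk : 0 < k := by have := hl.2.1; omega
  set S := strip ∩ closure (zeroSet β k \ trivialBranch) with hS
  have hsub : branch β j k ⊆ S := connectedComponentIn_subset _ _
  -- If the bifurcation point were not in the set, `connectedComponentIn` would be empty by
  -- convention; a point of the branch excludes this.
  have hx0 : ((bifInstant j k, 0) : ℝ × ℝ) ∈ S := by
    by_contra hc
    rw [branch, connectedComponentIn_eq_empty hc] at h
    exact h
  set G : ℝ × ℝ → ℝ := fun p => k * π / halfPeriod p.1 (initialHeight β p.1 p.2) with hG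
  have hGc : ContinuousOn G strip := by
    refine continuousOn_const.div ?_ fun p hp =>
      (halfPeriod_pos hp.1 (hβ.initialHeight_mem hp)).ne'
    exact continuousOn_halfPeriod.comp (f := fun p : ℝ × ℝ => (p.1, initialHeight β p.1 p.2))
      (continuousOn_fst.prodMk hβ.continuousOn_initialHeight)
      fun p hp => ⟨hp.1, hβ.initialHeight_mem hp⟩
  have hZ : ∀ p ∈ zeroSet β k \ trivialBranch, G p ∈ range ((↑) : ℤ → ℝ) := by
    rintro ⟨a, s⟩ ⟨⟨hp, hf⟩, ht⟩
    obtain ⟨n, hn⟩ := hβ.exists_int_of_fZero hp hk (fun h0 => ht ⟨hp.1, h0⟩) hf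
    exact ⟨n, hn⟩
  -- Integrality passes to the closure because the integers are closed in `ℝ`; this covers the
  -- trivial points of the branch, where vanishing of `f_k` carries no information.
  have hSZ : MapsTo G S (range ((↑) : ℤ → ℝ)) := by
    rintro p ⟨hp, hcl⟩
    have hw : ContinuousWithinAt G (zeroSet β k \ trivialBranch) p :=
      (hGc p hp).mono fun x hx => hx.1.1
    have := hw.mem_closure_image hcl
    exact closure_minimal (image_subset_iff.2 hZ : G '' _ ⊆ range ((↑) : ℤ → ℝ))
      Int.isClosedEmbedding_coe_real.isClosed_range this
  have hdisc : IsDiscrete (range ((↑) : ℤ → ℝ)) :=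
    Int.isClosedEmbedding_coe_real.isEmbedding.isDiscrete_range
  have hconst := isPreconnected_connectedComponentIn.constant_of_mapsTo hdisc
    (hGc.mono (hsub.trans inter_subset_left)) (hSZ.mono_left hsub)
    h (mem_connectedComponentIn hx0)
  have hp := (hsub h).1
  refine ⟨hp, ?_⟩
  simp only [hG] at hconst
  rw [hβ.initialHeight_zero (bifInstant_pos hl), halfPeriod_bifInstant hl,
    div_eq_iff (halfPeriod_pos hp.1 (hβ.initialHeight_mem hp)).ne'] at hconst
  exact hconst.symm

end IsRadialParametrization

/-- `T` determines `j / k`, and a fraction in lowest terms determines its numerator and denominator.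
-/
theorem IsLabel.eq_of_mul_eq {j k j' k' : ℕ} (h : IsLabel j k) (h' : IsLabel j' k') {T : ℝ}
    (hT : j * T = k * π) (hT' : j' * T = k' * π) : (j, k) = (j', k') := by
  have h1 : (k' : ℝ) * j = j' * k := by
    have hT0 : T ≠ 0 := by
      rintro rfl
      have hk : (0 : ℝ) < k := by
        have : 0 < k := by have := h.2.1; omega
        exact_mod_cast this
      have := mul_pos hk pi_pos
      linarith
    apply mul_right_cancel₀ (mul_ne_zero hT0 pi_pos.ne')
    linear_combination (k' : ℝ) * π * hT - k * π * hT'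
  have h2 : k' * j = j' * k := by exact_mod_cast h1
  have hj : j = j' := Nat.dvd_antisymm
    (h.2.2.dvd_of_dvd_mul_right ⟨k', by rw [← h2, mul_comm]⟩)
    (h'.2.2.dvd_of_dvd_mul_left ⟨k, h2⟩)
  subst hj
  have : k' = k := Nat.eq_of_mul_eq_mul_right h.1 (by rw [h2, mul_comm])
  rw [this]

/-! ### The Gauss equation for maps with the same first fundamental form -/

section Gauss

variable {V E : Type*} [NormedAddCommGroup V] [NormedSpace ℝ V] [NormedAddCommGroup E]
  {x : V}

section Derivatives

variable [NormedSpace ℝ E] {X : V → E}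

theorem hasFDerivAt_fderiv_apply (hX : ContDiffAt ℝ 2 X x) (v : V) :
    HasFDerivAt (fun y => fderiv ℝ X y v) ((fderiv ℝ (fderiv ℝ X) x).flip v) x := by
  have h1 := ((hX.fderiv_right (m := 1) (by norm_num)).differentiableAt (by norm_num)).hasFDerivAt
  simpa using h1.clm_apply (hasFDerivAt_const v x)

theorem hasFDerivAt_fderiv_fderiv_apply (hX : ContDiffAt ℝ 3 X x) (u v : V) :
    HasFDerivAt (fun y => fderiv ℝ (fderiv ℝ X) y u v)
      (((fderiv ℝ (fderiv ℝ (fderiv ℝ X)) x).flip u).flip v) x := by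
  have h1 := hasFDerivAt_fderiv_apply (hX.fderiv_right (m := 2) (by norm_num)) u
  simpa using h1.clm_apply (hasFDerivAt_const v x)

theorem fderiv_fderiv_symm (hX : ContDiffAt ℝ 2 X x) (u v : V) :
    fderiv ℝ (fderiv ℝ X) x u v = fderiv ℝ (fderiv ℝ X) x v u :=
  hX.isSymmSndFDerivAt (by simp) u v

end Derivatives

variable [InnerProductSpace ℝ E] {X Y : V → E}

/-- The Christoffel symbols of the first kind depend only on the metric. -/
theorem inner_fderiv_fderiv_eq (hX : ContDiffAt ℝ 2 X x) (hY : ContDiffAt ℝ 2 Y x)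
    (hg : ∀ᶠ y in 𝓝 x, ∀ u v, inner ℝ (fderiv ℝ X y u) (fderiv ℝ X y v) =
      inner ℝ (fderiv ℝ Y y u) (fderiv ℝ Y y v)) (u v w : V) :
    inner ℝ (fderiv ℝ (fderiv ℝ X) x u v) (fderiv ℝ X x w) =
      inner ℝ (fderiv ℝ (fderiv ℝ Y) x u v) (fderiv ℝ Y x w) := by
  have key : ∀ u v w, inner ℝ (fderiv ℝ X x v) (fderiv ℝ (fderiv ℝ X) x u w) +
      inner ℝ (fderiv ℝ (fderiv ℝ X) x u v) (fderiv ℝ X x w) =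
      inner ℝ (fderiv ℝ Y x v) (fderiv ℝ (fderiv ℝ Y) x u w) +
      inner ℝ (fderiv ℝ (fderiv ℝ Y) x u v) (fderiv ℝ Y x w) := fun u v w => by
    have h1 := (hasFDerivAt_fderiv_apply hX v).inner ℝ (hasFDerivAt_fderiv_apply hX w)
    have h2 := (hasFDerivAt_fderiv_apply hY v).inner ℝ (hasFDerivAt_fderiv_apply hY w)
    have h3 := h1.congr_of_eventuallyEq (hg.mono fun y hy => (hy v w).symm)
    simpa using DFunLike.congr_fun (h3.unique h2) u
  -- The Koszul combination `k1 + k2 - k3` of the cyclic permutations isolates one second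
  -- derivative.
  have k1 := key u v w
  have k2 := key v w u
  have k3 := key w u v
  rw [fderiv_fderiv_symm hX v u, fderiv_fderiv_symm hY v u] at k2
  rw [fderiv_fderiv_symm hX w v, fderiv_fderiv_symm hY w v,
    fderiv_fderiv_symm hX w u, fderiv_fderiv_symm hY w u] at k3
  have c1 := real_inner_comm (fderiv ℝ X x v) (fderiv ℝ (fderiv ℝ X) x u w)
  have c2 := real_inner_comm (fderiv ℝ X x w) (fderiv ℝ (fderiv ℝ X) x u v)
  have c3 := real_inner_comm (fderiv ℝ X x u) (fderiv ℝ (fderiv ℝ X) x v w)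
  have d1 := real_inner_comm (fderiv ℝ Y x v) (fderiv ℝ (fderiv ℝ Y) x u w)
  have d2 := real_inner_comm (fderiv ℝ Y x w) (fderiv ℝ (fderiv ℝ Y) x u v)
  have d3 := real_inner_comm (fderiv ℝ Y x u) (fderiv ℝ (fderiv ℝ Y) x v w)
  linarith

/-- The difference of products of second derivatives in the Gauss equation depends only on the
metric. -/
theorem gauss_equation (hX : ContDiffAt ℝ 3 X x) (hY : ContDiffAt ℝ 3 Y x)
    (hg : ∀ᶠ y in 𝓝 x, ∀ u v, inner ℝ (fderiv ℝ X y u) (fderiv ℝ X y v) =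
      inner ℝ (fderiv ℝ Y y u) (fderiv ℝ Y y v)) (u v w z : V) :
    inner ℝ (fderiv ℝ (fderiv ℝ X) x u v) (fderiv ℝ (fderiv ℝ X) x z w) -
      inner ℝ (fderiv ℝ (fderiv ℝ X) x z v) (fderiv ℝ (fderiv ℝ X) x u w) =
    inner ℝ (fderiv ℝ (fderiv ℝ Y) x u v) (fderiv ℝ (fderiv ℝ Y) x z w) -
      inner ℝ (fderiv ℝ (fderiv ℝ Y) x z v) (fderiv ℝ (fderiv ℝ Y) x u w) := by
  have hle : (2 : ℕ∞ω) ≤ 3 := by norm_num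
  have hev : ∀ᶠ y in 𝓝 x, ∀ u v w,
      inner ℝ (fderiv ℝ (fderiv ℝ X) y u v) (fderiv ℝ X y w) =
      inner ℝ (fderiv ℝ (fderiv ℝ Y) y u v) (fderiv ℝ Y y w) := by
    filter_upwards [hg.eventually_nhds, (hX.of_le hle).eventually (by simp),
      (hY.of_le hle).eventually (by simp)] with y h1 h2 h3
    exact inner_fderiv_fderiv_eq h2 h3 h1
  have key : ∀ u v w z,
      inner ℝ (fderiv ℝ (fderiv ℝ X) x u v) (fderiv ℝ (fderiv ℝ X) x z w) +
      inner ℝ (fderiv ℝ (fderiv ℝ (fderiv ℝ X)) x z u v) (fderiv ℝ X x w) =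
      inner ℝ (fderiv ℝ (fderiv ℝ Y) x u v) (fderiv ℝ (fderiv ℝ Y) x z w) +
      inner ℝ (fderiv ℝ (fderiv ℝ (fderiv ℝ Y)) x z u v) (fderiv ℝ Y x w) := fun u v w z => by
    have h1 := (hasFDerivAt_fderiv_fderiv_apply hX u v).inner ℝ
      (hasFDerivAt_fderiv_apply (hX.of_le hle) w)
    have h2 := (hasFDerivAt_fderiv_fderiv_apply hY u v).inner ℝ
      (hasFDerivAt_fderiv_apply (hY.of_le hle) w)
    have h3 := h1.congr_of_eventuallyEq (hev.mono fun y hy => (hy u v w).symm)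
    simpa using DFunLike.congr_fun (h3.unique h2) z
  -- These are derivatives of the Christoffel symbols; exchanging `u` and `z` leaves the third-order
  -- term unchanged, so it cancels in the difference.
  have k1 := key u v w z
  have k2 := key z v w u
  rw [fderiv_fderiv_symm (hX.fderiv_right (m := 2) (by norm_num)) z u,
    fderiv_fderiv_symm (hY.fderiv_right (m := 2) (by norm_num)) z u] at k1
  linarith

end Gauss

/-! ### The curvature of the ellipsoid -/

/-- The space `ℂ²` with its Euclidean norm. -/
abbrev C2 : Type := EuclideanSpace ℂ (Fin 2)

theorem inner_C2 (x y : C2) : inner ℝ x y = inner ℝ (x 0) (y 0) + inner ℝ (x 1) (y 1) := by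
  rw [PiLp.inner_apply, Fin.sum_univ_two]

/-- The linear map `(z, w) ↦ (c z, w)`. -/
noncomputable def scaleFst (c : ℝ) : C2 →L[ℝ] C2 :=
  LinearMap.toContinuousLinearMap
    { toFun := fun x => !₂[(c : ℂ) * x 0, x 1]
      map_add' := fun x y => by
        ext i
        fin_cases i <;> simp [mul_add]
      map_smul' := fun r x => by
        ext i
        fin_cases i <;> simp [mul_left_comm] }

@[simp] theorem scaleFst_zero (c : ℝ) (x : C2) : scaleFst c x 0 = c * x 0 := rfl

@[simp] theorem scaleFst_one (c : ℝ) (x : C2) : scaleFst c x 1 = x 1 := rfl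

theorem inner_ofReal_mul (c : ℝ) (z w : ℂ) : inner ℝ ((c : ℂ) * z) w = c * inner ℝ z w := by
  rw [← Complex.real_smul, real_inner_smul_left]

theorem inner_scaleFst (c : ℝ) (x y : C2) :
    inner ℝ (scaleFst c x) y = c * inner ℝ (x 0) (y 0) + inner ℝ (x 1) (y 1) := by
  rw [inner_C2, scaleFst_zero, scaleFst_one, inner_ofReal_mul]

theorem inner_scaleFst_comm (c : ℝ) (x y : C2) :
    inner ℝ (scaleFst c x) y = inner ℝ x (scaleFst c y) := by
  rw [real_inner_comm (scaleFst c y) x, inner_scaleFst, inner_scaleFst,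
    real_inner_comm (y 0) (x 0), real_inner_comm (y 1) (x 1)]

theorem sum_inner_scaleFst (c : ℝ) (b : OrthonormalBasis (Fin 4) ℝ C2) :
    ∑ i, inner ℝ (scaleFst c (b i)) (b i) = 2 * c + 2 := by
  have h := LinearMap.trace_eq_sum_inner (scaleFst c : C2 →ₗ[ℝ] C2) b
  have h' := LinearMap.trace_eq_sum_inner (scaleFst c : C2 →ₗ[ℝ] C2)
    (Pi.orthonormalBasis (fun _ : Fin 2 => Complex.orthonormalBasisOneI))
  rw [h] at h'
  simp only [ContinuousLinearMap.coe_coe, ← inner_scaleFst_comm] at h'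
  refine h'.trans ?_
  rw [Fintype.sum_sigma]
  simp [Fin.sum_univ_two, inner_scaleFst, Pi.orthonormalBasis_apply]
  ring

theorem scaleFst_scaleFst (c d : ℝ) (x : C2) : scaleFst c (scaleFst d x) = scaleFst (c * d) x := by
  ext i
  fin_cases i <;> simp [mul_assoc]

theorem norm_sq_C2 (x : C2) : ‖x‖ ^ 2 = ‖x 0‖ ^ 2 + ‖x 1‖ ^ 2 := by
  rw [EuclideanSpace.norm_sq_eq, Fin.sum_univ_two]

theorem inner_scaleFst_self (c : ℝ) (x : C2) :
    inner ℝ (scaleFst c x) x = c * ‖x 0‖ ^ 2 + ‖x 1‖ ^ 2 := by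
  rw [inner_scaleFst, real_inner_self_eq_norm_sq, real_inner_self_eq_norm_sq]

theorem norm_scaleFst_sq (c : ℝ) (x : C2) :
    ‖scaleFst c x‖ ^ 2 = inner ℝ (scaleFst (c * c) x) x := by
  rw [← real_inner_self_eq_norm_sq, inner_scaleFst_comm, scaleFst_scaleFst, real_inner_comm]

/-- The scalar curvature of an ellipsoid in terms of an orthonormal frame whose first vector is
the normal, before the normalization of the second fundamental form. -/
theorem sum_scaleFst_minors (c : ℝ) (b : OrthonormalBasis (Fin 4) ℝ C2) :
    ∑ i : Fin 3, ∑ j : Fin 3,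
      (inner ℝ (scaleFst c (b i.succ)) (b i.succ) * inner ℝ (scaleFst c (b j.succ)) (b j.succ) -
        inner ℝ (scaleFst c (b i.succ)) (b j.succ) ^ 2) =
    (2 * c + 2 - inner ℝ (scaleFst c (b 0)) (b 0)) ^ 2 - (2 * (c * c) + 2) +
      2 * ‖scaleFst c (b 0)‖ ^ 2 - inner ℝ (scaleFst c (b 0)) (b 0) ^ 2 := by
  have h1 := sum_inner_scaleFst c b
  have h2 := sum_inner_scaleFst (c * c) b
  simp only [← norm_scaleFst_sq] at h2
  have h3 : ∀ x : C2, ‖x‖ ^ 2 = ∑ j, inner ℝ x (b j) ^ 2 := fun x => by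
    rw [← b.sum_sq_norm_inner_left x]
    simp
  have h4 : ∀ i j, inner ℝ (scaleFst c (b i)) (b j) = inner ℝ (scaleFst c (b j)) (b i) :=
    fun i j => by rw [inner_scaleFst_comm, real_inner_comm]
  have h5 := h3 (scaleFst c (b 0))
  rw [Fin.sum_univ_succ] at h1 h5
  simp only [h3] at h2
  simp only [Fin.sum_univ_succ (n := 3), Finset.sum_add_distrib] at h2
  simp only [Finset.sum_sub_distrib, ← Finset.mul_sum, ← Finset.sum_mul]
  simp only [h4 _ 0] at h2
  generalize ∑ i : Fin 3, inner ℝ (scaleFst c (b i.succ)) (b i.succ) = s at *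
  generalize ∑ i : Fin 3, ∑ j : Fin 3, inner ℝ (scaleFst c (b i.succ)) (b j.succ) ^ 2 = r at *
  rw [h5]
  -- The sum of minors is `s ^ 2 - r`, the squared trace minus the squared Hilbert–Schmidt norm of
  -- the tangential block; both are obtained from the full operator by removing the row and column
  -- of `b 0`.
  have h6 : s = 2 * c + 2 - inner ℝ (scaleFst c (b 0)) (b 0) := by linarith
  rw [← h6]
  simp only [h4 0 _] at *
  linarith

theorem mem_ellipsoid_iff {a : ℝ} {p : C2} :
    p ∈ ellipsoid a ↔ inner ℝ (scaleFst (a ^ 2)⁻¹ p) p = 1 := by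
  rw [inner_scaleFst_self, ellipsoid, mem_ofPred_eq, div_eq_inv_mul]

section Quadric

variable {V : Type*} [NormedAddCommGroup V] [NormedSpace ℝ V] {X Y : V → C2} {x : V} {c : ℝ}

/-- Differentiating the equation of the quadric shows that its gradient `scaleFst c (X x)` is
normal. -/
theorem inner_scaleFst_fderiv (hX : DifferentiableAt ℝ X x)
    (hQ : ∀ᶠ y in 𝓝 x, inner ℝ (scaleFst c (X y)) (X y) = 1) (v : V) :
    inner ℝ (scaleFst c (X x)) (fderiv ℝ X x v) = 0 := by
  have h1 := (((scaleFst c).hasFDerivAt.comp x hX.hasFDerivAt).inner ℝ hX.hasFDerivAt)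
  have h2 := h1.congr_of_eventuallyEq (hQ.mono fun y hy => hy.symm)
  have h3 := DFunLike.congr_fun (h2.unique (hasFDerivAt_const 1 x)) v
  simp only [ContinuousLinearMap.comp_apply, ContinuousLinearMap.prod_apply,
    fderivInnerCLM_apply, Function.comp_apply, zero_apply] at h3
  rw [inner_scaleFst_comm c (fderiv ℝ X x v), real_inner_comm] at h3
  rw [real_inner_comm]
  linarith

/-- The second fundamental form of a quadric. -/
theorem inner_scaleFst_fderiv_fderiv (hX : ContDiffAt ℝ 2 X x)
    (hQ : ∀ᶠ y in 𝓝 x, inner ℝ (scaleFst c (X y)) (X y) = 1) (u v : V) :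
    inner ℝ (fderiv ℝ (fderiv ℝ X) x u v) (scaleFst c (X x)) =
      -inner ℝ (scaleFst c (fderiv ℝ X x u)) (fderiv ℝ X x v) := by
  have hd : ∀ᶠ y in 𝓝 x, inner ℝ (scaleFst c (X y)) (fderiv ℝ X y v) = 0 := by
    filter_upwards [hQ.eventually_nhds, hX.eventually (by simp)] with y h1 h2
    exact inner_scaleFst_fderiv (h2.differentiableAt (by norm_num)) h1 v
  have hXd := (hX.differentiableAt (by norm_num)).hasFDerivAt
  have h1 := (((scaleFst c).hasFDerivAt.comp x hXd).inner ℝ (hasFDerivAt_fderiv_apply hX v))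
  have h2 := h1.congr_of_eventuallyEq (hd.mono fun y hy => hy.symm)
  have h3 := DFunLike.congr_fun (h2.unique (hasFDerivAt_const 0 x)) u
  simp only [ContinuousLinearMap.comp_apply, ContinuousLinearMap.prod_apply,
    fderivInnerCLM_apply, Function.comp_apply, zero_apply,
    ContinuousLinearMap.flip_apply] at h3
  rw [real_inner_comm (scaleFst c (X x))]
  linarith

/-- The minors of the second fundamental form of a quadric depend only on the metric. -/
theorem minors_eq_of_metric_eq (hX : ContDiffAt ℝ 3 X x) (hY : ContDiffAt ℝ 3 Y x)
    (hg : ∀ᶠ y in 𝓝 x, ∀ u v, inner ℝ (fderiv ℝ X y u) (fderiv ℝ X y v) =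
      inner ℝ (fderiv ℝ Y y u) (fderiv ℝ Y y v))
    (hQX : ∀ᶠ y in 𝓝 x, inner ℝ (scaleFst c (X y)) (X y) = 1)
    (hQY : ∀ᶠ y in 𝓝 x, inner ℝ (scaleFst c (Y y)) (Y y) = 1)
    {e : Fin 3 → V} {bX bY : OrthonormalBasis (Fin 4) ℝ C2} {N M : ℝ}
    (hX0 : bX 0 = N⁻¹ • scaleFst c (X x)) (hXe : ∀ i : Fin 3, bX i.succ = fderiv ℝ X x (e i))
    (hY0 : bY 0 = M⁻¹ • scaleFst c (Y x)) (hYe : ∀ i : Fin 3, bY i.succ = fderiv ℝ Y x (e i))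
    (i j : Fin 3) :
    (N ^ 2)⁻¹ * (inner ℝ (scaleFst c (bX i.succ)) (bX i.succ) *
      inner ℝ (scaleFst c (bX j.succ)) (bX j.succ) -
        inner ℝ (scaleFst c (bX i.succ)) (bX j.succ) ^ 2) =
    (M ^ 2)⁻¹ * (inner ℝ (scaleFst c (bY i.succ)) (bY i.succ) *
      inner ℝ (scaleFst c (bY j.succ)) (bY j.succ) -
        inner ℝ (scaleFst c (bY i.succ)) (bY j.succ) ^ 2) := by
  have hle : (2 : ℕ∞ω) ≤ 3 := by norm_num
  have hC := inner_fderiv_fderiv_eq (hX.of_le hle) (hY.of_le hle) hg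
  have hG := gauss_equation hX hY hg (e i) (e i) (e j) (e j)
  have hkX : ∀ u v, inner ℝ (fderiv ℝ (fderiv ℝ X) x u v) (bX 0) =
      -(N⁻¹ * inner ℝ (scaleFst c (fderiv ℝ X x u)) (fderiv ℝ X x v)) := fun u v => by
    rw [hX0, real_inner_smul_right, inner_scaleFst_fderiv_fderiv (hX.of_le hle) hQX, mul_neg]
  have hkY : ∀ u v, inner ℝ (fderiv ℝ (fderiv ℝ Y) x u v) (bY 0) =
      -(M⁻¹ * inner ℝ (scaleFst c (fderiv ℝ Y x u)) (fderiv ℝ Y x v)) := fun u v => by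
    rw [hY0, real_inner_smul_right, inner_scaleFst_fderiv_fderiv (hY.of_le hle) hQY, mul_neg]
  -- In the adapted frame the tangential components of the second derivatives are Christoffel
  -- symbols, equal for `X` and `Y`. After they cancel, the Gauss equation compares only normal
  -- components, the second fundamental forms.
  have hpX : ∀ A B : C2, inner ℝ A B = inner ℝ A (bX 0) * inner ℝ B (bX 0) +
      ∑ i : Fin 3, inner ℝ A (fderiv ℝ X x (e i)) * inner ℝ B (fderiv ℝ X x (e i)) := fun A B => by
    rw [← bX.sum_inner_mul_inner A B, Fin.sum_univ_succ]
    simp only [hXe, real_inner_comm B]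
  have hpY : ∀ A B : C2, inner ℝ A B = inner ℝ A (bY 0) * inner ℝ B (bY 0) +
      ∑ i : Fin 3, inner ℝ A (fderiv ℝ Y x (e i)) * inner ℝ B (fderiv ℝ Y x (e i)) := fun A B => by
    rw [← bY.sum_inner_mul_inner A B, Fin.sum_univ_succ]
    simp only [hYe, real_inner_comm B]
  rw [hpX (fderiv ℝ (fderiv ℝ X) x (e i) (e i)), hpX (fderiv ℝ (fderiv ℝ X) x (e j) (e i)),
    hpY (fderiv ℝ (fderiv ℝ Y) x (e i) (e i)), hpY (fderiv ℝ (fderiv ℝ Y) x (e j) (e i))] at hG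
  simp only [hC, hkX, hkY] at hG
  have sX : inner ℝ (scaleFst c (fderiv ℝ X x (e j))) (fderiv ℝ X x (e i)) =
      inner ℝ (scaleFst c (fderiv ℝ X x (e i))) (fderiv ℝ X x (e j)) := by
    rw [inner_scaleFst_comm, real_inner_comm]
  have sY : inner ℝ (scaleFst c (fderiv ℝ Y x (e j))) (fderiv ℝ Y x (e i)) =
      inner ℝ (scaleFst c (fderiv ℝ Y x (e i))) (fderiv ℝ Y x (e j)) := by
    rw [inner_scaleFst_comm, real_inner_comm]
  rw [sX, sY] at hG
  simp only [hXe, hYe, ← inv_pow]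
  linarith

end Quadric

/-! ### Isometries preserve the modulus of the first coordinate if `a ≠ 1` -/

/-- The radial projection onto the quadric `c |z|² + |w|² = 1`. -/
noncomputable def radialProj (c : ℝ) (x : C2) : C2 := (√(inner ℝ (scaleFst c x) x))⁻¹ • x

theorem inner_scaleFst_pos {c : ℝ} (hc : 0 < c) {x : C2} (hx : x ≠ 0) :
    0 < inner ℝ (scaleFst c x) x := by
  rw [inner_scaleFst_self]
  have h := norm_sq_C2 x
  have h1 : 0 < ‖x‖ ^ 2 := by positivity
  rcases (sq_nonneg ‖x 0‖).lt_or_eq with h0 | h0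
  · positivity
  · rw [← h0] at h ⊢
    linarith

theorem contDiffAt_inner_scaleFst (c : ℝ) (x : C2) {n : ℕ∞ω} :
    ContDiffAt ℝ n (fun x => inner ℝ (scaleFst c x) x) x :=
  ((scaleFst c).contDiff.contDiffAt).inner ℝ contDiffAt_id

theorem contDiffAt_radialProj {c : ℝ} (hc : 0 < c) {x : C2} (hx : x ≠ 0) {n : ℕ∞ω} :
    ContDiffAt ℝ n (radialProj c) x := by
  have h := inner_scaleFst_pos hc hx
  exact (((contDiffAt_inner_scaleFst c x).sqrt h.ne').inv (Real.sqrt_pos.2 h).ne').smul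
    contDiffAt_id

theorem inner_scaleFst_radialProj {c : ℝ} (hc : 0 < c) {x : C2} (hx : x ≠ 0) :
    inner ℝ (scaleFst c (radialProj c x)) (radialProj c x) = 1 := by
  have h := inner_scaleFst_pos hc hx
  rw [radialProj, map_smul, real_inner_smul_left, real_inner_smul_right, ← mul_assoc,
    ← mul_inv, Real.mul_self_sqrt h.le, inv_mul_cancel₀ h.ne']

theorem radialProj_of_inner_eq_one {c : ℝ} {x : C2} (hx : inner ℝ (scaleFst c x) x = 1) :
    radialProj c x = x := by
  rw [radialProj, hx, Real.sqrt_one, inv_one, one_smul]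

/-- The normalizing factor is `1` at `x` and stationary in tangent directions. This makes the radial
projection, defined on an open subset of `ℂ²`, usable as a degenerate parametrization of the
quadric. -/
theorem fderiv_radialProj {c : ℝ} {x v : C2} (hx : inner ℝ (scaleFst c x) x = 1)
    (hv : inner ℝ (scaleFst c x) v = 0) : fderiv ℝ (radialProj c) x v = v := by
  have h1 : HasFDerivAt (fun x => inner ℝ (scaleFst c x) x) _ x :=
    (scaleFst c).hasFDerivAt.inner ℝ (hasFDerivAt_id x)
  have h0 : inner ℝ (scaleFst c x) x ≠ 0 := by rw [hx]; exact one_ne_zero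
  have hs : √(inner ℝ (scaleFst c x) x) ≠ 0 := by rw [hx, Real.sqrt_one]; exact one_ne_zero
  have h2 := (((hasDerivAt_inv hs).comp_hasFDerivAt x (h1.sqrt h0)).smul
    (hasFDerivAt_id x)).fderiv
  have h3 : radialProj c = ((fun t : ℝ => t⁻¹) ∘ fun x => √(inner ℝ (scaleFst c x) x)) • id := rfl
  have h4 : inner ℝ (scaleFst c v) x = 0 := by rw [inner_scaleFst_comm, real_inner_comm, hv]
  rw [h3]
  erw [h2]
  simp [hx, hv, h4]

theorem exists_orthonormalBasis_cons {v : Fin 4 → C2} (hv : Orthonormal ℝ v) :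
    ∃ b : OrthonormalBasis (Fin 4) ℝ C2, ∀ i, b i = v i := by
  have hcard : Module.finrank ℝ C2 = Fintype.card (Fin 4) := by
    rw [(WithLp.linearEquiv 2 ℝ (Fin 2 → ℂ)).finrank_eq, Module.finrank_pi_fintype]
    simp [Complex.finrank_real_complex]
  obtain ⟨b, hb⟩ := Orthonormal.exists_orthonormalBasis_extension_of_card_eq hcard (v := v)
    (s := univ) (hv.comp _ Subtype.val_injective)
  exact ⟨b, fun i => hb i (mem_univ i)⟩

theorem exists_orthonormalBasis_zero {n : C2} (hn : ‖n‖ = 1) :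
    ∃ b : OrthonormalBasis (Fin 4) ℝ C2, b 0 = n := by
  have hcard : Module.finrank ℝ C2 = Fintype.card (Fin 4) := by
    rw [(WithLp.linearEquiv 2 ℝ (Fin 2 → ℂ)).finrank_eq, Module.finrank_pi_fintype]
    simp [Complex.finrank_real_complex]
  obtain ⟨b, hb⟩ := Orthonormal.exists_orthonormalBasis_extension_of_card_eq hcard
    (v := fun _ : Fin 4 => n) (s := {0}) (by
      refine ⟨fun _ => hn, fun i j hij => ?_⟩
      exact absurd (Subsingleton.elim i j) hij)
  exact ⟨b, hb 0 (mem_singleton _)⟩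

/-- The sum of the minors of the second fundamental form at a point of the quadric. -/
theorem scalar_curvature_eq {c : ℝ} {p : C2} (hp : inner ℝ (scaleFst c p) p = 1) {N : ℝ}
    (hN : N = ‖scaleFst c p‖) (hN0 : 0 < N) {b : OrthonormalBasis (Fin 4) ℝ C2}
    (hb : b 0 = N⁻¹ • scaleFst c p) :
    ∑ i : Fin 3, ∑ j : Fin 3,
      (inner ℝ (scaleFst c (b i.succ)) (b i.succ) * inner ℝ (scaleFst c (b j.succ)) (b j.succ) -
        inner ℝ (scaleFst c (b i.succ)) (b j.succ) ^ 2) = 2 * c + 2 * c * (c + 1) * (N ^ 2)⁻¹ := by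
  rw [sum_scaleFst_minors, hb, map_smul, norm_smul, real_inner_smul_left, real_inner_smul_right,
    scaleFst_scaleFst, mul_pow, norm_scaleFst_sq, inner_scaleFst_comm, scaleFst_scaleFst,
    ← inner_scaleFst_comm, inner_scaleFst_self, inner_scaleFst_self]
  have h1 : N ^ 2 = c * c * ‖p 0‖ ^ 2 + ‖p 1‖ ^ 2 := by
    rw [hN, norm_scaleFst_sq, inner_scaleFst_self]
  rw [inner_scaleFst_self] at hp
  have hy : ‖p 1‖ ^ 2 = 1 - c * ‖p 0‖ ^ 2 := by linarith
  rw [hy] at h1 ⊢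
  rw [Real.norm_of_nonneg (inv_pos.2 hN0).le]
  generalize ‖p 0‖ ^ 2 = z at *
  field_simp
  have h2 : N ^ 4 = (c * c * z + (1 - c * z)) ^ 2 := by rw [← h1]; ring
  simp only [h2, h1]
  ring

/-- Near `p`, the maps `radialProj` and `F ∘ radialProj` induce the same first fundamental form,
hence the same scalar curvature. That curvature is a strictly increasing function of `(N ^ 2)⁻¹`,
where `N` is the norm of the gradient of the quadric. -/
theorem IsEllipsoidIsometry.norm_scaleFst_eq {a : ℝ} (ha : 0 < a) {F : C2 → C2}
    (hF : IsEllipsoidIsometry a F) {p : C2} (hp : p ∈ ellipsoid a) :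
    ‖scaleFst (a ^ 2)⁻¹ (F p)‖ = ‖scaleFst (a ^ 2)⁻¹ p‖ := by
  obtain ⟨hbij, ⟨U, hU, hEU, hFU⟩, hiso⟩ := hF
  set c := (a ^ 2)⁻¹ with hc
  have hc0 : 0 < c := by positivity
  have hne : ∀ {p : C2}, p ∈ ellipsoid a → p ≠ 0 := by
    rintro p hp rfl
    rw [mem_ellipsoid_iff] at hp
    simp at hp
  have hp1 := mem_ellipsoid_iff.1 hp
  have hq := hbij.1 hp
  have hq1 := mem_ellipsoid_iff.1 hq
  set X := radialProj c with hX
  have hXm : ∀ {x : C2}, x ≠ 0 → X x ∈ ellipsoid a := fun hx =>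
    mem_ellipsoid_iff.2 (inner_scaleFst_radialProj hc0 hx)
  have hXp : X p = p := radialProj_of_inner_eq_one hp1
  have hXs : ∀ {x : C2}, x ≠ 0 → ContDiffAt ℝ 3 X x := fun hx => contDiffAt_radialProj hc0 hx
  have hFs : ∀ {x : C2}, x ∈ ellipsoid a → ContDiffAt ℝ 3 F x := fun hx =>
    by exact_mod_cast contDiffAt_infty.1 (hFU.contDiffAt (hU.mem_nhds (hEU hx))) 3
  have hev : ∀ᶠ x : C2 in 𝓝 p, x ≠ 0 := isOpen_ne.mem_nhds (hne hp)
  have hQX : ∀ᶠ x in 𝓝 p, inner ℝ (scaleFst c (X x)) (X x) = 1 :=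
    hev.mono fun x hx => inner_scaleFst_radialProj hc0 hx
  have hQY : ∀ᶠ x in 𝓝 p, inner ℝ (scaleFst c ((F ∘ X) x)) ((F ∘ X) x) = 1 :=
    hev.mono fun x hx => mem_ellipsoid_iff.1 (hbij.1 (hXm hx))
  -- Polarization: preservation of tangent norms gives preservation of tangent inner products.
  have hiso' : ∀ p ∈ ellipsoid a, ∀ u v : C2, inner ℝ (scaleFst c p) u = 0 →
      inner ℝ (scaleFst c p) v = 0 →
      inner ℝ (fderiv ℝ F p u) (fderiv ℝ F p v) = inner ℝ u v := by
    have h0 : ∀ p ∈ ellipsoid a, ∀ v : C2, inner ℝ (scaleFst c p) v = 0 →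
        ‖fderiv ℝ F p v‖ = ‖v‖ := fun p hp v hv => by
      apply hiso p hp v
      rw [← hv, inner_scaleFst, hc, div_eq_inv_mul]
    intro p hp u v hu hv
    have h1 := h0 p hp u hu
    have h2 := h0 p hp v hv
    have h3 := h0 p hp (u + v) (by rw [inner_add_right, hu, hv, add_zero])
    rw [map_add] at h3
    have h4 := norm_add_sq_real u v
    have h5 := norm_add_sq_real (fderiv ℝ F p u) (fderiv ℝ F p v)
    rw [h1, h2, h3] at h5
    linarith
  have hYd : ∀ {x : C2}, x ≠ 0 → fderiv ℝ (F ∘ X) x = (fderiv ℝ F (X x)).comp (fderiv ℝ X x) :=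
    fun hx => fderiv_comp _ ((hFs (hXm hx)).differentiableAt (by norm_num))
      ((hXs hx).differentiableAt (by norm_num))
  have hg : ∀ᶠ x in 𝓝 p, ∀ u v, inner ℝ (fderiv ℝ X x u) (fderiv ℝ X x v) =
      inner ℝ (fderiv ℝ (F ∘ X) x u) (fderiv ℝ (F ∘ X) x v) := by
    filter_upwards [hev, hQX.eventually_nhds] with x hx hx2 u v
    rw [hYd hx]
    exact (hiso' _ (hXm hx) _ _
      (inner_scaleFst_fderiv ((hXs hx).differentiableAt (by norm_num)) hx2 u)
      (inner_scaleFst_fderiv ((hXs hx).differentiableAt (by norm_num)) hx2 v)).symm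
  have hN : 0 < ‖scaleFst c p‖ := norm_pos_iff.2 fun h => by rw [h] at hp1; simp at hp1
  have hM : 0 < ‖scaleFst c (F p)‖ := norm_pos_iff.2 fun h => by rw [h] at hq1; simp at hq1
  set N := ‖scaleFst c p‖ with hNdef
  set M := ‖scaleFst c (F p)‖ with hMdef
  obtain ⟨bX, hbX⟩ := exists_orthonormalBasis_zero (n := N⁻¹ • scaleFst c p) (by
    rw [norm_smul, norm_inv, Real.norm_of_nonneg hN.le, ← hNdef, inv_mul_cancel₀ hN.ne'])
  have htan : ∀ i : Fin 3, inner ℝ (scaleFst c p) (bX i.succ) = 0 := fun i => by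
    have : inner ℝ (bX 0) (bX i.succ) = 0 := bX.orthonormal.2 (Fin.succ_ne_zero i).symm
    rw [hbX, real_inner_smul_left] at this
    exact (mul_eq_zero.1 this).resolve_left (inv_pos.2 hN).ne'
  have hXe : ∀ i : Fin 3, bX i.succ = fderiv ℝ X p (bX i.succ) := fun i =>
    (fderiv_radialProj hp1 (htan i)).symm
  have hYe' : ∀ i : Fin 3, fderiv ℝ (F ∘ X) p (bX i.succ) = fderiv ℝ F p (bX i.succ) := fun i => by
    rw [hYd (hne hp), ContinuousLinearMap.comp_apply, ← hXe, hXp]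
  have hYc : ContDiffAt ℝ 3 (F ∘ X) p :=
    ContDiffAt.comp p (by rw [hXp]; exact hFs hp) (hXs (hne hp))
  have hYp : (F ∘ X) p = F p := by rw [Function.comp_apply, hXp]
  have hnY : ∀ v, inner ℝ (scaleFst c (F p)) (fderiv ℝ (F ∘ X) p v) = 0 := fun v => by
    have := inner_scaleFst_fderiv (hYc.differentiableAt (by norm_num)) hQY v
    rwa [hYp] at this
  have horth : Orthonormal ℝ (Fin.cons (M⁻¹ • scaleFst c (F p))
      fun i : Fin 3 => fderiv ℝ (F ∘ X) p (bX i.succ) : Fin 4 → C2) := by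
    have h1 : ‖M⁻¹ • scaleFst c (F p)‖ = 1 := by
      rw [norm_smul, norm_inv, Real.norm_of_nonneg hM.le, ← hMdef, inv_mul_cancel₀ hM.ne']
    have h2 : ∀ v, inner ℝ (M⁻¹ • scaleFst c (F p)) (fderiv ℝ (F ∘ X) p v) = 0 := fun v => by
      rw [real_inner_smul_left, hnY, mul_zero]
    have h3 : ∀ i j : Fin 3, inner ℝ (fderiv ℝ (F ∘ X) p (bX i.succ))
        (fderiv ℝ (F ∘ X) p (bX j.succ)) = if i = j then (1 : ℝ) else 0 := fun i j => by
      rw [hYe', hYe', hiso' p hp _ _ (htan i) (htan j),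
        orthonormal_iff_ite.1 bX.orthonormal]
      simp
    rw [orthonormal_iff_ite]
    intro i j
    induction i using Fin.cases with
    | zero =>
      induction j using Fin.cases with
      | zero => simp only [Fin.cons_zero, real_inner_self_eq_norm_sq, h1]; simp
      | succ j => simp only [Fin.cons_zero, Fin.cons_succ, h2, (Fin.succ_ne_zero j).symm, if_false]
    | succ i =>
      induction j using Fin.cases with
      | zero =>
        simp only [Fin.cons_zero, Fin.cons_succ, Fin.succ_ne_zero, if_false]
        rw [real_inner_comm, h2]
      | succ j => simp only [Fin.cons_succ, h3, Fin.succ_inj]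
  obtain ⟨bY, hbY⟩ := exists_orthonormalBasis_cons horth
  have hY0 : bY 0 = M⁻¹ • scaleFst c (F p) := by rw [hbY, Fin.cons_zero]
  have hYe : ∀ i : Fin 3, bY i.succ = fderiv ℝ (F ∘ X) p (bX i.succ) := fun i => by
    rw [hbY, Fin.cons_succ]
  have hmin := minors_eq_of_metric_eq (hXs (hne hp)) hYc hg hQX hQY
    (by rw [hXp]; exact hbX) hXe (by rw [hYp]; exact hY0) hYe
  have hsX := scalar_curvature_eq hp1 hNdef hN hbX
  have hsY := scalar_curvature_eq hq1 hMdef hM hY0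
  have hsum := Finset.sum_congr (rfl : (Finset.univ : Finset (Fin 3)) = _) fun i _ =>
    Finset.sum_congr (rfl : (Finset.univ : Finset (Fin 3)) = _) fun j _ => hmin i j
  simp only [← Finset.mul_sum] at hsum
  rw [hsX, hsY] at hsum
  -- The curvature is `2c x + 2c(c+1) x²` with `x = (N ^ 2)⁻¹`, and this is injective for `x > 0`.
  have hinv : (M ^ 2)⁻¹ = (N ^ 2)⁻¹ := by
    have hx : 0 < (N ^ 2)⁻¹ := by positivity
    have hy : 0 < (M ^ 2)⁻¹ := by positivity
    generalize (N ^ 2)⁻¹ = x at *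
    generalize (M ^ 2)⁻¹ = y at *
    have h0 : (y - x) * (2 * c + 2 * c * (c + 1) * (x + y)) = 0 := by linear_combination -hsum
    have h1 : 0 < 2 * c + 2 * c * (c + 1) * (x + y) := by positivity
    linarith [(mul_eq_zero.1 h0).resolve_right h1.ne']
  have := inv_injective hinv
  exact (sq_eq_sq₀ hM.le hN.le).1 this

/-- On the ellipsoid, with `c = (a ^ 2)⁻¹`, the squared norm of the gradient is `1 + c(c - 1)|z|²`;
for `c ≠ 1` it determines `|z|`. -/
theorem IsEllipsoidIsometry.norm_fst_eq {a : ℝ} (ha : 0 < a) (ha1 : a ≠ 1) {F : C2 → C2}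
    (hF : IsEllipsoidIsometry a F) {p : C2} (hp : p ∈ ellipsoid a) : ‖F p 0‖ = ‖p 0‖ := by
  have h1 := hF.norm_scaleFst_eq ha hp
  have hp1 := mem_ellipsoid_iff.1 hp
  have hq1 := mem_ellipsoid_iff.1 (hF.1.1 hp)
  have h2 : ‖scaleFst (a ^ 2)⁻¹ (F p)‖ ^ 2 = ‖scaleFst (a ^ 2)⁻¹ p‖ ^ 2 := by rw [h1]
  rw [norm_scaleFst_sq, norm_scaleFst_sq, inner_scaleFst_self, inner_scaleFst_self] at h2
  rw [inner_scaleFst_self] at hp1 hq1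
  have hc0 : (a ^ 2)⁻¹ ≠ 0 := by positivity
  have hc1 : (a ^ 2)⁻¹ - 1 ≠ 0 := by
    intro h
    apply ha1
    have h3 : a ^ 2 = 1 := by rw [← inv_inv (a ^ 2), sub_eq_zero.1 h, inv_one]
    exact (pow_eq_one_iff_of_nonneg ha.le two_ne_zero).1 h3
  have h3 : (a ^ 2)⁻¹ * ((a ^ 2)⁻¹ - 1) * (‖F p 0‖ ^ 2 - ‖p 0‖ ^ 2) = 0 := by
    linear_combination h2 - hq1 + hp1
  have h4 := (mul_eq_zero.1 h3).resolve_left (mul_ne_zero hc0 hc1)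
  exact (sq_eq_sq₀ (norm_nonneg _) (norm_nonneg _)).1 (by linarith)

/-! ### Isometries of the round sphere are linear -/

theorem scaleFst_one_apply (x : C2) : scaleFst 1 x = x := by
  ext i
  fin_cases i <;> simp

theorem mem_ellipsoid_one_iff {p : C2} : p ∈ ellipsoid 1 ↔ ‖p‖ = 1 := by
  rw [mem_ellipsoid_iff, one_pow, inv_one, scaleFst_one_apply, real_inner_self_eq_norm_sq]
  exact pow_eq_one_iff_of_nonneg (norm_nonneg p) two_ne_zero

theorem radialProj_one (x : C2) : radialProj 1 x = ‖x‖⁻¹ • x := by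
  rw [radialProj, scaleFst_one_apply, real_inner_self_eq_norm_sq, Real.sqrt_sq (norm_nonneg x)]

/-- The positively homogeneous extension of a map of the unit sphere. -/
noncomputable def homExt (F : C2 → C2) (x : C2) : C2 := ‖x‖ • F (radialProj 1 x)

/-- A vector splits into a radial and a spherical part. The differential of the extension sends them
to orthogonal vectors of the same lengths, so Pythagoras applies on both sides. -/
theorem IsEllipsoidIsometry.differentiableAt_homExt {F : C2 → C2} (hF : IsEllipsoidIsometry 1 F)
    {x : C2} (hx : x ≠ 0) :
    DifferentiableAt ℝ (homExt F) x ∧ ∀ v, ‖fderiv ℝ (homExt F) x v‖ = ‖v‖ := by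
  obtain ⟨hbij, ⟨U, hU, hEU, hFU⟩, hiso⟩ := hF
  set X := radialProj 1 with hX
  have hXm : ∀ {x : C2}, x ≠ 0 → X x ∈ ellipsoid 1 := fun {x} hx => by
    have := inner_scaleFst_radialProj one_pos hx
    rw [mem_ellipsoid_iff]
    simpa using this
  have hXd : DifferentiableAt ℝ X x :=
    (contDiffAt_radialProj one_pos hx (n := 1)).differentiableAt (by norm_num)
  have hFd : DifferentiableAt ℝ F (X x) :=
    (hFU.contDiffAt (hU.mem_nhds (hEU (hXm hx)))).differentiableAt (by simp)
  have hn : DifferentiableAt ℝ (fun x : C2 => ‖x‖) x := differentiableAt_id.norm ℝ hx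
  have h1 := hn.hasFDerivAt.smul (hFd.hasFDerivAt.comp x hXd.hasFDerivAt)
  have h1' : HasFDerivAt (homExt F) _ x := h1
  have h2 := hn.hasFDerivAt.smul hXd.hasFDerivAt
  have hev : ∀ᶠ y : C2 in 𝓝 x, y ≠ 0 := isOpen_ne.mem_nhds hx
  have h3 : HasFDerivAt (fun y : C2 => y) _ x := h2.congr_of_eventuallyEq <| hev.mono fun y hy => by
    change y = ‖y‖ • radialProj 1 y
    rw [radialProj_one, smul_smul, mul_inv_cancel₀ (norm_ne_zero_iff.2 hy), one_smul]
  have hQX : ∀ᶠ y in 𝓝 x, inner ℝ (scaleFst 1 (X y)) (X y) = 1 :=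
    hev.mono fun y hy => inner_scaleFst_radialProj one_pos hy
  have hQF : ∀ᶠ y in 𝓝 x, inner ℝ (scaleFst 1 ((F ∘ X) y)) ((F ∘ X) y) = 1 :=
    hev.mono fun y hy => by
      have := mem_ellipsoid_iff.1 (hbij.1 (hXm hy))
      simpa using this
  have hcomp := hFd.hasFDerivAt.comp x hXd.hasFDerivAt
  refine ⟨h1'.differentiableAt, fun v => ?_⟩
  have t1 := inner_scaleFst_fderiv hXd hQX v
  have t2 := inner_scaleFst_fderiv hcomp.differentiableAt hQF v
  rw [scaleFst_one_apply] at t1 t2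
  rw [hcomp.fderiv] at t2
  have t3 : ‖fderiv ℝ F (X x) (fderiv ℝ X x v)‖ = ‖fderiv ℝ X x v‖ := by
    apply hiso _ (hXm hx)
    rw [one_pow, div_one, ← inner_C2, t1]
  have e1 : ‖X x‖ = 1 := mem_ellipsoid_one_iff.1 (hXm hx)
  have e2 : ‖F (X x)‖ = 1 := mem_ellipsoid_one_iff.1 (hbij.1 (hXm hx))
  have h4 := DFunLike.congr_fun (h3.unique (hasFDerivAt_id x)) v
  rw [h1'.fderiv]
  have hsq : ∀ (α : ℝ) (A B : C2), inner ℝ A B = 0 → ‖A‖ = 1 →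
      ‖‖x‖ • B + α • A‖ ^ 2 = ‖x‖ ^ 2 * ‖B‖ ^ 2 + α ^ 2 := fun α A B hAB hA => by
    rw [norm_add_sq_real, norm_smul, norm_smul, real_inner_smul_left, real_inner_smul_right,
      real_inner_comm, hAB, hA, norm_norm, mul_one, Real.norm_eq_abs, sq_abs]
    ring
  have s1 := hsq (fderiv ℝ (fun x : C2 => ‖x‖) x v) _ _ t1 e1
  have s2 := hsq (fderiv ℝ (fun x : C2 => ‖x‖) x v) _ _ t2 e2
  simp only [add_apply, smul_apply, ContinuousLinearMap.smulRight_apply,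
    ContinuousLinearMap.comp_apply, Function.comp_apply, ContinuousLinearMap.id_apply] at h4 s2 ⊢
  rw [t3, ← s1, h4] at s2
  exact (sq_eq_sq₀ (norm_nonneg _) (norm_nonneg _)).1 s2

theorem homExt_of_norm_eq_one (F : C2 → C2) {x : C2} (hx : ‖x‖ = 1) : homExt F x = F x := by
  rw [homExt, radialProj_one, hx, inv_one, one_smul, one_smul]

/-- The mean value inequality for `homExt F` along the chord. The chord meets the origin only for
antipodal points, whose distance `2` is the diameter of the sphere. -/
theorem IsEllipsoidIsometry.norm_sub_le {F : C2 → C2} (hF : IsEllipsoidIsometry 1 F) {x y : C2}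
    (hx : ‖x‖ = 1) (hy : ‖y‖ = 1) : ‖F y - F x‖ ≤ ‖y - x‖ := by
  by_cases h0 : (0 : C2) ∈ segment ℝ x y
  · have hyx : ‖y - x‖ = 2 := by
      obtain ⟨s, t, hs, ht, hst, h⟩ := h0
      have h1 : s • x = -(t • y) := eq_neg_of_add_eq_zero_left h
      have h2 : s = t := by
        have := congrArg norm h1
        rwa [norm_neg, norm_smul, norm_smul, hx, hy, mul_one, mul_one, Real.norm_of_nonneg hs,
          Real.norm_of_nonneg ht] at this
      have h3 : s = 1 / 2 := by linarith
      rw [← h2, h3, ← smul_neg] at h1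
      have h4 : x = -y := smul_right_injective C2 (by norm_num : (1 / 2 : ℝ) ≠ 0) h1
      rw [h4, sub_neg_eq_add, ← two_smul ℝ, norm_smul, hy]
      norm_num
    have e1 : ‖F x‖ = 1 := mem_ellipsoid_one_iff.1 (hF.1.1 (mem_ellipsoid_one_iff.2 hx))
    have e2 : ‖F y‖ = 1 := mem_ellipsoid_one_iff.1 (hF.1.1 (mem_ellipsoid_one_iff.2 hy))
    rw [hyx]
    linarith [_root_.norm_sub_le (F y) (F x)]
  · have hne : ∀ z ∈ segment ℝ x y, z ≠ 0 := fun z hz h => h0 (h ▸ hz)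
    have := Convex.norm_image_sub_le_of_norm_fderiv_le (f := homExt F) (C := 1)
      (fun z hz => (hF.differentiableAt_homExt (hne z hz)).1)
      (fun z hz => ContinuousLinearMap.opNorm_le_bound _ zero_le_one fun v => by
        rw [(hF.differentiableAt_homExt (hne z hz)).2, one_mul])
      (convex_segment x y) (left_mem_segment ℝ x y) (right_mem_segment ℝ x y)
    rwa [homExt_of_norm_eq_one F hx, homExt_of_norm_eq_one F hy, one_mul] at this

/-- Contraction gives `⟪x, y⟫ ≤ ⟪F x, F y⟫`. A preimage of `-F x` then has inner product at most
`-1` with `x`, so it is `-x`; thus `F` is odd, and the inequality for `-x` is the reverse one. -/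
theorem IsEllipsoidIsometry.inner_eq {F : C2 → C2} (hF : IsEllipsoidIsometry 1 F) {x y : C2}
    (hx : ‖x‖ = 1) (hy : ‖y‖ = 1) : inner ℝ (F x) (F y) = inner ℝ x y := by
  have hn : ∀ {x : C2}, ‖x‖ = 1 → ‖F x‖ = 1 := fun hx =>
    mem_ellipsoid_one_iff.1 (hF.1.1 (mem_ellipsoid_one_iff.2 hx))
  have hle : ∀ {x y : C2}, ‖x‖ = 1 → ‖y‖ = 1 → inner ℝ x y ≤ inner ℝ (F x) (F y) := by
    intro x y hx hy
    have h1 := pow_le_pow_left₀ (norm_nonneg _) (hF.norm_sub_le hy hx) 2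
    rw [norm_sub_sq_real, norm_sub_sq_real, hx, hy, hn hx, hn hy] at h1
    linarith
  obtain ⟨x', hx', hFx'⟩ := hF.1.2.2 (mem_ellipsoid_one_iff.2 (by rw [norm_neg, hn hx]) :
    -F x ∈ ellipsoid 1)
  rw [mem_ellipsoid_one_iff] at hx'
  have hneg : x' = -x := by
    have h1 := hle hx' hx
    rw [hFx', inner_neg_left, real_inner_self_eq_norm_sq, hn hx] at h1
    have h2 : ‖x' + x‖ ^ 2 ≤ 0 := by
      rw [norm_add_sq_real, hx', hx]
      linarith
    have h3 : ‖x' + x‖ = 0 := by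
      have := sq_nonneg ‖x' + x‖
      exact pow_eq_zero_iff two_ne_zero |>.1 (le_antisymm h2 this)
    exact eq_neg_of_add_eq_zero_left (norm_eq_zero.1 h3)
  have h1 := hle hx hy
  have h2 := hle hx' hy
  rw [hFx', hneg, inner_neg_left, inner_neg_left] at h2
  linarith

/-- The homogeneous extension preserves inner products, so it is a surjective isometry fixing `0`,
and the Mazur–Ulam theorem makes it linear. -/
theorem IsEllipsoidIsometry.exists_linearIsometryEquiv {F : C2 → C2}
    (hF : IsEllipsoidIsometry 1 F) :
    ∃ G : C2 ≃ₗᵢ[ℝ] C2, ∀ p ∈ ellipsoid 1, F p = G p := by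
  have hu : ∀ {x : C2}, x ≠ 0 → ‖radialProj 1 x‖ = 1 := fun hx => by
    rw [radialProj_one, norm_smul, norm_inv, norm_norm, inv_mul_cancel₀ (norm_ne_zero_iff.2 hx)]
  have hdec : ∀ x : C2, x = ‖x‖ • radialProj 1 x := fun x => by
    rcases eq_or_ne x 0 with rfl | hx
    · simp
    · rw [radialProj_one, smul_smul, mul_inv_cancel₀ (norm_ne_zero_iff.2 hx), one_smul]
  have hinner : ∀ x y : C2, inner ℝ (homExt F x) (homExt F y) = inner ℝ x y := fun x y => by
    rcases eq_or_ne x 0 with rfl | hx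
    · simp [homExt]
    rcases eq_or_ne y 0 with rfl | hy
    · simp [homExt]
    conv_rhs => rw [hdec x, hdec y]
    rw [homExt, homExt, real_inner_smul_left, real_inner_smul_right, real_inner_smul_left,
      real_inner_smul_right, hF.inner_eq (hu hx) (hu hy)]
  have hisom : Isometry (homExt F) := Isometry.of_dist_eq fun x y => by
    rw [dist_eq_norm, dist_eq_norm]
    refine (sq_eq_sq₀ (norm_nonneg _) (norm_nonneg _)).1 ?_
    rw [norm_sub_sq_real, norm_sub_sq_real, hinner, ← real_inner_self_eq_norm_sq,
      ← real_inner_self_eq_norm_sq, hinner, hinner, real_inner_self_eq_norm_sq,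
      real_inner_self_eq_norm_sq]
  have hsurj : Function.Surjective (homExt F) := fun y => by
    rcases eq_or_ne y 0 with rfl | hy
    · exact ⟨0, by simp [homExt]⟩
    obtain ⟨x, hx, hFx⟩ := hF.1.2.2 (mem_ellipsoid_one_iff.2 (hu hy) : radialProj 1 y ∈ ellipsoid 1)
    rw [mem_ellipsoid_one_iff] at hx
    have hy' := norm_pos_iff.2 hy
    refine ⟨‖y‖ • x, ?_⟩
    rw [homExt, radialProj_one, norm_smul, hx, norm_norm, mul_one, smul_smul,
      inv_mul_cancel₀ hy'.ne', one_smul, hFx, ← hdec]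
  let e : C2 ≃ᵢ C2 := ⟨Equiv.ofBijective _ ⟨hisom.injective, hsurj⟩, hisom⟩
  refine ⟨e.toRealLinearIsometryEquivOfMapZero (show homExt F 0 = 0 by simp [homExt]), fun p hp => ?_⟩
  exact (homExt_of_norm_eq_one F (mem_ellipsoid_one_iff.1 hp)).symm

/-! ### The oscillation of `|z|²` on rotationally symmetric sets of the round sphere -/

/-- The rotation by `t` in the second coordinate. -/
noncomputable def rotSnd (t : ℝ) (x : C2) : C2 := !₂[x 0, Complex.exp (t * Complex.I) * x 1]

@[simp] theorem rotSnd_zero (t : ℝ) (x : C2) : rotSnd t x 0 = x 0 := rfl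

@[simp] theorem rotSnd_one (t : ℝ) (x : C2) :
    rotSnd t x 1 = Complex.exp (t * Complex.I) * x 1 := rfl

/-- The generator `(z, w) ↦ (0, i w)` of the rotations in the second coordinate. -/
noncomputable def rotGen : C2 →ₗ[ℝ] C2 where
  toFun x := !₂[0, Complex.I * x 1]
  map_add' x y := by
    ext i
    fin_cases i <;> simp [mul_add]
  map_smul' r x := by
    ext i
    fin_cases i <;> simp [mul_left_comm]

@[simp] theorem rotGen_zero (x : C2) : rotGen x 0 = 0 := rfl

@[simp] theorem rotGen_one (x : C2) : rotGen x 1 = Complex.I * x 1 := rfl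

theorem hasDerivAt_rotSnd (x : C2) : HasDerivAt (fun t => rotSnd t x) (rotGen x) 0 := by
  have h : (fun t => rotSnd t x) =
      fun t => !₂[x 0, 0] + (cos t • !₂[0, x 1] + sin t • rotGen x) := by
    ext t i
    fin_cases i
    · simp
    · simp [Complex.exp_mul_I]
      ring
  rw [h]
  have h1 := (((hasDerivAt_cos 0).smul_const (!₂[0, x 1] : C2)).add
    ((hasDerivAt_sin 0).smul_const (rotGen x))).const_add (!₂[x 0, 0] : C2)
  simpa using h1

theorem inner_rotGen_self (x : C2) : inner ℝ (rotGen x) x = 0 := by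
  rw [inner_C2, rotGen_zero, rotGen_one, inner_zero_left, Complex.inner]
  simp
  ring

theorem norm_rotGen (x : C2) : ‖rotGen x‖ = ‖x 1‖ := by
  have := norm_sq_C2 (rotGen x)
  rw [rotGen_zero, rotGen_one, norm_mul, Complex.norm_I, one_mul, norm_zero] at this
  refine (sq_eq_sq₀ (norm_nonneg _) (norm_nonneg _)).1 ?_
  rw [this]
  ring

/-- A skew map of the real plane is a multiple of the quarter turn, hence scales all norms by the
same factor. -/
theorem norm_map_of_inner_self_eq_zero {f : ℂ →ₗ[ℝ] ℂ} (hf : ∀ z, inner ℝ (f z) z = 0) (z : ℂ) :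
    ‖f z‖ ^ 2 = ‖f 1‖ ^ 2 * ‖z‖ ^ 2 := by
  have h1 := hf 1
  have h2 := hf Complex.I
  have h3 := hf (1 + Complex.I)
  have hz : f z = z.re • f 1 + z.im • f Complex.I := by
    rw [← map_smul, ← map_smul, ← map_add]
    congr 1
    apply Complex.ext <;> simp
  rw [map_add] at h3
  simp only [Complex.inner] at h1 h2 h3
  simp at h1 h2 h3
  rw [hz, Complex.sq_norm, Complex.sq_norm, Complex.sq_norm, Complex.normSq_apply,
    Complex.normSq_apply, Complex.normSq_apply]
  simp
  have h4 : (f Complex.I).re = -(f 1).im := by linarith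
  rw [h1, h2, h4]
  ring

/-- A subset of the round sphere invariant under rotations of the second coordinate, on which
`1/2 - |z|²` attains its extreme values `q / 2` and `-q / 2` at two points whose first coordinates
are linearly independent over `ℝ`. -/
structure IsRotational (q : ℝ) (C : Set C2) : Prop where
  norm_eq : ∀ p ∈ C, ‖p‖ = 1
  rot : ∀ p ∈ C, ∀ t, rotSnd t p ∈ C
  le : ∀ p ∈ C, |1 / 2 - ‖p 0‖ ^ 2| ≤ |q| / 2
  exists_extreme : ∃ p₁ ∈ C, ∃ p₂ ∈ C, 1 / 2 - ‖p₁ 0‖ ^ 2 = q / 2 ∧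
    1 / 2 - ‖p₂ 0‖ ^ 2 = -(q / 2) ∧ p₁ 1 ≠ 0 ∧ p₂ 1 ≠ 0 ∧ (p₁ 0).im = 0 ∧ (p₁ 0).re ≠ 0 ∧
    (p₂ 0).im ≠ 0

/-- The rotations of `C`, transported by `G`, keep `p` inside `C'`, so `|z|²` is extremal at `t = 0`
along this curve; its derivative there is twice the stated inner product. -/
theorem IsRotational.inner_eq_zero {q : ℝ} {C C' : Set C2} (hC : ∀ p ∈ C, ∀ t, rotSnd t p ∈ C)
    (hC' : IsRotational q C') {G : C2 ≃ₗᵢ[ℝ] C2} (hG : G '' C = C') {p : C2} (hp : p ∈ C')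
    (hext : 1 / 2 - ‖p 0‖ ^ 2 = q / 2 ∨ 1 / 2 - ‖p 0‖ ^ 2 = -(q / 2)) :
    inner ℝ (p 0) (G (rotGen (G.symm p)) 0) = 0 := by
  have hmem : ∀ t, G (rotSnd t (G.symm p)) ∈ C' := fun t => by
    rw [← hG] at hp ⊢
    obtain ⟨x, hx, rfl⟩ := hp
    rw [G.symm_apply_apply]
    exact mem_image_of_mem _ (hC x hx t)
  have h0 : rotSnd 0 (G.symm p) = G.symm p := by
    ext i
    fin_cases i <;> simp
  have hproj : HasDerivAt (fun t => G (rotSnd t (G.symm p)) 0) (G (rotGen (G.symm p)) 0) 0 := by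
    have h1 := (G.toContinuousLinearEquiv : C2 →L[ℝ] C2).hasFDerivAt.comp_hasDerivAt (0 : ℝ)
      (hasDerivAt_rotSnd (G.symm p))
    exact (PiLp.proj (𝕜 := ℝ) 2 (fun _ : Fin 2 => ℂ) 0).hasFDerivAt.comp_hasDerivAt
      (0 : ℝ) h1
  have hd := hproj.norm_sq
  simp only [h0, G.apply_symm_apply] at hd
  have hb : ∀ t, -(|q| / 2) ≤ 1 / 2 - ‖G (rotSnd t (G.symm p)) 0‖ ^ 2 ∧
      1 / 2 - ‖G (rotSnd t (G.symm p)) 0‖ ^ 2 ≤ |q| / 2 := fun t => abs_le.1 (hC'.le _ (hmem t))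
  have hextr : 1 / 2 - ‖p 0‖ ^ 2 = |q| / 2 ∨ 1 / 2 - ‖p 0‖ ^ 2 = -(|q| / 2) := by
    rcases abs_choice q with h | h <;> rw [h] <;> rcases hext with h' | h' <;> rw [h']
    · simp
    · simp
    · right; ring
    · left; ring
  have hz : 2 * inner ℝ (p 0) (G (rotGen (G.symm p)) 0) = 0 := by
    rcases hextr with h | h
    · refine IsLocalMin.hasDerivAt_eq_zero (Filter.Eventually.of_forall fun t => ?_) hd
      simp only [h0, G.apply_symm_apply]
      linarith [(hb t).2]
    · refine IsLocalMax.hasDerivAt_eq_zero (Filter.Eventually.of_forall fun t => ?_) hd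
      simp only [h0, G.apply_symm_apply]
      linarith [(hb t).1]
  linarith

/-- Let `B` be the rotation generator conjugated by `G`. Criticality at two extreme points with
independent first coordinates forces `B` to preserve the splitting `ℂ ⊕ ℂ`, acting on the summands
as skew maps of norms `λ₀, λ₁ ≤ 1`. Then `|w(x)|² = λ₀²|z(Gx)|² + λ₁²|w(Gx)|²`, so `1/2 - |z|²` on
`C` is an affine function of `1/2 - |z|²` on `C'` with slope `λ₁² - λ₀²` of absolute value at most
`1`. -/
theorem IsRotational.abs_le {q q' : ℝ} {C C' : Set C2} (hC : IsRotational q C)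
    (hC' : IsRotational q' C') {G : C2 ≃ₗᵢ[ℝ] C2} (hG : G '' C = C') : |q| ≤ |q'| := by
  set B : C2 →ₗ[ℝ] C2 := G.toLinearEquiv.toLinearMap ∘ₗ rotGen ∘ₗ G.symm.toLinearEquiv.toLinearMap
    with hB
  have hBapp : ∀ x, B x = G (rotGen (G.symm x)) := fun x => rfl
  have hskew : ∀ x, inner ℝ (B x) x = 0 := fun x => by
    have h := G.inner_map_map (rotGen (G.symm x)) (G.symm x)
    rw [G.apply_symm_apply, inner_rotGen_self] at h
    exact h
  have hskew2 : ∀ x y, inner ℝ (B x) y = -inner ℝ x (B y) := fun x y => by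
    have := hskew (x + y)
    rw [map_add, inner_add_left, inner_add_right, inner_add_right, hskew, hskew,
      real_inner_comm x (B y)] at this
    linarith
  have hnorm : ∀ x, ‖B x‖ = ‖G.symm x 1‖ := fun x => by
    rw [hBapp, G.norm_map, norm_rotGen]
  have hnle : ∀ x, ‖B x‖ ≤ ‖x‖ := fun x => by
    rw [hnorm, ← G.symm.norm_map x]
    exact PiLp.norm_apply_le _ 1
  let ι₀ : ℂ →ₗ[ℝ] C2 :=
    { toFun := fun z => !₂[z, 0]
      map_add' := fun x y => by ext i; fin_cases i <;> simp
      map_smul' := fun r x => by ext i; fin_cases i <;> simp }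
  let ι₁ : ℂ →ₗ[ℝ] C2 :=
    { toFun := fun z => !₂[0, z]
      map_add' := fun x y => by ext i; fin_cases i <;> simp
      map_smul' := fun r x => by ext i; fin_cases i <;> simp }
  have a00 : ∀ z, ι₀ z 0 = z := fun z => rfl
  have a01 : ∀ z, ι₀ z 1 = 0 := fun z => rfl
  have a10 : ∀ z, ι₁ z 0 = 0 := fun z => rfl
  have a11 : ∀ z, ι₁ z 1 = z := fun z => rfl
  have hdec : ∀ x : C2, x = ι₀ (x 0) + ι₁ (x 1) := fun x => by
    ext i
    fin_cases i <;> simp [ι₀, ι₁]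
  have i0 : ∀ (z : ℂ) (x : C2), inner ℝ (ι₀ z) x = inner ℝ z (x 0) := fun z x => by
    rw [inner_C2, a00, a01, inner_zero_left, add_zero]
  have i1 : ∀ (z : ℂ) (x : C2), inner ℝ (ι₁ z) x = inner ℝ z (x 1) := fun z x => by
    rw [inner_C2, a10, a11, inner_zero_left, zero_add]
  have n0 : ∀ z, ‖ι₀ z‖ = ‖z‖ := fun z => by
    refine (sq_eq_sq₀ (norm_nonneg _) (norm_nonneg _)).1 ?_
    rw [norm_sq_C2, a00, a01, norm_zero]
    ring
  have n1 : ∀ z, ‖ι₁ z‖ = ‖z‖ := fun z => by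
    refine (sq_eq_sq₀ (norm_nonneg _) (norm_nonneg _)).1 ?_
    rw [norm_sq_C2, a10, a11, norm_zero]
    ring
  -- the first coordinate of an extreme point is orthogonal to `B (0, w)` for all `w`
  have horth : ∀ p ∈ C', (1 / 2 - ‖p 0‖ ^ 2 = q' / 2 ∨ 1 / 2 - ‖p 0‖ ^ 2 = -(q' / 2)) →
      p 1 ≠ 0 → ∀ w, inner ℝ (p 0) (B (ι₁ w) 0) = 0 := by
    intro p hp hext hp1 w
    rcases eq_or_ne w 0 with rfl | hw
    · simp
    have hself : inner ℝ (p 0) (B (ι₀ (p 0)) 0) = 0 := by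
      rw [← i0, real_inner_comm, hskew]
    -- Rotating the second coordinate of `p` and rescaling reaches every `w`, while the first
    -- coordinate of `p` stays fixed.
    set t := (w / p 1).arg with ht
    have hw' : w = ((‖w / p 1‖ : ℝ) : ℂ) * (Complex.exp (t * Complex.I) * p 1) := by
      rw [← mul_assoc, ht, Complex.norm_mul_exp_arg_mul_I, div_mul_cancel₀ _ hp1]
    have h1 := hC'.inner_eq_zero hC.rot hG (hC'.rot p hp t) hext
    rw [rotSnd_zero, ← hBapp, hdec (rotSnd t p), map_add, PiLp.add_apply, inner_add_right,
      rotSnd_zero, hself, zero_add, rotSnd_one] at h1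
    have h2 : ι₁ w = ‖w / p 1‖ • ι₁ (Complex.exp (t * Complex.I) * p 1) := by
      rw [← map_smul, Complex.real_smul, ← hw']
    rw [h2, map_smul, PiLp.smul_apply, real_inner_smul_right, h1, mul_zero]
  obtain ⟨p₁, hp₁, p₂, hp₂, e1, e2, w1, w2, im1, re1, im2⟩ := hC'.exists_extreme
  have hB10 : ∀ w, B (ι₁ w) 0 = 0 := fun w => by
    have h1 := horth p₁ hp₁ (Or.inl e1) w1 w
    have h2 := horth p₂ hp₂ (Or.inr e2) w2 w
    rw [Complex.inner, Complex.mul_re, Complex.conj_re, Complex.conj_im] at h1 h2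
    rw [im1] at h1
    have h3 : (B (ι₁ w) 0).re = 0 := by
      have : (B (ι₁ w) 0).re * (p₁ 0).re = 0 := by linarith
      exact (mul_eq_zero.1 this).resolve_right re1
    rw [h3] at h2
    have h4 : (B (ι₁ w) 0).im = 0 := by
      have : (B (ι₁ w) 0).im * (p₂ 0).im = 0 := by linarith
      exact (mul_eq_zero.1 this).resolve_right im2
    exact Complex.ext h3 h4
  have hB01 : ∀ z, B (ι₀ z) 1 = 0 := fun z => by
    have h1 := hskew2 (ι₁ (B (ι₀ z) 1)) (ι₀ z)
    rw [i1, real_inner_comm, i0, hB10, inner_zero_right] at h1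
    exact inner_self_eq_zero.1 (neg_eq_zero.1 h1.symm)
  let f₀ : ℂ →ₗ[ℝ] ℂ :=
    (PiLp.proj (𝕜 := ℝ) 2 (fun _ : Fin 2 => ℂ) 0).toLinearMap ∘ₗ B ∘ₗ ι₀
  let f₁ : ℂ →ₗ[ℝ] ℂ :=
    (PiLp.proj (𝕜 := ℝ) 2 (fun _ : Fin 2 => ℂ) 1).toLinearMap ∘ₗ B ∘ₗ ι₁
  have hf₀ : ∀ z, f₀ z = B (ι₀ z) 0 := fun z => rfl
  have hf₁ : ∀ z, f₁ z = B (ι₁ z) 1 := fun z => rfl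
  have k0 := norm_map_of_inner_self_eq_zero (f := f₀) fun z => by
    rw [hf₀, real_inner_comm, ← i0, real_inner_comm, hskew]
  have k1 := norm_map_of_inner_self_eq_zero (f := f₁) fun z => by
    rw [hf₁, real_inner_comm, ← i1, real_inner_comm, hskew]
  have hle : ∀ x : C2, ∀ i, ‖B x i‖ ≤ ‖x‖ := fun x i => (PiLp.norm_apply_le _ i).trans (hnle x)
  have b0 : ‖f₀ 1‖ ≤ 1 := by simpa [n0, hf₀] using hle (ι₀ 1) 0
  have b1 : ‖f₁ 1‖ ≤ 1 := by simpa [n1, hf₁] using hle (ι₁ 1) 1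
  have hmain : ∀ x : C2, ‖x 1‖ ^ 2 = ‖f₀ 1‖ ^ 2 * ‖G x 0‖ ^ 2 + ‖f₁ 1‖ ^ 2 * ‖G x 1‖ ^ 2 := by
    intro x
    have h1 := hnorm (G x)
    rw [G.symm_apply_apply] at h1
    rw [← h1, norm_sq_C2, ← k0, ← k1, hf₀, hf₁]
    conv_lhs => rw [hdec (G x)]
    rw [map_add, PiLp.add_apply, PiLp.add_apply, hB10, hB01, add_zero, zero_add]
  obtain ⟨x₁, hx₁, x₂, hx₂, g1, g2, -⟩ := hC.exists_extreme
  have hGm : ∀ x ∈ C, G x ∈ C' := fun x hx => hG ▸ mem_image_of_mem _ hx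
  have hs : ∀ x : C2, ‖x‖ = 1 → ‖x 1‖ ^ 2 = 1 - ‖x 0‖ ^ 2 := fun x hx => by
    have := norm_sq_C2 x
    rw [hx] at this
    linarith
  have m1 := hmain x₁
  have m2 := hmain x₂
  rw [hs _ (hC.norm_eq _ hx₁), hs _ (hC'.norm_eq _ (hGm _ hx₁))] at m1
  rw [hs _ (hC.norm_eq _ hx₂), hs _ (hC'.norm_eq _ (hGm _ hx₂))] at m2
  have l1 := hC'.le _ (hGm _ hx₁)
  have l2 := hC'.le _ (hGm _ hx₂)
  -- The difference of the two extreme values on `C` is exactly `q`; subtraction removes the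
  -- constant term of the affine relation.
  have key : q = (‖f₁ 1‖ ^ 2 - ‖f₀ 1‖ ^ 2) *
      ((1 / 2 - ‖G x₁ 0‖ ^ 2) - (1 / 2 - ‖G x₂ 0‖ ^ 2)) := by linarith
  have hκ : |‖f₁ 1‖ ^ 2 - ‖f₀ 1‖ ^ 2| ≤ 1 := by
    have h1 : ‖f₁ 1‖ ^ 2 ≤ 1 := pow_le_one₀ (norm_nonneg _) b1
    have h2 : ‖f₀ 1‖ ^ 2 ≤ 1 := pow_le_one₀ (norm_nonneg _) b0
    exact _root_.abs_le.2 ⟨by linarith [sq_nonneg ‖f₁ 1‖], by linarith [sq_nonneg ‖f₀ 1‖]⟩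
  have hdiff : |(1 / 2 - ‖G x₁ 0‖ ^ 2) - (1 / 2 - ‖G x₂ 0‖ ^ 2)| ≤ |q'| :=
    (abs_sub _ _).trans (by linarith)
  rw [key, abs_mul]
  calc _ ≤ 1 * |q'| := mul_le_mul hκ hdiff (abs_nonneg _) zero_le_one
    _ = |q'| := one_mul _

/-! ### The half period on the round sphere -/

/-- The naive primitive `arctan (tan x / c)` jumps at `π/2`. By the addition formula it differs from
`x` by the arctangent used here, which is smooth everywhere and vanishes at `0` and `π`. -/
theorem integral_sqrt_div {q : ℝ} (hq : q ∈ Ioo (-1 : ℝ) 1) :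
    ∫ x in (0 : ℝ)..π, √(1 - q ^ 2) / (1 - q ^ 2 * cos x ^ 2) = π := by
  set c := √(1 - q ^ 2) with hc
  have hc0 : 0 < c := Real.sqrt_pos.2 (one_sub_sq_pos hq)
  have hc2 : c ^ 2 = 1 - q ^ 2 := Real.sq_sqrt (one_sub_sq_pos hq).le
  have hd : ∀ x, 0 < c * cos x ^ 2 + sin x ^ 2 := fun x => by
    have := sin_sq_add_cos_sq x
    rcases (sq_nonneg (cos x)).lt_or_eq with h | h
    · positivity
    · rw [← h] at this ⊢
      linarith
  have hden : ∀ x, 0 < 1 - q ^ 2 * cos x ^ 2 := fun x => by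
    have := one_sub_sq_pos (mul_cos_mem_Ioo hq x)
    rwa [mul_pow] at this
  have hder : ∀ x, HasDerivAt
      (fun x => x + arctan ((1 - c) * (sin x * cos x) / (c * cos x ^ 2 + sin x ^ 2)))
      (c / (1 - q ^ 2 * cos x ^ 2)) x := fun x => by
    have h1 : HasDerivAt (fun x => (1 - c) * (sin x * cos x))
        ((1 - c) * (cos x ^ 2 - sin x ^ 2)) x :=
      (((hasDerivAt_sin x).mul (hasDerivAt_cos x)).const_mul (1 - c)).congr_deriv (by ring)
    have h2 : HasDerivAt (fun x => c * cos x ^ 2 + sin x ^ 2)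
        (2 * (1 - c) * (sin x * cos x)) x :=
      ((((hasDerivAt_cos x).pow 2).const_mul c).add ((hasDerivAt_sin x).pow 2)).congr_deriv
        (by simp; ring)
    refine ((hasDerivAt_id x).add (h1.div h2 (hd x).ne').arctan).congr_deriv ?_
    have h3 := (hd x).ne'
    have h4 := (hden x).ne'
    have hs := sin_sq_add_cos_sq x
    simp only [Pi.div_apply]
    have h5 : 1 + ((1 - c) * (sin x * cos x) / (c * cos x ^ 2 + sin x ^ 2)) ^ 2 =
        (1 - q ^ 2 * cos x ^ 2) / (c * cos x ^ 2 + sin x ^ 2) ^ 2 := by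
      rw [eq_div_iff (pow_ne_zero 2 h3), add_mul, one_mul, ← mul_pow, div_mul_cancel₀ _ h3]
      have hs' : sin x ^ 2 = 1 - cos x ^ 2 := by linarith
      have hq2 : q ^ 2 = 1 - c ^ 2 := by linarith
      rw [mul_pow, mul_pow, hs', hq2]
      ring
    rw [h5]
    have hs' : sin x ^ 2 = 1 - cos x ^ 2 := by linarith
    have hq2 : q ^ 2 = 1 - c ^ 2 := by linarith
    generalize hdd : c * cos x ^ 2 + sin x ^ 2 = d at h3
    generalize hDD : 1 - q ^ 2 * cos x ^ 2 = D at h4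
    field_simp
    rw [← hdd, ← hDD]
    simp only [hs', hq2]
    ring
  rw [intervalIntegral.integral_eq_sub_of_hasDerivAt (fun x _ => hder x)]
  · simp
  · refine Continuous.intervalIntegrable ?_ _ _
    exact continuous_const.div (by fun_prop) fun x => (hden x).ne'

/-- Averaging the density with its reflection under `x ↦ π - x` and using `√(1+u) + √(1-u) ≤ 2`
bounds the half period by `π / √2`. As it lies strictly between `0` and `π`, the two extreme points
of the torus have linearly independent first coordinates. -/
theorem halfPeriod_one_lt_pi {q : ℝ} (hq : q ∈ Ioo (-1 : ℝ) 1) : halfPeriod 1 q < π := by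
  have hA := isPhaseDensity_angleDensity one_pos hq
  have h := intervalIntegral.integral_comp_sub_left (a := 0) (b := π) (angleDensity 1 q) π
  rw [sub_self, sub_zero] at h
  have hT : halfPeriod 1 q = ∫ x in (0 : ℝ)..π, angleDensity 1 q x := rfl
  have hi1 : IntervalIntegrable (angleDensity 1 q) MeasureTheory.volume 0 π :=
    hA.cont.intervalIntegrable _ _
  have hi2 : IntervalIntegrable (fun x => angleDensity 1 q (π - x)) MeasureTheory.volume 0 π :=
    (hA.cont.comp (by fun_prop)).intervalIntegrable _ _
  have hden : ∀ x, 0 < 1 - q ^ 2 * cos x ^ 2 := fun x => by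
    have := one_sub_sq_pos (mul_cos_mem_Ioo hq x)
    rwa [mul_pow] at this
  have hsum : 2 * halfPeriod 1 q ≤
      ∫ x in (0 : ℝ)..π, √2 * (√(1 - q ^ 2) / (1 - q ^ 2 * cos x ^ 2)) := by
    have h2 : 2 * halfPeriod 1 q =
        ∫ x in (0 : ℝ)..π, (angleDensity 1 q x + angleDensity 1 q (π - x)) := by
      rw [intervalIntegral.integral_add hi1 hi2, h, hT]
      ring
    rw [h2]
    refine intervalIntegral.integral_mono_on pi_pos.le (hi1.add hi2)
      (Continuous.intervalIntegrable ?_ _ _) fun x _ => ?_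
    · exact continuous_const.mul (continuous_const.div (by fun_prop) fun x => (hden x).ne')
    · have hu := mul_cos_mem_Ioo hq x
      simp only [angleDensity, cos_pi_sub, mul_neg]
      rw [show 1 - q ^ 2 * cos x ^ 2 = 1 - (q * cos x) ^ 2 by ring]
      generalize q * cos x = u at *
      have u1 : 0 < 1 + u := by linarith [hu.1]
      have u2 : 0 < 1 - u := by linarith [hu.2]
      have s1 := Real.sq_sqrt u1.le
      have s2 := Real.sq_sqrt u2.le
      have p1 := Real.sqrt_pos.2 u1
      have p2 := Real.sqrt_pos.2 u2
      rw [show (1 : ℝ) ^ 2 * (1 + u) + (1 - u) = 2 by ring,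
        show (1 : ℝ) ^ 2 * (1 + -u) + (1 - -u) = 2 by ring, ← sub_eq_add_neg, sub_neg_eq_add]
      have hs : √(1 + u) + √(1 - u) ≤ 2 := by nlinarith [sq_nonneg (√(1 + u) - √(1 - u))]
      have hc := Real.sqrt_nonneg (1 - q ^ 2)
      have h2' := Real.sqrt_nonneg 2
      rw [show 1 - u ^ 2 = (1 - u) * (1 + u) by ring]
      generalize √(1 + u) = A at *
      generalize √(1 - u) = D at *
      rw [← s1, ← s2]
      have heq : √(1 - q ^ 2) * √2 / (2 * 1 * D ^ 2 * A) + √(1 - q ^ 2) * √2 / (2 * 1 * A ^ 2 * D) =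
          √2 * (√(1 - q ^ 2) / (D ^ 2 * A ^ 2)) * ((A + D) / 2) := by
        field_simp
      rw [heq]
      exact mul_le_of_le_one_right (by positivity) (by linarith)
  rw [intervalIntegral.integral_const_mul, integral_sqrt_div hq] at hsum
  have h2 : √2 < 2 := by
    rw [Real.sqrt_lt' two_pos]
    norm_num
  nlinarith [pi_pos]

/-! ### The tori -/

theorem halfPeriod_eq_of_abs_eq {a q q' : ℝ} (h : |q| = |q'|) :
    halfPeriod a q = halfPeriod a q' := by
  rcases abs_eq_abs.1 h with rfl | rfl
  · rfl
  · exact halfPeriod_neg a q'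

namespace IsRadialParametrization

variable {β : ℝ → ℝ → ℝ} {a s : ℝ}

theorem norm_fst_sq_of_mem_torus (hβ : IsRadialParametrization β) (h : (a, s) ∈ strip) {p : C2}
    (hp : p ∈ torus β a s) : ∃ x, ‖p 0‖ ^ 2 = a ^ 2 * (1 - initialHeight β a s * cos x) / 2 := by
  obtain ⟨τ, hτ⟩ := hβ.exists_isPhase h
  obtain ⟨-, t, ht⟩ := hp
  refine ⟨τ t, ?_⟩
  have h0 : p 0 = (diskPoint a ((gammaCurve β a s t).1, (gammaCurve β a s t).2)).1 :=
    (congrArg Prod.fst ht).symm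
  rw [h0, norm_diskPoint_fst h.1 (hτ.mem t), mul_pow, sin_sq_latitude, hτ.height_eq]
  ring

theorem abs_norm_fst_sq_sub_le (hβ : IsRadialParametrization β) (h : (a, s) ∈ strip) {p : C2}
    (hp : p ∈ torus β a s) : |a ^ 2 / 2 - ‖p 0‖ ^ 2| ≤ a ^ 2 * |initialHeight β a s| / 2 := by
  obtain ⟨x, hx⟩ := hβ.norm_fst_sq_of_mem_torus h hp
  rw [hx, show a ^ 2 / 2 - a ^ 2 * (1 - initialHeight β a s * cos x) / 2 =
    a ^ 2 / 2 * (initialHeight β a s * cos x) by ring, abs_mul, abs_mul,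
    abs_of_nonneg (by positivity : 0 ≤ a ^ 2 / 2)]
  have := mul_le_of_le_one_right (abs_nonneg (initialHeight β a s)) (abs_cos_le_one x)
  nlinarith [sq_nonneg a]

/-- The point of the torus with phase `x` over the given geodesic and positive second
coordinate. -/
theorem exists_mem_torus (hβ : IsRadialParametrization β) (h : (a, s) ∈ strip) (x : ℝ) :
    ∃ p ∈ torus β a s, ∃ r : ℝ, 0 < r ∧
      p 0 = (r : ℂ) * Complex.exp (phaseAngle a (initialHeight β a s) x * Complex.I) ∧
      p 1 ≠ 0 ∧ ‖p 0‖ ^ 2 = a ^ 2 * (1 - initialHeight β a s * cos x) / 2 := by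
  obtain ⟨τ, hτ⟩ := hβ.exists_isPhase h
  have ha : 0 < a := h.1
  set t := phaseTime a (initialHeight β a s) x with ht
  have hx : τ t = x := hτ.phase_phaseTime ha (hβ.initialHeight_mem h) x
  have hm := hτ.mem t
  set ψ := latitude a (gammaCurve β a s t).1 with hψ
  have hs := sin_latitude_pos ha hm
  have hc := cos_latitude_pos ha hm
  have h1 : (diskPoint a (gammaCurve β a s t)).1 = ((a * sin ψ : ℝ) : ℂ) *
      Complex.exp (phaseAngle a (initialHeight β a s) x * Complex.I) := by
    rw [diskPoint_fst, hτ.angle, hx]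
  have hn : ‖(diskPoint a (gammaCurve β a s t)).1‖ = a * sin ψ :=
    norm_diskPoint_fst ha hm (gammaCurve β a s t).2
  have hnc : ‖((cos ψ : ℝ) : ℂ)‖ = cos ψ := by
    rw [Complex.norm_real, Real.norm_of_nonneg hc.le]
  refine ⟨!₂[(diskPoint a (gammaCurve β a s t)).1, ((cos ψ : ℝ) : ℂ)], ⟨?_, t, ?_⟩, a * sin ψ,
    mul_pos ha hs, h1, Complex.ofReal_ne_zero.2 hc.ne', ?_⟩
  · change ‖(diskPoint a (gammaCurve β a s t)).1‖ ^ 2 / a ^ 2 + ‖((cos ψ : ℝ) : ℂ)‖ ^ 2 = 1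
    rw [hn, hnc, mul_pow, mul_div_cancel_left₀ _ (pow_ne_zero 2 ha.ne'), sin_sq_add_cos_sq]
  · exact Prod.ext rfl hnc.symm
  · change ‖(diskPoint a (gammaCurve β a s t)).1‖ ^ 2 = _
    rw [hn, mul_pow, sin_sq_latitude, hτ.height_eq, hx]
    ring

theorem exists_mem_torus_norm_fst_sq (hβ : IsRadialParametrization β) (h : (a, s) ∈ strip) :
    ∃ p ∈ torus β a s, ‖p 0‖ ^ 2 = a ^ 2 * (1 + |initialHeight β a s|) / 2 := by
  rcases abs_choice (initialHeight β a s) with hq | hq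
  · obtain ⟨p, hp, r, -, -, -, hn⟩ := hβ.exists_mem_torus h π
    exact ⟨p, hp, by rw [hn, hq, cos_pi]; ring⟩
  · obtain ⟨p, hp, r, -, -, -, hn⟩ := hβ.exists_mem_torus h 0
    exact ⟨p, hp, by rw [hn, hq, cos_zero]; ring⟩

theorem isRotational_torus (hβ : IsRadialParametrization β) (h : (1, s) ∈ strip) :
    IsRotational (initialHeight β 1 s) (torus β 1 s) where
  norm_eq p hp := mem_ellipsoid_one_iff.1 hp.1
  rot p hp t := by
    have hn : ‖rotSnd t p 1‖ = ‖p 1‖ := by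
      rw [rotSnd_one, norm_mul, Complex.norm_exp_ofReal_mul_I, one_mul]
    have ho : orbitMap (rotSnd t p) = orbitMap p := Prod.ext rfl hn
    refine ⟨?_, ho ▸ hp.2⟩
    rw [mem_ellipsoid_iff, inner_scaleFst_self, hn, rotSnd_zero, ← inner_scaleFst_self]
    exact mem_ellipsoid_iff.1 hp.1
  le p hp := by simpa using hβ.abs_norm_fst_sq_sub_le h hp
  exists_extreme := by
    have hq := hβ.initialHeight_mem h
    obtain ⟨p₁, hp₁, r₁, hr₁, e₁, w₁, n₁⟩ := hβ.exists_mem_torus h 0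
    obtain ⟨p₂, hp₂, r₂, hr₂, e₂, w₂, n₂⟩ := hβ.exists_mem_torus h π
    have h0 : phaseAngle 1 (initialHeight β 1 s) 0 = 0 := by simp [phaseAngle, primitive]
    rw [h0] at e₁
    refine ⟨p₁, hp₁, p₂, hp₂, ?_, ?_, w₁, w₂, ?_, ?_, ?_⟩
    · rw [n₁, cos_zero]; ring
    · rw [n₂, cos_pi]; ring
    · simp [e₁]
    · simp [e₁, hr₁.ne']
    · rw [e₂, Complex.im_ofReal_mul, Complex.exp_ofReal_mul_I_im]
      -- The argument of the first coordinate at phase `π` is the half period.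
      exact (mul_pos hr₂ (sin_pos_of_pos_of_lt_pi (halfPeriod_pos one_pos hq)
        (halfPeriod_one_lt_pi hq))).ne'

/-- The absolute value of the initial height is a congruence invariant of the torus. -/
theorem abs_initialHeight_eq_of_congruent (hβ : IsRadialParametrization β) {s' : ℝ}
    (h : (a, s) ∈ strip) (h' : (a, s') ∈ strip)
    (hc : Congruent a (torus β a s) (torus β a s')) :
    |initialHeight β a s| = |initialHeight β a s'| := by
  obtain ⟨F, hF, hFS⟩ := hc
  have ha : 0 < a := h.1
  -- The round sphere is separate: its isometries need not preserve `|z|`.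
  by_cases ha1 : a = 1
  · subst ha1
    obtain ⟨G, hG⟩ := hF.exists_linearIsometryEquiv
    have hGS : G '' torus β 1 s = torus β 1 s' := by
      rw [← hFS]
      exact image_congr fun p hp => (hG p hp.1).symm
    have hGS' : G.symm '' torus β 1 s' = torus β 1 s := by
      rw [← hGS, ← image_comp]
      simp
    exact le_antisymm ((hβ.isRotational_torus h).abs_le (hβ.isRotational_torus h') hGS)
      ((hβ.isRotational_torus h').abs_le (hβ.isRotational_torus h) hGS')
  -- Here `|z|` is preserved, and `|q|` is read off from the maximum `a²(1 + |q|)/2` of `|z|²` on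
  -- the torus.
  · have ha2 : 0 < a ^ 2 := by positivity
    obtain ⟨p, hp, hn⟩ := hβ.exists_mem_torus_norm_fst_sq h
    obtain ⟨p', hp', hn'⟩ := hβ.exists_mem_torus_norm_fst_sq h'
    have h1 := (_root_.abs_le.1 (hβ.abs_norm_fst_sq_sub_le h' (hFS ▸ mem_image_of_mem F hp))).1
    rw [hF.norm_fst_eq ha ha1 hp.1, hn] at h1
    obtain ⟨x, hx, rfl⟩ : p' ∈ F '' torus β a s := hFS ▸ hp'
    have h2 := (_root_.abs_le.1 (hβ.abs_norm_fst_sq_sub_le h hx)).1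
    rw [← hF.norm_fst_eq ha ha1 hx.1, hn'] at h2
    refine le_antisymm ?_ ?_
    · exact le_of_mul_le_mul_left (by linarith) ha2
    · exact le_of_mul_le_mul_left (by linarith) ha2

end IsRadialParametrization

end EllipsoidTori

/-! ### The theorem, deduced from `jT = kπ` and the invariance of `|q|` -/

theorem mainTheorem4 (β : ℝ → ℝ → ℝ) (hβ : EllipsoidTori.IsRadialParametrization β) :
    (∀ j k : ℕ, EllipsoidTori.IsLabel j k → ∀ a s ℓ : ℝ,
      (a, s) ∈ EllipsoidTori.branch β j k \ EllipsoidTori.trivialBranch →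
      ℓ = EllipsoidTori.ell β k a s →
        -- the geodesic and the time are the ones described in the definitions
        (EllipsoidTori.IsOrthogonalGeodesic a (β a s) (EllipsoidTori.gammaCurve β a s) ∧
          0 < ℓ ∧ (EllipsoidTori.gammaCurve β a s ℓ).2 = k * Real.pi) ∧
        EllipsoidTori.IsClosedGeodesicOn a (EllipsoidTori.gammaCurve β a s) (-ℓ) ℓ ∧
        -- intersections with the Clifford geodesic
        {t ∈ Set.Icc (-ℓ) ℓ | EllipsoidTori.gammaPoint β a s t ∈
          EllipsoidTori.cliffordGeodesic a}.encard = 2 * j ∧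
        -- winding number around the centre
        EllipsoidTori.HasWindingNumber (fun t => (EllipsoidTori.gammaPoint β a s t).1) (-ℓ) ℓ k ∧
        -- self-intersections on the diameter: pairs of instants, and points
        {x : ℝ × ℝ | x.1 ∈ Set.Ico (-ℓ) ℓ ∧ x.2 ∈ Set.Ico (-ℓ) ℓ ∧ x.1 < x.2 ∧
          EllipsoidTori.gammaPoint β a s x.1 = EllipsoidTori.gammaPoint β a s x.2 ∧
          EllipsoidTori.gammaPoint β a s x.1 ∈ EllipsoidTori.diameter a 0}.encard + 1 = k ∧
        {p ∈ EllipsoidTori.diameter a 0 | ∃ t₁ ∈ Set.Ico (-ℓ) ℓ, ∃ t₂ ∈ Set.Ico (-ℓ) ℓ, t₁ ≠ t₂ ∧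
          EllipsoidTori.gammaPoint β a s t₁ = p ∧
          EllipsoidTori.gammaPoint β a s t₂ = p}.encard + 1 = k) ∧
    (∀ j k j' k' : ℕ, EllipsoidTori.IsLabel j k → EllipsoidTori.IsLabel j' k' →
      (j, k) ≠ (j', k') →
        Disjoint (EllipsoidTori.branch β j k) (EllipsoidTori.branch β j' k') ∧
        ∀ a s s' : ℝ, (a, s) ∈ EllipsoidTori.branch β j k →
          (a, s') ∈ EllipsoidTori.branch β j' k' →
          ¬ EllipsoidTori.Congruent a (EllipsoidTori.torus β a s)
            (EllipsoidTori.torus β a s')) := by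
  refine ⟨fun j k hl a s ℓ hmem hℓ => ?_, fun j k j' k' hl hl' hne => ⟨?_, ?_⟩⟩
  · obtain ⟨hst, hT⟩ := hβ.halfPeriod_of_mem_branch hl hmem.1
    have ha : 0 < a := hst.1
    have hk : 0 < k := by have := hl.2.1; omega
    have hs : s ≠ 0 := fun h0 => hmem.2 ⟨ha, h0⟩
    have hq := hβ.initialHeight_mem hst
    have hq0 := hβ.initialHeight_ne_zero hst hs
    obtain ⟨hpos, hang⟩ := hβ.ell_spec hst hk
    rw [← hℓ] at hpos hang
    obtain ⟨τ, hτ⟩ := hβ.exists_isPhase hst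
    have hO := hβ.isOrthogonalGeodesic hst
    exact ⟨⟨hO, hpos, hang⟩,
      ⟨hO.geodesic, by linarith, hτ.periodic_diskPoint ha hq hT hang⟩,
      hτ.encard_clifford ha hq hq0 hT hang, hτ.hasWindingNumber ha hq hT hang,
      hτ.encard_selfIntersection_pairs ha hq hq0 hl.1 hk hl.2.2 hT hang,
      hτ.encard_selfIntersection_points ha hq hq0 hl.1 hk hl.2.2 hT hang⟩
  · refine Set.disjoint_left.2 ?_
    rintro ⟨a, s⟩ h h'
    exact hne (hl.eq_of_mul_eq hl' (hβ.halfPeriod_of_mem_branch hl h).2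
      (hβ.halfPeriod_of_mem_branch hl' h').2)
  · intro a s s' h h' hc
    obtain ⟨hst, hT⟩ := hβ.halfPeriod_of_mem_branch hl h
    obtain ⟨hst', hT'⟩ := hβ.halfPeriod_of_mem_branch hl' h'
    have heq := hβ.abs_initialHeight_eq_of_congruent hst hst' hc
    -- Equal `|q|` gives one common half period, which cannot satisfy the relations of two different
    -- labels.
    rw [← EllipsoidTori.halfPeriod_eq_of_abs_eq heq] at hT'
    exact hne (hl.eq_of_mul_eq hl' hT hT')
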